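/- Let $\Omega,\Omega'\subset\mathbb R^3$ be smooth bounded domains that are axisymmetric (invariant under all rotations about the $z$-axis), with $\inf_{(x,y,z)\in\Omega}\sqrt{x^2+y^2}>0$, and put $\Omega_0=\{(r,z): r>0,\ (r,0,z)\in\Omega\}$. A map $u:\Omega\to\mathbb R^3$ is called axisymmetric if there is $v=(v_1,v_2):\Omega_0\to\mathbb R^2$ with $v_1\ge 0$ a.e. and, a.e. in $\Omega$, $$u(r\cos\theta,r\sin\theta,z)=v_1(r,z)\,e_r+v_2(r,z)\,e_z,\qquad e_r=(\cos\theta,\sin\theta,0),\ e_z=(0,0,1);$$ $v$ is then called a profile of $u$. Let $g:\overline\Omega\to\overline{\Omega'}$ be an axisymmetric $C^1$-diffeomorphism and $M>0$. Let $H:(0,\infty)\to[0,\infty)$ be convex and $C^1$ with $\lim_{t\to\infty}H(t)/t=\lim_{t\to0^+}H(t)=+\infty$. Assume that there are $s,c_1,c_2,d_0>0$ with $$c_1t^{-s-k}\le(-1)^kH^{(k)}(t)\le c_2t^{-s-k}\quad(k=0,1,\ 0<t<d_0),$$ and $\tau,c_3,c_4,d_1>0$ with $c_3t^{\tau+1}\le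 H'(t)\le c_4t^{\tau+1}$ for $t\ge d_1$. Let $\mathcal A_{nc}^{axi}$ be the set of axisymmetric $u\in W^{1,2}\cap L^\infty(\Omega,\mathbb R^3)$ such that $u=g$ on $\partial\Omega$ in the sense of traces, $\|u\|_\infty\le M$, $\det Du>0$ a.e., $\det Du\in L^1(\Omega)$, $u$ is injective outside a null set, and $\mathcal E(u)=0$, where $$\mathcal E(u)=\sup_f\int_\Omega\langle\operatorname{cof}Du,D_xf(x,u(x))\rangle+\det Du\,\operatorname{div}_yf(x,u(x))\,dx,$$ the supremum being over $f\in C_c^\infty(\Omega\times\mathbb R^3,\mathbb R^3)$ with $\|f\|_\infty\le1$. Let $E(u)=\int_\Omega|Du|^2+H(\det Du)\,dx\in[0,\infty]$. (a) Let $u$ be a minimizer of $E$ in $\mathcal A_{nc}^{axi}$, with $E(u)<\infty$, and let $v$ be a profile of $u$. Then $v\in W^{1,2}(\Omega_0,\mathbb R^2)$ and, with $\delta=\frac{v_1}{r}\det Dv$, $$\frac1r\partial_r\Big(r\big[|\partial_rv|^2-|\partial_zv|^2-\tfrac{v_1^2}{r^2}+H'(\delta)\delta-H(\delta)\big]\Big)+\partial_z(2\,\partial_rv\cdot\partial_zv)=\frac1r\Big[-|Dv|^2+\tfrac{v_1^2}{r^2}+H'(\delta)\delta-H(\delta)\Big],$$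 $$\frac1r\partial_r(2r\,\partial_rv\cdot\partial_zv)+\partial_z\Big[|\partial_zv|^2-|\partial_rv|^2-\tfrac{v_1^2}{r^2}+H'(\delta)\delta-H(\delta)\Big]=0$$ in the sense of distributions in $\Omega_0$, and $$\operatorname{Div}\big(2Du^TDu+[H'(\det Du)\det Du-|Du|^2-H(\det Du)]I\big)=0$$ in the sense of distributions in $\Omega$; the functions to which the derivatives apply, and the right-hand side, are locally integrable. (b) For every $u\in\mathcal A_{nc}^{axi}$ with $E(u)<\infty$ and every profile $v$ of $u$, the two equations for $v$ in $\Omega_0$ hold if and only if the last equation for $u$ holds in $\Omega$. -/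

import Mathlib

open MeasureTheory Filter Topology
open scoped ContDiff

noncomputable section

namespace NeoHookean

/-- `ℝⁿ` with its Euclidean norm and Lebesgue measure. -/
abbrev Eu (n : ℕ) : Type := EuclideanSpace ℝ (Fin n)

/-- The `j`-th vector of the canonical basis of `ℝⁿ`. -/
def basisVec {n : ℕ} (j : Fin n) : Eu n := EuclideanSpace.single j 1

/-- `φ ∈ C_c^∞(U; F)`. -/
def IsTest {E F : Type*} [NormedAddCommGroup E] [NormedSpace ℝ E]
    [NormedAddCommGroup F] [NormedSpace ℝ F] (U : Set E) (φ : E → F) : Prop :=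
  ContDiff ℝ ∞ φ ∧ HasCompactSupport φ ∧ tsupport φ ⊆ U

/-- The partial derivative `∂_j φ (x)` of a (differentiable) scalar function. -/
def pd {n : ℕ} (j : Fin n) (φ : Eu n → ℝ) (x : Eu n) : ℝ := fderiv ℝ φ x (basisVec j)

/-- The classical Jacobian matrix `(∂_j φ_i (x))_{ij}`. -/
def jacobian {m n : ℕ} (φ : Eu m → Eu n) (x : Eu m) : Matrix (Fin n) (Fin m) ℝ :=
  Matrix.of fun i j => fderiv ℝ φ x (basisVec j) i

/-- The squared Frobenius norm `|A|² = tr (Aᵀ A)`. -/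
def frobSq {m n : ℕ} (A : Matrix (Fin n) (Fin m) ℝ) : ℝ := ∑ i, ∑ j, A i j ^ 2

/-- The cofactor matrix, normalized by `Aᵀ * cof A = (det A) I`. -/
def cof {n : ℕ} (A : Matrix (Fin n) (Fin n) ℝ) : Matrix (Fin n) (Fin n) ℝ := A.adjugate.transpose

/-! ### Sobolev spaces -/

/-- `F = (∂_j u_i)_{ij}` is a weak gradient of `u` on the open set `U`. -/
def IsWeakGrad {m n : ℕ} (U : Set (Eu m)) (u : Eu m → Eu n)
    (F : Eu m → Matrix (Fin n) (Fin m) ℝ) : Prop :=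
  (∀ i, LocallyIntegrableOn (fun x => u x i) U) ∧
  (∀ i j, LocallyIntegrableOn (fun x => F x i j) U) ∧
  ∀ i j, ∀ φ : Eu m → ℝ, IsTest U φ →
    ∫ x in U, u x i * pd j φ x = - ∫ x in U, F x i j * φ x

open Classical in
/-- The weak gradient of `u` on `U` (it is unique up to null sets); `0` if there is none. -/
def weakGrad {m n : ℕ} (U : Set (Eu m)) (u : Eu m → Eu n) : Eu m → Matrix (Fin n) (Fin m) ℝ :=
  if h : ∃ F, IsWeakGrad U u F then h.choose else fun _ => 0

theorem weakGrad_spec {m n : ℕ} {U : Set (Eu m)} {u : Eu m → Eu n}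
    (h : ∃ F, IsWeakGrad U u F) : IsWeakGrad U u (weakGrad U u) := by
  unfold weakGrad
  rw [dif_pos h]
  exact h.choose_spec

/-- `u ∈ W^{1,2}(U; ℝⁿ)`. -/
def MemW12 {m n : ℕ} (U : Set (Eu m)) (u : Eu m → Eu n) : Prop :=
  MemLp u 2 (volume.restrict U) ∧
  ∃ F, IsWeakGrad U u F ∧ ∀ i j, MemLp (fun x => F x i j) 2 (volume.restrict U)

/-- `u ∈ W_0^{1,2}(U; ℝⁿ)`, the closure of `C_c^∞(U; ℝⁿ)` in `W^{1,2}(U; ℝⁿ)`. -/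
def MemW120 {m n : ℕ} (U : Set (Eu m)) (u : Eu m → Eu n) : Prop :=
  MemW12 U u ∧ ∃ φ : ℕ → Eu m → Eu n, (∀ k, IsTest U (φ k)) ∧
    Tendsto (fun k => ∫⁻ x in U, ENNReal.ofReal (‖φ k x - u x‖ ^ 2)) atTop (𝓝 0) ∧
    Tendsto (fun k => ∫⁻ x in U, ENNReal.ofReal (frobSq (jacobian (φ k) x - weakGrad U u x)))
      atTop (𝓝 0)

/-! ### Domains and boundary data -/

/-- A bounded domain with smooth boundary: near each boundary point the domain is the
negativity set of a smooth function with non-vanishing differential. -/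
structure IsSmoothBoundedDomain {n : ℕ} (U : Set (Eu n)) : Prop where
  isOpen : IsOpen U
  isConnected : IsConnected U
  isBounded : Bornology.IsBounded U
  smooth_boundary : ∀ x ∈ frontier U, ∃ V : Set (Eu n), IsOpen V ∧ x ∈ V ∧
    ∃ ρ : Eu n → ℝ, ContDiffOn ℝ ∞ ρ V ∧ fderiv ℝ ρ x ≠ 0 ∧
      U ∩ V = {y | ρ y < 0} ∩ V ∧ frontier U ∩ V = {y | ρ y = 0} ∩ V

/-- The rotation of angle `θ` about the `z` axis. -/
def rotZ (θ : ℝ) (x : Eu 3) : Eu 3 :=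
  !₂[Real.cos θ * x 0 - Real.sin θ * x 1, Real.sin θ * x 0 + Real.cos θ * x 1, x 2]

/-- A set that is symmetric about the `z` axis. -/
def IsAxisymmetricSet (U : Set (Eu 3)) : Prop := ∀ θ : ℝ, ∀ x ∈ U, rotZ θ x ∈ U

/-- The distance `r = √(x² + y²)` to the `z` axis. -/
def cylRadius (x : Eu 3) : ℝ := Real.sqrt (x 0 ^ 2 + x 1 ^ 2)

/-- `g` restricts to a `C¹` diffeomorphism from the closure of `U` onto the closure of `U'`. -/
def IsC1DiffeoClosure {n : ℕ} (U U' : Set (Eu n)) (g : Eu n → Eu n) : Prop :=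
  ContDiffOn ℝ 1 g (closure U) ∧ Set.BijOn g (closure U) (closure U') ∧
  ∃ h : Eu n → Eu n, ContDiffOn ℝ 1 h (closure U') ∧ Set.InvOn h g (closure U) (closure U')

/-! ### Axisymmetric maps -/

/-- The meridian section in the coordinates `(r, z)`, `r > 0`. -/
def meridian (Ω : Set (Eu 3)) : Set (Eu 2) := {X | 0 < X 0 ∧ !₂[X 0, 0, X 1] ∈ Ω}

/-- The map `v₁(r, z) e_r + v₂(r, z) e_z` in Cartesian coordinates, where off the axis
`e_r = (x / r, y / r, 0)`. -/
def axiLift (v : Eu 2 → Eu 2) (x : Eu 3) : Eu 3 :=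
  let w : Eu 2 := v !₂[cylRadius x, x 2]
  !₂[w 0 * (x 0 / cylRadius x), w 0 * (x 1 / cylRadius x), w 1]

/-- `u = v₁ e_r + v₂ e_z` (a.e. in `Ω`), with `v₁ ≥ 0` a.e. -/
def IsProfile (Ω : Set (Eu 3)) (u : Eu 3 → Eu 3) (v : Eu 2 → Eu 2) : Prop :=
  (∀ᵐ x ∂(volume.restrict Ω), u x = axiLift v x) ∧
  ∀ᵐ X ∂(volume.restrict (meridian Ω)), 0 ≤ v X 0

/-- `u` is axisymmetric on `Ω`. -/
def IsAxisymmetricMap (Ω : Set (Eu 3)) (u : Eu 3 → Eu 3) : Prop := ∃ v, IsProfile Ω u v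

/-! ### Surface energy, stored energy, admissible classes -/

/-- `∫_Ω ⟨cof Du(x), D_x f(x, u(x))⟩ + det Du(x) div_y f(x, u(x)) dx`. -/
def surfaceFunctional (Ω : Set (Eu 3)) (u : Eu 3 → Eu 3) (f : Eu 3 × Eu 3 → Eu 3) : ℝ :=
  ∫ x in Ω,
    ((∑ i, ∑ j, cof (weakGrad Ω u x) i j * fderiv ℝ f (x, u x) (basisVec j, 0) i) +
      (weakGrad Ω u x).det * ∑ i, fderiv ℝ f (x, u x) (0, basisVec i) i)

/-- The surface energy: the supremum of the surface functional over the fields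
`f ∈ C_c^∞(Ω × ℝ³; ℝ³)` with `‖f‖_∞ ≤ 1`. -/
def surfaceEnergy (Ω : Set (Eu 3)) (u : Eu 3 → Eu 3) : EReal :=
  ⨆ f : {f : Eu 3 × Eu 3 → Eu 3 // IsTest (Ω ×ˢ Set.univ) f ∧ ∀ p, ‖f p‖ ≤ 1},
    (surfaceFunctional Ω u f.1 : EReal)

/-- The neo-Hookean energy `E(u) = ∫_Ω |Du|² + H(det Du)`, with values in `[0, ∞]`. -/
def energy (H : ℝ → ℝ) (Ω : Set (Eu 3)) (u : Eu 3 → Eu 3) : ENNReal :=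
  ∫⁻ x in Ω, ENNReal.ofReal (frobSq (weakGrad Ω u x) + H (weakGrad Ω u x).det)

/-- `u` is one-to-one a.e. in `U`: it is injective on the complement of a null set. -/
def InjectiveAE {n : ℕ} (U : Set (Eu n)) (u : Eu n → Eu n) : Prop :=
  ∃ N : Set (Eu n), volume N = 0 ∧ Set.InjOn u (U \ N)

/-- The class `𝒜`. On a smooth bounded domain, equality of the traces of `u` and `g` on the
boundary is membership of `u - g` in `W_0^{1,2}`. -/
structure Admissible (Ω : Set (Eu 3)) (g : Eu 3 → Eu 3) (M : ℝ) (u : Eu 3 → Eu 3) : Prop where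
  memW12 : MemW12 Ω u
  trace_eq : MemW120 Ω (fun x => u x - g x)
  bound : ∀ᵐ x ∂(volume.restrict Ω), ‖u x‖ ≤ M
  det_pos : ∀ᵐ x ∂(volume.restrict Ω), 0 < (weakGrad Ω u x).det
  injective : InjectiveAE Ω u

/-- The class `𝒜_nc^axi` of axisymmetric admissible maps without surface energy; the surface
energy is defined for maps with `det Du ∈ L¹(Ω)`. -/
structure AdmissibleNcAxi (Ω : Set (Eu 3)) (g : Eu 3 → Eu 3) (M : ℝ) (u : Eu 3 → Eu 3) : Prop
    extends Admissible Ω g M u where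
  det_integrable : IntegrableOn (fun x => (weakGrad Ω u x).det) Ω
  surfaceEnergy_eq_zero : surfaceEnergy Ω u = 0
  axisymmetric : IsAxisymmetricMap Ω u

/-- `u` minimizes `E` in `𝒜_nc^axi` (and the minimum is finite). -/
structure IsMinimizer (H : ℝ → ℝ) (Ω : Set (Eu 3)) (g : Eu 3 → Eu 3) (M : ℝ)
    (u : Eu 3 → Eu 3) : Prop where
  mem : AdmissibleNcAxi Ω g M u
  energy_lt_top : energy H Ω u < ⊤
  le : ∀ w, AdmissibleNcAxi Ω g M w → energy H Ω u ≤ energy H Ω w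

/-- The hypotheses on `H` on `(0, ∞)`: nonnegative, convex, `C¹`, superlinear at `∞`, infinite
limit at `0`, and power growth of `H` and `H'` near `0` and of `H'` near `∞`. -/
structure IsStoredEnergy (H : ℝ → ℝ) : Prop where
  nonneg : ∀ t, 0 < t → 0 ≤ H t
  convex : ConvexOn ℝ (Set.Ioi 0) H
  contDiffOn : ContDiffOn ℝ 1 H (Set.Ioi 0)
  superlinear : Tendsto (fun t => H t / t) atTop atTop
  blowup : Tendsto H (𝓝[>] 0) atTop
  growth_zero : ∃ s c₁ c₂ d₀ : ℝ, 0 < s ∧ 0 < c₁ ∧ 0 < c₂ ∧ 0 < d₀ ∧ ∀ t, 0 < t → t < d₀ →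
    (c₁ * t ^ (-s) ≤ H t ∧ H t ≤ c₂ * t ^ (-s)) ∧
    (c₁ * t ^ (-s - 1) ≤ -deriv H t ∧ -deriv H t ≤ c₂ * t ^ (-s - 1))
  growth_infty : ∃ τ c₃ c₄ d₁ : ℝ, 0 < τ ∧ 0 < c₃ ∧ 0 < c₄ ∧ 0 < d₁ ∧ ∀ t, d₁ ≤ t →
    c₃ * t ^ (τ + 1) ≤ deriv H t ∧ deriv H t ≤ c₄ * t ^ (τ + 1)

/-! ### The equations -/

/-- The energy-momentum tensor `2 Duᵀ Du + [H'(det Du) det Du - |Du|² - H(det Du)] I`. -/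
def energyMomentum (H : ℝ → ℝ) (Ω : Set (Eu 3)) (u : Eu 3 → Eu 3) (x : Eu 3) :
    Matrix (Fin 3) (Fin 3) ℝ :=
  let F := weakGrad Ω u x
  (2 : ℝ) • (F.transpose * F) +
    (deriv H F.det * F.det - frobSq F - H F.det) • (1 : Matrix (Fin 3) (Fin 3) ℝ)

/-- `Div T = 0` in the sense of distributions in `U`, for a locally integrable matrix field:
`∑_j ∂_j T_{ij} = 0` for each `i`. -/
def DistribDivFree {n : ℕ} (U : Set (Eu n)) (T : Eu n → Matrix (Fin n) (Fin n) ℝ) : Prop :=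
  (∀ i j, LocallyIntegrableOn (fun x => T x i j) U) ∧
  ∀ i, ∀ φ : Eu n → ℝ, IsTest U φ → -∑ j, ∫ x in U, T x i j * pd j φ x = 0

section Reduced

variable (H : ℝ → ℝ) (Ω : Set (Eu 3)) (v : Eu 2 → Eu 2) (X : Eu 2)

/-- `|∂_r v|²`. -/
def drSq : ℝ := ∑ i, weakGrad (meridian Ω) v X i 0 ^ 2

/-- `|∂_z v|²`. -/
def dzSq : ℝ := ∑ i, weakGrad (meridian Ω) v X i 1 ^ 2

/-- `∂_r v · ∂_z v`. -/
def drDotDz : ℝ := ∑ i, weakGrad (meridian Ω) v X i 0 * weakGrad (meridian Ω) v X i 1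

/-- `(v₁ / r) det Dv`. -/
def redDet : ℝ := v X 0 / X 0 * (weakGrad (meridian Ω) v X).det

/-- `H'(δ) δ - H(δ)` with `δ = (v₁ / r) det Dv`. -/
def redPressure : ℝ := deriv H (redDet Ω v X) * redDet Ω v X - H (redDet Ω v X)

/-- `|∂_r v|² - |∂_z v|² - v₁² / r² + H'(δ) δ - H(δ)`. -/
def coeffRR : ℝ := drSq Ω v X - dzSq Ω v X - v X 0 ^ 2 / X 0 ^ 2 + redPressure H Ω v X

/-- `|∂_z v|² - |∂_r v|² - v₁² / r² + H'(δ) δ - H(δ)`. -/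
def coeffZZ : ℝ := dzSq Ω v X - drSq Ω v X - v X 0 ^ 2 / X 0 ^ 2 + redPressure H Ω v X

/-- `-|Dv|² + v₁² / r² + H'(δ) δ - H(δ)`. -/
def coeffTT : ℝ := -(drSq Ω v X + dzSq Ω v X) + v X 0 ^ 2 / X 0 ^ 2 + redPressure H Ω v X

end Reduced

/-- For `A, B, C` locally integrable in an open subset `U` of the half-plane `{r > 0}`,
`(1 / r) ∂_r (r A) + ∂_z B = (1 / r) C` in the sense of distributions in `U`. -/
def DistribEq (U : Set (Eu 2)) (A B C : Eu 2 → ℝ) : Prop :=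
  LocallyIntegrableOn A U ∧ LocallyIntegrableOn B U ∧ LocallyIntegrableOn C U ∧
  ∀ ψ : Eu 2 → ℝ, IsTest U ψ →
    -(∫ X in U, (X 0 * A X) * pd 0 (fun Y => 1 / Y 0 * ψ Y) X) - ∫ X in U, B X * pd 1 ψ X =
      ∫ X in U, 1 / X 0 * C X * ψ X

/-- The two equations for the profile `v` in the variables `(r, z)`. -/
def ReducedEquations (H : ℝ → ℝ) (Ω : Set (Eu 3)) (v : Eu 2 → Eu 2) : Prop :=
  DistribEq (meridian Ω) (coeffRR H Ω v) (fun X => 2 * drDotDz Ω v X) (coeffTT H Ω v) ∧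
  DistribEq (meridian Ω) (fun X => 2 * drDotDz Ω v X) (coeffZZ H Ω v) (fun _ => 0)

end NeoHookean

end

open NeoHookean

open MeasureTheory Filter Topology
open scoped ContDiff

noncomputable section

namespace NeoHookean

/-! ### Test functions -/

section Test

variable {E F : Type*} [NormedAddCommGroup E] [NormedSpace ℝ E]
  [NormedAddCommGroup F] [NormedSpace ℝ F] {U : Set E}

/-! Write `T` for the energy-momentum tensor. Both parts follow from `reducedEquations_tfae`: for
axisymmetric maps of finite energy, the reduced equations, `Div T = 0`, and the vanishing of `∫ T :
DX` for every axisymmetric test field `X = ξ₁ e_r + ξ₂ e_z` are equivalent. Part (b) is the first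
equivalence; for part (a) it remains to see that minimizers satisfy the third condition.

The equivalence. In the frame `e_r, e_θ, e_z` the gradient of `u` consists of the block `Dv` and the
single entry `v₁/r` on `e_θ ⊗ e_θ`, with no dependence on the angle (`IsProfile.memW12`). This
shape, `frameGrad`, is stable under the algebra that defines `T`, so `T` has the same shape, with
entries the coefficients of the reduced equations (`energyMomentum_frame`). Paired with `DX` it
gives an integrand free of the angle, and the choice `ξ = (ψ/r) e_l` turns stationarity into the
weak form of the `l`-th reduced equation. Conversely, let `φ` be an arbitrary test function on `Ω`.
In cylindrical coordinates the integrand of `∫ ∑_j T_ij ∂_jφ` splits into two pieces: one is, at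
each fixed angle, a reduced equation tested with `r φ`; the other is, at each fixed `(r, z)`, a
total derivative in the angle, which integrates to zero by periodicity. Since `r` is bounded below
on `Ω`, the weight `r` affects neither integrability nor null sets.

Stationarity of minimizers. Outer variations could destroy injectivity or the sign of the
determinant, so `u` is composed with the inverse `χ` of `id + tX`. For small `t` this is a
diffeomorphism equal to the identity near the boundary, and `u ∘ χ` stays in the class
(`admissibleNcAxi_comp`); in particular the surface energy does not change, since the change of
variables only replaces the test field `f(x, y)` by `f(x + tX(x), y)`. In the original coordinates
the energy of `u ∘ χ` is the integral of the explicit density `varDensity`, whose derivative at `t =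
0` is `-T : DX`. Differentiation under the integral needs a dominating function, and here the growth
of `H` enters: if `t/2 ≤ a ≤ 2t`, then `|H'(a)| a` and `H(a)` are both at most `C (1 + H(t))`
(`IsStoredEnergy.exists_bound`). The same bound makes `T` integrable. -/

theorem IsTest.differentiable {φ : E → F} (h : IsTest U φ) : Differentiable ℝ φ :=
  h.1.differentiable (by simp)

theorem IsTest.mul_left {φ ψ : E → ℝ} (h : IsTest U φ) (hψ : ContDiff ℝ ∞ ψ) :
    IsTest U (fun x => ψ x * φ x) :=
  ⟨hψ.mul h.1, h.2.1.mul_left, (tsupport_mul_subset_right).trans h.2.2⟩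

theorem IsTest.add {φ ψ : E → F} (h : IsTest U φ) (hψ : IsTest U ψ) :
    IsTest U (fun x => φ x + ψ x) :=
  ⟨h.1.add hψ.1, h.2.1.add hψ.2.1, (tsupport_add φ ψ).trans (Set.union_subset h.2.2 hψ.2.2)⟩

theorem IsTest.fderiv_apply {φ : E → F} (h : IsTest U φ) (w : E) :
    IsTest U (fun x => fderiv ℝ φ x w) :=
  ⟨(h.1.fderiv_right (m := ∞) (by simp)).clm_apply contDiff_const, h.2.1.fderiv_apply ℝ w,
    (tsupport_fderiv_apply_subset ℝ w).trans h.2.2⟩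

theorem IsTest.clm_comp {G : Type*} [NormedAddCommGroup G] [NormedSpace ℝ G] {φ : E → F}
    (h : IsTest U φ) (L : F →L[ℝ] G) : IsTest U (fun x => L (φ x)) :=
  ⟨L.contDiff.comp h.1, h.2.1.comp_left L.map_zero,
    (closure_mono (Function.support_comp_subset L.map_zero φ)).trans h.2.2⟩

theorem IsTest.eq_zero_of_notMem {φ : E → F} (h : IsTest U φ) {x : E} (hx : x ∉ U) : φ x = 0 :=
  image_eq_zero_of_notMem_tsupport fun hx' => hx (h.2.2 hx')

theorem IsTest.exists_bound {φ : E → F} (h : IsTest U φ) : ∃ C, ∀ x, ‖φ x‖ ≤ C :=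
  h.2.1.exists_bound_of_continuous h.1.continuous

end Test

theorem IsTest.pd {n : ℕ} {U : Set (Eu n)} {φ : Eu n → ℝ} (h : IsTest U φ) (j : Fin n) :
    IsTest U (pd j φ) :=
  h.fderiv_apply _

theorem IsTest.coord {E : Type*} [NormedAddCommGroup E] [NormedSpace ℝ E] {n : ℕ} {U : Set E}
    {φ : E → Eu n} (h : IsTest U φ) (i : Fin n) : IsTest U (fun x => φ x i) :=
  h.clm_comp (EuclideanSpace.proj i)

theorem fderiv_coord {E : Type*} [NormedAddCommGroup E] [NormedSpace ℝ E] {n : ℕ}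
    {φ : E → Eu n} {x : E} (h : DifferentiableAt ℝ φ x) (i : Fin n) (w : E) :
    fderiv ℝ (fun y => φ y i) x w = fderiv ℝ φ x w i := by
  have := ((EuclideanSpace.proj (𝕜 := ℝ) i).hasFDerivAt.comp x h.hasFDerivAt).fderiv
  change fderiv ℝ ((EuclideanSpace.proj (𝕜 := ℝ) i) ∘ φ) x w = _
  rw [this]; rfl

theorem integrable_mul_of_test {E : Type*} [NormedAddCommGroup E] [NormedSpace ℝ E]
    [MeasurableSpace E] [BorelSpace E] {μ : Measure E} {U : Set E}
    {f φ : E → ℝ} (hf : LocallyIntegrableOn f U μ) (hφ : IsTest U φ) :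
    Integrable (fun x => f x * φ x) (μ.restrict U) := by
  have hK : IsCompact (tsupport φ) := hφ.2.1
  have h1 : IntegrableOn f (tsupport φ) μ :=
    hf.integrableOn_compact_subset hφ.2.2 hK
  have h2 : IntegrableOn (fun x => f x * φ x) (tsupport φ) μ :=
    h1.mul_continuousOn hφ.1.continuous.continuousOn hK
  have h3 : Integrable (fun x => f x * φ x) μ := by
    rw [← integrableOn_iff_integrable_of_support_subset (s := tsupport φ)]
    · exact h2
    · intro x hx
      exact subset_tsupport _ (right_ne_zero_of_mul hx)
  exact h3.integrableOn

/-! ### Weak gradients -/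

section WeakGrad

variable {m n : ℕ} {U : Set (Eu m)} {u w : Eu m → Eu n} {F G : Eu m → Matrix (Fin n) (Fin m) ℝ}

theorem ae_eq_of_integral_test_eq {U : Set (Eu m)} (hU : IsOpen U) {f g : Eu m → ℝ}
    (hf : LocallyIntegrableOn f U) (hg : LocallyIntegrableOn g U)
    (h : ∀ φ : Eu m → ℝ, IsTest U φ → ∫ x in U, f x * φ x = ∫ x in U, g x * φ x) :
    ∀ᵐ x ∂(volume.restrict U), f x = g x := by
  rw [ae_restrict_iff' hU.measurableSet]
  have := hU.ae_eq_zero_of_integral_contDiff_smul_eq_zero (f := fun x => f x - g x)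
    (μ := volume) (hf.sub hg) ?_
  · filter_upwards [this] with x hx hxU using sub_eq_zero.1 (hx hxU)
  · intro φ h1 h2 h3
    have hφ : IsTest U φ := ⟨h1, h2, h3⟩
    have e : ∫ x in U, φ x • (f x - g x) = ∫ x, φ x • (f x - g x) := by
      apply setIntegral_eq_integral_of_forall_compl_eq_zero
      intro x hx
      simp [hφ.eq_zero_of_notMem hx]
    rw [← e]
    have : ∀ x, φ x • (f x - g x) = f x * φ x - g x * φ x := by
      intro x; simp only [smul_eq_mul]; ring
    simp_rw [this]
    rw [integral_sub (integrable_mul_of_test hf hφ) (integrable_mul_of_test hg hφ),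
      h φ hφ, sub_self]

theorem IsWeakGrad.ae_eq (hU : IsOpen U) (hF : IsWeakGrad U u F) (hG : IsWeakGrad U u G) :
    ∀ᵐ x ∂(volume.restrict U), F x = G x := by
  have : ∀ i j, ∀ᵐ x ∂(volume.restrict U), F x i j = G x i j := by
    intro i j
    refine ae_eq_of_integral_test_eq hU (hF.2.1 i j) (hG.2.1 i j) fun φ hφ => ?_
    have h1 := hF.2.2 i j φ hφ
    have h2 := hG.2.2 i j φ hφ
    linarith
  have h2 : ∀ᵐ x ∂(volume.restrict U), ∀ i j, F x i j = G x i j :=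
    ae_all_iff.2 fun i => ae_all_iff.2 fun j => this i j
  filter_upwards [h2] with x hx
  ext i j; exact hx i j

theorem IsWeakGrad.weakGrad_ae_eq (hU : IsOpen U) (hF : IsWeakGrad U u F) :
    ∀ᵐ x ∂(volume.restrict U), weakGrad U u x = F x :=
  (weakGrad_spec ⟨F, hF⟩).ae_eq hU hF

theorem locallyIntegrableOn_congr_ae {E : Type*} [MeasurableSpace E] [TopologicalSpace E]
    {μ : Measure E} {U : Set E} {f g : E → ℝ}
    (h : ∀ᵐ x ∂(μ.restrict U), f x = g x) (hf : LocallyIntegrableOn f U μ) :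
    LocallyIntegrableOn g U μ := by
  intro x hx
  obtain ⟨s, hs, hfs⟩ := hf x hx
  -- The functions are only known to agree inside `U`, so the neighbourhood is cut down to `U`.
  refine ⟨s ∩ U, inter_mem hs self_mem_nhdsWithin, ?_⟩
  have h1 : IntegrableOn f (s ∩ U) μ := hfs.mono_set Set.inter_subset_left
  refine h1.congr ?_
  exact ae_mono (Measure.restrict_mono Set.inter_subset_right le_rfl) h

theorem IsWeakGrad.congr_ae (hF : IsWeakGrad U u F)
    (h : ∀ᵐ x ∂(volume.restrict U), u x = w x) : IsWeakGrad U w F := by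
  refine ⟨fun i => locallyIntegrableOn_congr_ae ?_ (hF.1 i), hF.2.1, fun i j φ hφ => ?_⟩
  · filter_upwards [h] with x hx using by rw [hx]
  · rw [← hF.2.2 i j φ hφ]
    exact integral_congr_ae (by filter_upwards [h] with x hx using by rw [hx])

theorem IsWeakGrad.add (hF : IsWeakGrad U u F) (hG : IsWeakGrad U w G) :
    IsWeakGrad U (fun x => u x + w x) (fun x => F x + G x) := by
  refine ⟨fun i => (hF.1 i).add (hG.1 i), fun i j => (hF.2.1 i j).add (hG.2.1 i j),
    fun i j φ hφ => ?_⟩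
  have e1 : ∀ x, (u x + w x) i * NeoHookean.pd j φ x =
    u x i * NeoHookean.pd j φ x + w x i * NeoHookean.pd j φ x := by
      intro x; simp only [PiLp.add_apply]; ring
  have e2 : ∀ x, (F x + G x) i j * φ x = F x i j * φ x + G x i j * φ x := by
      intro x; simp only [Matrix.add_apply]; ring
  simp_rw [e1, e2]
  rw [integral_add (integrable_mul_of_test (hF.1 i) (hφ.pd j))
    (integrable_mul_of_test (hG.1 i) (hφ.pd j)),
    integral_add (integrable_mul_of_test (hF.2.1 i j) hφ)
    (integrable_mul_of_test (hG.2.1 i j) hφ), hF.2.2 i j φ hφ, hG.2.2 i j φ hφ]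
  ring

theorem MemW12.isWeakGrad (h : MemW12 U u) : IsWeakGrad U u (weakGrad U u) := by
  obtain ⟨-, F, hF, -⟩ := h
  exact weakGrad_spec ⟨F, hF⟩

theorem MemW12.memLp_weakGrad (hU : IsOpen U) (h : MemW12 U u) (i : Fin n) (j : Fin m) :
    MemLp (fun x => weakGrad U u x i j) 2 (volume.restrict U) := by
  obtain ⟨-, F, hF, hF2⟩ := h
  refine (memLp_congr_ae ?_).2 (hF2 i j)
  filter_upwards [hF.weakGrad_ae_eq hU] with x hx using by rw [hx]

theorem MemW12.add (hu : MemW12 U u) (hw : MemW12 U w) :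
    MemW12 U (fun x => u x + w x) := by
  obtain ⟨h1, F, hF, hF2⟩ := hu
  obtain ⟨h2, G, hG, hG2⟩ := hw
  exact ⟨h1.add h2, _, hF.add hG, fun i j => (hF2 i j).add (hG2 i j)⟩

end WeakGrad

theorem isFiniteMeasure_restrict_of_isBounded {n : ℕ} {U : Set (Eu n)}
    (h : Bornology.IsBounded U) : IsFiniteMeasure (volume.restrict U) :=
  ⟨by simpa using h.measure_lt_top⟩

theorem frobSq_nonneg {m n : ℕ} (A : Matrix (Fin n) (Fin m) ℝ) : 0 ≤ frobSq A :=
  Finset.sum_nonneg fun _ _ => Finset.sum_nonneg fun _ _ => sq_nonneg _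

/-! ### Cylindrical coordinates -/

/-- The point of `ℝ³` with cylindrical coordinates `(r, θ, z)`, where `X = (r, z)`. -/
def cyl (X : Eu 2) (θ : ℝ) : Eu 3 := !₂[X 0 * Real.cos θ, X 0 * Real.sin θ, X 1]

/-- The coordinates `(r, z)` of a point of `ℝ³`. -/
def cylProj (x : Eu 3) : Eu 2 := !₂[cylRadius x, x 2]

@[simp] theorem cyl_zero (X : Eu 2) (θ : ℝ) : cyl X θ 0 = X 0 * Real.cos θ := rfl
@[simp] theorem cyl_one (X : Eu 2) (θ : ℝ) : cyl X θ 1 = X 0 * Real.sin θ := rfl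
@[simp] theorem cyl_two (X : Eu 2) (θ : ℝ) : cyl X θ 2 = X 1 := rfl
@[simp] theorem cylProj_zero (x : Eu 3) : cylProj x 0 = cylRadius x := rfl
@[simp] theorem cylProj_one (x : Eu 3) : cylProj x 1 = x 2 := rfl

theorem cylRadius_cyl {X : Eu 2} (h : 0 ≤ X 0) (θ : ℝ) : cylRadius (cyl X θ) = X 0 := by
  rw [cylRadius, cyl_zero, cyl_one, show (X 0 * Real.cos θ) ^ 2 + (X 0 * Real.sin θ) ^ 2 =
    X 0 ^ 2 by linear_combination X 0 ^ 2 * Real.cos_sq_add_sin_sq θ, Real.sqrt_sq h]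

theorem cylProj_cyl {X : Eu 2} (h : 0 ≤ X 0) (θ : ℝ) : cylProj (cyl X θ) = X := by
  ext i
  fin_cases i
  · simpa using cylRadius_cyl h θ
  · simp

theorem exists_eq_cyl (x : Eu 3) : ∃ θ, x = cyl (cylProj x) θ := by
  by_cases h : cylRadius x = 0
  · refine ⟨0, ?_⟩
    have h2 : x 0 ^ 2 + x 1 ^ 2 = 0 := by
      rwa [cylRadius, Real.sqrt_eq_zero (by positivity)] at h
    have h0 : x 0 = 0 := by nlinarith [sq_nonneg (x 0), sq_nonneg (x 1)]
    have h1 : x 1 = 0 := by nlinarith [sq_nonneg (x 0), sq_nonneg (x 1)]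
    ext i
    fin_cases i <;> simp [h, h0, h1]
  · have key : ‖(⟨x 0, x 1⟩ : ℂ)‖ = cylRadius x := by
      rw [Complex.norm_def, Complex.normSq_mk, cylRadius]; congr 1; ring
    refine ⟨Complex.arg ⟨x 0, x 1⟩, ?_⟩
    ext i
    fin_cases i
    · have := Complex.norm_mul_cos_arg ⟨x 0, x 1⟩
      simpa [key] using this.symm
    · have := Complex.norm_mul_sin_arg ⟨x 0, x 1⟩
      simpa [key] using this.symm
    · simp

theorem rotZ_cyl (X : Eu 2) (θ η : ℝ) : rotZ η (cyl X θ) = cyl X (η + θ) := by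
  ext i
  fin_cases i <;> simp [rotZ, Real.cos_add, Real.sin_add] <;> ring

theorem cyl_angle_zero (X : Eu 2) : cyl X 0 = !₂[X 0, 0, X 1] := by
  ext i; fin_cases i <;> simp

theorem cyl_mem_iff {Ω : Set (Eu 3)} (hΩ : IsAxisymmetricSet Ω) {X : Eu 2} (hX : 0 < X 0) (θ : ℝ) :
    cyl X θ ∈ Ω ↔ X ∈ meridian Ω := by
  constructor
  · intro h
    refine ⟨hX, ?_⟩
    have := hΩ (-θ) _ h
    rwa [rotZ_cyl, neg_add_cancel, cyl_angle_zero] at this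
  · rintro ⟨-, h⟩
    rw [← cyl_angle_zero] at h
    have := hΩ θ _ h
    rwa [rotZ_cyl, add_zero] at this

theorem continuous_cylRadius : Continuous cylRadius := by
  unfold cylRadius; fun_prop

theorem continuous_cylProj : Continuous cylProj := by
  unfold cylProj
  refine (PiLp.continuous_toLp 2 _).comp (continuous_pi fun i => ?_)
  fin_cases i
  · exact continuous_cylRadius
  · simp; fun_prop

theorem contDiff_cyl : ContDiff ℝ ∞ (fun p : Eu 2 × ℝ => cyl p.1 p.2) := by
  rw [contDiff_euclidean]
  intro i
  have h0 : ContDiff ℝ ∞ (fun p : Eu 2 × ℝ => p.1 0) :=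
    (contDiff_euclidean.1 contDiff_fst 0)
  have h1 : ContDiff ℝ ∞ (fun p : Eu 2 × ℝ => p.1 1) :=
    (contDiff_euclidean.1 contDiff_fst 1)
  fin_cases i
  · exact h0.mul (Real.contDiff_cos.comp contDiff_snd)
  · exact h0.mul (Real.contDiff_sin.comp contDiff_snd)
  · exact h1

theorem continuous_cyl : Continuous (fun p : Eu 2 × ℝ => cyl p.1 p.2) :=
  contDiff_cyl.continuous

theorem isOpen_meridian {Ω : Set (Eu 3)} (hΩ : IsOpen Ω) : IsOpen (meridian Ω) := by
  have h0 : IsOpen {X : Eu 2 | 0 < X 0} := isOpen_lt continuous_const (by fun_prop)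
  refine h0.inter ?_
  have : Continuous fun X : Eu 2 => cyl X 0 := continuous_cyl.comp (continuous_id.prodMk continuous_const)
  simp_rw [← cyl_angle_zero]
  exact hΩ.preimage this

/-- The measure `r dr dz` on the meridian section. -/
def merMeas (Ω : Set (Eu 3)) : Measure (Eu 2) :=
  (volume.restrict (meridian Ω)).withDensity fun X => ENNReal.ofReal (X 0)

/-- Lebesgue measure on an interval of angles. -/
def angMeas : Measure ℝ := volume.restrict (Set.Ioo (-Real.pi) Real.pi)

instance : IsFiniteMeasure angMeas := ⟨by simp [angMeas]⟩

theorem measurePreserving_prod_eu2 :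
    MeasurePreserving (fun p : ℝ × ℝ => (!₂[p.1, p.2] : Eu 2)) := by
  have h := (PiLp.volume_preserving_toLp (Fin 2)).comp (volume_preserving_finTwoArrow ℝ).symm
  refine (congrArg (fun f => MeasurePreserving f volume volume) ?_).mp h
  funext p
  refine PiLp.ext fun i => ?_
  fin_cases i <;> rfl

/-- The axial coordinate is split off first, leaving the horizontal pair to which polar coordinates
apply. -/
theorem measurePreserving_prod_eu3 :
    MeasurePreserving (fun p : ℝ × ℝ × ℝ => (!₂[p.2.1, p.2.2, p.1] : Eu 3)) := by
  have h1 : MeasurePreserving (Prod.map id (MeasurableEquiv.finTwoArrow (α := ℝ)).symm)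
      (volume : Measure (ℝ × ℝ × ℝ)) (volume : Measure (ℝ × (Fin 2 → ℝ))) :=
    (MeasurePreserving.id _).prod (volume_preserving_finTwoArrow ℝ).symm
  have h := ((PiLp.volume_preserving_toLp (Fin 3)).comp
    (volume_preserving_piFinSuccAbove (fun _ : Fin 3 => ℝ) 2).symm).comp h1
  refine (congrArg (fun f => MeasurePreserving f volume volume) ?_).mp h
  funext p
  refine PiLp.ext fun i => ?_
  fin_cases i <;> rfl

/-- Tonelli in `z`, then polar coordinates in each horizontal plane. The angles run over `(-π, π)`,
as in the target of `polarCoord`. -/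
theorem lintegral_cyl {f : Eu 3 → ENNReal} (hf : Measurable f) :
    ∫⁻ X : Eu 2 in {X | 0 < X 0}, ∫⁻ θ, ENNReal.ofReal (X 0) * f (cyl X θ) ∂angMeas =
      ∫⁻ x, f x := by
  have hcyl : Measurable (fun p : Eu 2 × ℝ => f (cyl p.1 p.2)) := hf.comp continuous_cyl.measurable
  rw [← measurePreserving_prod_eu3.lintegral_comp hf,
    ← measurePreserving_prod_eu2.setLIntegral_comp_preimage (measurableSet_lt measurable_const
      (by fun_prop)) (f := fun X => ∫⁻ θ, ENNReal.ofReal (X 0) * f (cyl X θ) ∂angMeas)]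
  · have hm3 : Measurable fun p : ℝ × ℝ × ℝ => f !₂[p.2.1, p.2.2, p.1] :=
      hf.comp measurePreserving_prod_eu3.measurable
    have e3 : ∫⁻ p : ℝ × ℝ × ℝ, f !₂[p.2.1, p.2.2, p.1] = ∫⁻ z, ∫⁻ q : ℝ × ℝ, f !₂[q.1, q.2, z] :=
      lintegral_prod _ hm3.aemeasurable
    rw [e3]
    have hset : (fun p : ℝ × ℝ => (!₂[p.1, p.2] : Eu 2)) ⁻¹' {X | 0 < X 0} =
        Set.Ioi (0 : ℝ) ×ˢ Set.univ := by ext p; simp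
    rw [hset, Measure.volume_eq_prod, ← Measure.prod_restrict, Measure.restrict_univ]
    have hmt : Measurable fun q : (ℝ × ℝ) × ℝ =>
        ENNReal.ofReal q.1.1 * f (cyl !₂[q.1.1, q.1.2] q.2) :=
      (ENNReal.measurable_ofReal.comp (by fun_prop)).mul
        (hcyl.comp ((measurePreserving_prod_eu2.measurable.comp measurable_fst).prodMk
          measurable_snd))
    rw [lintegral_prod_symm]
    · refine lintegral_congr fun z => ?_
      rw [← Measure.volume_eq_prod, ← lintegral_comp_polarCoord_symm, polarCoord_target, Measure.volume_eq_prod,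
        ← Measure.prod_restrict, lintegral_prod]
      · simp [cyl, angMeas]
      · refine (Measurable.mul (by fun_prop) ?_).aemeasurable
        exact hm3.comp (measurable_const.prodMk continuous_polarCoord_symm.measurable)
    · exact (Measurable.lintegral_prod_right' (f := fun q : (ℝ × ℝ) × ℝ =>
        ENNReal.ofReal q.1.1 * f (cyl !₂[q.1.1, q.1.2] q.2)) hmt).aemeasurable
  · refine Measurable.lintegral_prod_right' (f := fun p : Eu 2 × ℝ =>
      ENNReal.ofReal (p.1 0) * f (cyl p.1 p.2)) ?_
    exact Measurable.mul (by fun_prop) hcyl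

/-- Axisymmetry makes the indicator of `Ω` along a circle independent of the angle, so the cut-off
of `lintegral_cyl` to `Ω` is a cut-off to the meridian section. -/
theorem measurePreserving_cyl {Ω : Set (Eu 3)} (hΩo : IsOpen Ω) (hΩ : IsAxisymmetricSet Ω) :
    MeasurePreserving (fun p : Eu 2 × ℝ => cyl p.1 p.2) ((merMeas Ω).prod angMeas)
      (volume.restrict Ω) := by
  refine ⟨continuous_cyl.measurable, ?_⟩
  refine Measure.ext_of_lintegral _ fun f hf => ?_
  have hcyl : Measurable (fun p : Eu 2 × ℝ => f (cyl p.1 p.2)) := hf.comp continuous_cyl.measurable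
  rw [lintegral_map hf continuous_cyl.measurable, lintegral_prod _ hcyl.aemeasurable, merMeas,
    lintegral_withDensity_eq_lintegral_mul₀ (by fun_prop)
      (Measurable.lintegral_prod_right' (f := fun p : Eu 2 × ℝ => f (cyl p.1 p.2)) hcyl).aemeasurable,
    ← lintegral_indicator hΩo.measurableSet, ← lintegral_cyl (hf.indicator hΩo.measurableSet)]
  have hsub : meridian Ω ⊆ {X : Eu 2 | 0 < X 0} := fun X hX => hX.1
  have hmeas : MeasurableSet {X : Eu 2 | 0 < X 0} := measurableSet_lt measurable_const (by fun_prop)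
  have hmo := (isOpen_meridian hΩo).measurableSet
  rw [← Set.inter_eq_left.2 hsub, ← Measure.restrict_restrict hmo, ← lintegral_indicator hmo]
  refine setLIntegral_congr_fun hmeas fun X hX => ?_
  by_cases h : X ∈ meridian Ω
  · have : ∀ θ, Ω.indicator f (cyl X θ) = f (cyl X θ) := fun θ =>
      Set.indicator_of_mem ((cyl_mem_iff hΩ hX θ).2 h) _
    simp only [this, Set.indicator_of_mem h, Pi.mul_apply]
    rw [lintegral_const_mul]
    exact hcyl.comp (measurable_const.prodMk measurable_id)
  · have : ∀ θ, Ω.indicator f (cyl X θ) = 0 := fun θ =>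
      Set.indicator_of_notMem (fun h' => h ((cyl_mem_iff hΩ hX θ).1 h')) _
    simp [this, Set.indicator_of_notMem h]

/-- A bounded axisymmetric open set at positive distance from the axis. -/
structure IsAxiDomain (Ω : Set (Eu 3)) : Prop where
  isOpen : IsOpen Ω
  isBounded : Bornology.IsBounded Ω
  axi : IsAxisymmetricSet Ω
  away : ∃ r₀ : ℝ, 0 < r₀ ∧ ∀ x ∈ Ω, r₀ ≤ cylRadius x

/-- The measure `dr dz dθ` on the product of the meridian section and the interval of angles. -/
def cylMeas (Ω : Set (Eu 3)) : Measure (Eu 2 × ℝ) :=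
  (volume.restrict (meridian Ω)).prod angMeas

theorem angMeas_univ : angMeas.real Set.univ = 2 * Real.pi := by
  simp [angMeas, Measure.real, Real.pi_pos.le]
  ring

theorem angMeas_ne_zero : angMeas ≠ 0 := by
  intro h
  have := angMeas_univ
  rw [h] at this
  simp at this

/-! ### Transfer of null sets and integrals between `Ω` and the product of the meridian section with
the angles. -/

namespace IsAxiDomain

variable {Ω : Set (Eu 3)} (D : IsAxiDomain Ω)
include D

theorem isOpen_meridian : IsOpen (meridian Ω) := NeoHookean.isOpen_meridian D.isOpen

theorem cylRadius_pos {x : Eu 3} (hx : x ∈ Ω) : 0 < cylRadius x := by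
  obtain ⟨r₀, h0, h⟩ := D.away
  exact h0.trans_le (h x hx)

theorem cyl_mem {X : Eu 2} (hX : X ∈ meridian Ω) (θ : ℝ) : cyl X θ ∈ Ω :=
  (cyl_mem_iff D.axi hX.1 θ).2 hX

theorem cylProj_mem {x : Eu 3} (hx : x ∈ Ω) : cylProj x ∈ meridian Ω := by
  obtain ⟨θ, hθ⟩ := exists_eq_cyl x
  rw [hθ] at hx
  refine (cyl_mem_iff D.axi ?_ θ).1 hx
  rw [← hθ] at hx
  exact D.cylRadius_pos hx

theorem mem_of_cylProj_mem {x : Eu 3} (hx : cylProj x ∈ meridian Ω) : x ∈ Ω := by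
  obtain ⟨θ, hθ⟩ := exists_eq_cyl x
  rw [hθ]
  exact D.cyl_mem hx θ

theorem exists_radius_le : ∃ r₀, 0 < r₀ ∧ ∀ X ∈ meridian Ω, r₀ ≤ X 0 := by
  obtain ⟨r₀, h0, h⟩ := D.away
  refine ⟨r₀, h0, fun X hX => ?_⟩
  rw [← cylRadius_cyl hX.1.le 0]
  exact h _ (D.cyl_mem hX 0)

theorem isBounded_meridian : Bornology.IsBounded (meridian Ω) := by
  obtain ⟨C, hC⟩ := D.isBounded.exists_norm_le
  refine isBounded_iff_forall_norm_le.2 ⟨C, fun X hX => ?_⟩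
  have h1 := hC _ (D.cyl_mem hX 0)
  have : ‖X‖ = ‖cyl X 0‖ := by
    simp [EuclideanSpace.norm_eq, Fin.sum_univ_succ]
  rw [this]; exact h1

theorem finite_volume : IsFiniteMeasure (volume.restrict Ω) :=
  isFiniteMeasure_restrict_of_isBounded D.isBounded

theorem ae_cylMeas_mem : ∀ᵐ p ∂(cylMeas Ω), p.1 ∈ meridian Ω := by
  have h : ∀ᵐ X ∂(volume.restrict (meridian Ω)), X ∈ meridian Ω :=
    ae_restrict_mem D.isOpen_meridian.measurableSet
  exact Measure.quasiMeasurePreserving_fst.ae h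

/-- The weight `r` is moved from the first factor to the whole product, so that it appears below as
an explicit factor under integrals for `dr dz dθ`. -/
theorem map_cylMeas :
    Measure.map (fun p : Eu 2 × ℝ => cyl p.1 p.2)
      ((cylMeas Ω).withDensity fun p => ENNReal.ofReal (p.1 0)) = volume.restrict Ω := by
  rw [← (measurePreserving_cyl D.isOpen D.axi).map_eq, merMeas, prod_withDensity_left₀]
  · rfl
  · fun_prop

theorem quasiMeasurePreserving_cyl :
    Measure.QuasiMeasurePreserving (fun p : Eu 2 × ℝ => cyl p.1 p.2) (cylMeas Ω)
      (volume.restrict Ω) := by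
  refine ⟨continuous_cyl.measurable, ?_⟩
  rw [← D.map_cylMeas]
  refine Measure.AbsolutelyContinuous.map ?_ continuous_cyl.measurable
  refine withDensity_absolutelyContinuous' (by fun_prop) ?_
  filter_upwards [D.ae_cylMeas_mem] with p hp
  simpa using hp.1

/-- Functions on the section are only almost everywhere measurable; this is what makes their
composition with `cylProj` measurable on `Ω`. -/
theorem quasiMeasurePreserving_cylProj :
    Measure.QuasiMeasurePreserving cylProj (volume.restrict Ω)
      (volume.restrict (meridian Ω)) := by
  refine ⟨continuous_cylProj.measurable, ?_⟩
  refine Measure.AbsolutelyContinuous.mk fun s hs h0 => ?_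
  rw [Measure.map_apply continuous_cylProj.measurable hs, ← D.map_cylMeas, Measure.map_apply
    continuous_cyl.measurable (continuous_cylProj.measurable hs)]
  refine withDensity_absolutelyContinuous _ _ ?_
  have h1 : ∀ᵐ X ∂(volume.restrict (meridian Ω)), X ∉ s := by
    rw [ae_iff]; simpa using h0
  have h2 : ∀ᵐ p ∂(cylMeas Ω), p.1 ∉ s := Measure.quasiMeasurePreserving_fst.ae h1
  have h3 : ∀ᵐ p ∂(cylMeas Ω), ¬ (p ∈ (fun p : Eu 2 × ℝ => cyl p.1 p.2) ⁻¹' (cylProj ⁻¹' s)) := by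
    filter_upwards [h2, D.ae_cylMeas_mem] with p hp hp2
    simpa [cylProj_cyl hp2.1.le] using hp
  exact measure_eq_zero_iff_ae_notMem.2 h3

theorem integrable_cyl {f : Eu 3 → ℝ} (hf : AEStronglyMeasurable f (volume.restrict Ω)) :
    IntegrableOn f Ω ↔ Integrable (fun p : Eu 2 × ℝ => p.1 0 * f (cyl p.1 p.2)) (cylMeas Ω) := by
  have hf' := hf
  rw [← D.map_cylMeas] at hf'
  rw [IntegrableOn, ← D.map_cylMeas, integrable_map_measure hf' continuous_cyl.aemeasurable,
    integrable_withDensity_iff_integrable_smul' (by fun_prop) (by simp)]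
  refine integrable_congr ?_
  filter_upwards [D.ae_cylMeas_mem] with p hp
  simp [ENNReal.toReal_ofReal hp.1.le]

theorem integral_cyl {f : Eu 3 → ℝ} (hf : AEStronglyMeasurable f (volume.restrict Ω)) :
    ∫ x in Ω, f x = ∫ p, p.1 0 * f (cyl p.1 p.2) ∂(cylMeas Ω) := by
  have hf' := hf
  rw [← D.map_cylMeas] at hf'
  rw [← D.map_cylMeas, integral_map continuous_cyl.aemeasurable hf',
    integral_withDensity_eq_integral_toReal_smul (by fun_prop) (by simp)]
  refine integral_congr_ae ?_
  filter_upwards [D.ae_cylMeas_mem] with p hp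
  simp [ENNReal.toReal_ofReal hp.1.le]

omit D in
theorem ae_cylMeas_angle : ∀ᵐ p ∂(cylMeas Ω), p.2 ∈ Set.Ioo (-Real.pi) Real.pi := by
  have h : ∀ᵐ θ ∂angMeas, θ ∈ Set.Ioo (-Real.pi) Real.pi := ae_restrict_mem measurableSet_Ioo
  exact Measure.quasiMeasurePreserving_snd.ae h

/-- The section and the range of angles are bounded, so a continuous factor is bounded there. This
disposes of all frame vectors, test functions and powers of `r` in later integrands. -/
theorem integrable_mul_continuous {h : Eu 2 → ℝ} (hh : IntegrableOn h (meridian Ω))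
    {b : Eu 2 × ℝ → ℝ} (hb : Continuous b) :
    Integrable (fun p => h p.1 * b p) (cylMeas Ω) := by
  have hK : IsCompact (closure (meridian Ω) ×ˢ Set.Icc (-Real.pi) Real.pi) :=
    D.isBounded_meridian.isCompact_closure.prod isCompact_Icc
  obtain ⟨C, hC⟩ := hK.exists_bound_of_continuousOn hb.continuousOn
  have h1 : Integrable (fun p : Eu 2 × ℝ => h p.1) (cylMeas Ω) := Integrable.comp_fst hh angMeas
  refine h1.mul_bdd (c := C) hb.aestronglyMeasurable ?_
  filter_upwards [D.ae_cylMeas_mem, ae_cylMeas_angle] with p hp hp2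
  exact hC p ⟨subset_closure hp, Set.Ioo_subset_Icc_self hp2⟩

theorem integrableOn_of_cyl {f : Eu 3 → ℝ} (hf : AEStronglyMeasurable f (volume.restrict Ω))
    {g : Eu 2 × ℝ → ℝ} (hg : Integrable g (cylMeas Ω))
    (h : ∀ X ∈ meridian Ω, ∀ θ, X 0 * f (cyl X θ) = g (X, θ)) : IntegrableOn f Ω := by
  rw [D.integrable_cyl hf]
  refine hg.congr ?_
  filter_upwards [D.ae_cylMeas_mem] with p hp using (h p.1 hp p.2).symm

/-- Removing the weight `r` costs a factor `1 / r₀`; the positive distance to the axis is used here.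
-/
theorem integrable_comp_cyl {f : Eu 3 → ℝ} (hf : IntegrableOn f Ω) :
    Integrable (fun p : Eu 2 × ℝ => f (cyl p.1 p.2)) (cylMeas Ω) := by
  obtain ⟨r₀, hr0, hr⟩ := D.exists_radius_le
  have h1 := (D.integrable_cyl hf.aestronglyMeasurable).1 hf
  have h2 : Integrable (fun p : Eu 2 × ℝ => (p.1 0 * f (cyl p.1 p.2)) * (p.1 0)⁻¹) (cylMeas Ω) := by
    refine h1.mul_bdd (c := r₀⁻¹) (by fun_prop) ?_
    filter_upwards [D.ae_cylMeas_mem] with p hp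
    rw [Real.norm_eq_abs, abs_of_nonneg (inv_nonneg.2 hp.1.le)]
    exact inv_anti₀ hr0 (hr _ hp)
  refine h2.congr ?_
  filter_upwards [D.ae_cylMeas_mem] with p hp
  have := hp.1.ne'
  field_simp

theorem aestronglyMeasurable_comp_cylProj {h : Eu 2 → ℝ}
    (hh : AEStronglyMeasurable h (volume.restrict (meridian Ω))) :
    AEStronglyMeasurable (fun x => h (cylProj x)) (volume.restrict Ω) :=
  hh.comp_quasiMeasurePreserving D.quasiMeasurePreserving_cylProj

-- This lemma and the next are the two ways in which integrals over the product are shown to vanish: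
-- a weak equation on the section at each fixed angle, or periodicity in the angle at each fixed
-- `(r, z)`.
omit D in
theorem integral_eq_zero_of_forall_angle {f : Eu 2 × ℝ → ℝ} (hf : Integrable f (cylMeas Ω))
    (h : ∀ θ, ∫ X in meridian Ω, f (X, θ) = 0) : ∫ p, f p ∂(cylMeas Ω) = 0 := by
  rw [cylMeas, integral_prod_symm f hf]
  simp [h]

theorem integral_eq_zero_of_forall_meridian {f : Eu 2 × ℝ → ℝ} (hf : Integrable f (cylMeas Ω))
    (h : ∀ X ∈ meridian Ω, ∫ θ, f (X, θ) ∂angMeas = 0) : ∫ p, f p ∂(cylMeas Ω) = 0 := by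
  rw [cylMeas, integral_prod f hf]
  rw [setIntegral_congr_fun D.isOpen_meridian.measurableSet (g := fun _ => 0) h]
  simp

end IsAxiDomain

/-! ### The moving frame -/

/-- The frame vector `e_r`. -/
def eR (θ : ℝ) : Fin 3 → ℝ := ![Real.cos θ, Real.sin θ, 0]
/-- The frame vector `e_θ`. -/
def eT (θ : ℝ) : Fin 3 → ℝ := ![-Real.sin θ, Real.cos θ, 0]
/-- The frame vector `e_z`. -/
def eZ : Fin 3 → ℝ := ![0, 0, 1]
/-- The frame vectors `e_r`, `e_z`. -/
def frm (l : Fin 2) (θ : ℝ) : Fin 3 → ℝ := ![eR θ, eZ] l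
/-- The component of a profile that enters the `i`-th Cartesian component. -/
def prof (i : Fin 3) : Fin 2 := ![0, 0, 1] i

theorem hasDerivAt_eR (i : Fin 3) (θ : ℝ) : HasDerivAt (fun t => eR t i) (eT θ i) θ := by
  fin_cases i
  · exact Real.hasDerivAt_cos θ
  · exact Real.hasDerivAt_sin θ
  · exact hasDerivAt_const _ _

theorem hasDerivAt_eT (i : Fin 3) (θ : ℝ) : HasDerivAt (fun t => eT t i) (-eR θ i) θ := by
  fin_cases i
  · exact (Real.hasDerivAt_sin θ).neg
  · exact Real.hasDerivAt_cos θ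
  · have h : -eR θ 2 = 0 := by simp [eR]
    change HasDerivAt (fun t => eT t 2) (-eR θ 2) θ
    rw [h]
    exact hasDerivAt_const θ (0 : ℝ)

theorem continuous_eR (i : Fin 3) : Continuous fun t => eR t i :=
  continuous_iff_continuousAt.2 fun t => (hasDerivAt_eR i t).continuousAt

theorem continuous_eT (i : Fin 3) : Continuous fun t => eT t i :=
  continuous_iff_continuousAt.2 fun t => (hasDerivAt_eT i t).continuousAt

theorem abs_eR_le (i : Fin 3) (θ : ℝ) : |eR θ i| ≤ 1 := by
  fin_cases i
  · exact Real.abs_cos_le_one θ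
  · exact Real.abs_sin_le_one θ
  · simp [eR]

theorem abs_eT_le (i : Fin 3) (θ : ℝ) : |eT θ i| ≤ 1 := by
  fin_cases i
  · simpa [eT] using Real.abs_sin_le_one θ
  · exact Real.abs_cos_le_one θ
  · simp [eT]

theorem eR_pi (i : Fin 3) : eR Real.pi i = eR (-Real.pi) i := by
  fin_cases i <;> simp [eR]

theorem eT_pi (i : Fin 3) : eT Real.pi i = eT (-Real.pi) i := by
  fin_cases i <;> simp [eT]

theorem cyl_pi (X : Eu 2) : cyl X Real.pi = cyl X (-Real.pi) := by
  ext i; fin_cases i <;> simp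

/-- The integrand is the derivative of `a b`, which takes equal values at `-π` and `π`. -/
theorem integral_mul_deriv_angle {a a' b b' : ℝ → ℝ} (ha : ∀ t, HasDerivAt a (a' t) t)
    (hb : ∀ t, HasDerivAt b (b' t) t) (ha' : Continuous a') (hb' : Continuous b')
    (hap : a Real.pi = a (-Real.pi)) (hbp : b Real.pi = b (-Real.pi)) :
    ∫ θ, (a θ * b' θ + a' θ * b θ) ∂angMeas = 0 := by
  have hac : Continuous a := continuous_iff_continuousAt.2 fun t => (ha t).continuousAt
  have hbc : Continuous b := continuous_iff_continuousAt.2 fun t => (hb t).continuousAt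
  have h := intervalIntegral.integral_eq_sub_of_hasDerivAt (a := -Real.pi) (b := Real.pi)
    (f := fun t => a t * b t) (f' := fun t => a' t * b t + a t * b' t)
    (fun t _ => (ha t).mul (hb t)) (by
      apply Continuous.intervalIntegrable; fun_prop)
  rw [intervalIntegral.integral_of_le (by linarith [Real.pi_pos]), integral_Ioc_eq_integral_Ioo]
    at h
  rw [angMeas]
  simp only [hap, hbp, sub_self] at h
  rw [← h]
  congr 1; ext t; ring

/-! ### Derivatives in cylindrical coordinates -/

theorem hasFDerivAt_cyl_left (X : Eu 2) (θ : ℝ) :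
    DifferentiableAt ℝ (fun Y : Eu 2 => cyl Y θ) X :=
  ((contDiff_cyl.comp (contDiff_id.prodMk contDiff_const)).differentiable (by simp)) X

theorem eu3_expand (w : Eu 3) : w = ∑ j, w j • (basisVec j : Eu 3) := by
  ext i
  simp [basisVec, Fin.sum_univ_three]
  fin_cases i <;> simp

theorem fderiv_apply_eq_sum {φ : Eu 3 → ℝ} (x w : Eu 3) :
    fderiv ℝ φ x w = ∑ j, w j * pd j φ x := by
  conv_lhs => rw [eu3_expand w]
  simp [pd]

theorem pd_coord {n : ℕ} (i j : Fin n) (x : Eu n) :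
    pd j (fun Y : Eu n => Y i) x = if i = j then 1 else 0 := by
  rw [pd]
  have : fderiv ℝ (fun Y : Eu n => Y i) x = EuclideanSpace.proj i :=
    (EuclideanSpace.proj (𝕜 := ℝ) i).hasFDerivAt.fderiv
  rw [this]
  simp [basisVec]

theorem fderiv_cyl_apply (X : Eu 2) (θ : ℝ) (k : Fin 2) (i : Fin 3) :
    fderiv ℝ (fun Y : Eu 2 => cyl Y θ) X (basisVec k) i = frm k θ i := by
  rw [← fderiv_coord (hasFDerivAt_cyl_left X θ)]
  have h0 : DifferentiableAt ℝ (fun Y : Eu 2 => Y 0) X := by fun_prop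
  have e0 := pd_coord (n := 2) 0 k X
  have e1 := pd_coord (n := 2) 1 k X
  rw [pd] at e0 e1
  fin_cases i <;> fin_cases k <;> simp [frm, eR, eZ, cyl] at e0 e1 ⊢ <;>
    simp [fderiv_mul_const h0, e0, e1]

theorem pd_comp_cyl {φ : Eu 3 → ℝ} {X : Eu 2} {θ : ℝ} (hφ : DifferentiableAt ℝ φ (cyl X θ))
    (k : Fin 2) : pd k (fun Y => φ (cyl Y θ)) X = ∑ j, frm k θ j * pd j φ (cyl X θ) := by
  have h := (hφ.hasFDerivAt.comp X (hasFDerivAt_cyl_left X θ).hasFDerivAt).fderiv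
  rw [pd]
  change fderiv ℝ (φ ∘ fun Y : Eu 2 => cyl Y θ) X _ = _
  rw [h, ContinuousLinearMap.comp_apply, fderiv_apply_eq_sum]
  simp_rw [fderiv_cyl_apply]

theorem hasDerivAt_cyl (X : Eu 2) (θ : ℝ) :
    HasDerivAt (fun t => cyl X t) (WithLp.toLp 2 fun i => X 0 * eT θ i) θ := by
  rw [hasDerivAt_iff_hasFDerivAt, ← hasFDerivWithinAt_univ, hasFDerivWithinAt_euclidean]
  intro i
  have : HasDerivAt (fun t => cyl X t i) (X 0 * eT θ i) θ := by
    fin_cases i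
    · exact (Real.hasDerivAt_cos θ).const_mul _
    · exact (Real.hasDerivAt_sin θ).const_mul _
    · simpa [eT] using hasDerivAt_const θ (X 1)
  rw [hasFDerivWithinAt_univ]
  refine this.hasFDerivAt.congr_fderiv ?_
  ext; simp

theorem hasDerivAt_comp_cyl {φ : Eu 3 → ℝ} {X : Eu 2} {θ : ℝ}
    (hφ : DifferentiableAt ℝ φ (cyl X θ)) :
    HasDerivAt (fun t => φ (cyl X t)) (∑ j, X 0 * eT θ j * pd j φ (cyl X θ)) θ := by
  have := hφ.hasFDerivAt.comp_hasDerivAt θ (hasDerivAt_cyl X θ)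
  rw [fderiv_apply_eq_sum] at this
  exact this

theorem frame_resolution (θ : ℝ) (j k : Fin 3) :
    eR θ j * eR θ k + eT θ j * eT θ k + eZ j * eZ k = if j = k then 1 else 0 := by
  have := Real.cos_sq_add_sin_sq θ
  fin_cases j <;> fin_cases k <;> simp [eR, eT, eZ] <;> linarith

/-- A partial derivative in the moving frame. -/
theorem pd_eq_frame (φ : Eu 3 → ℝ) (x : Eu 3) (θ : ℝ) (j : Fin 3) :
    pd j φ x = eR θ j * (∑ k, frm 0 θ k * pd k φ x) + eT θ j * (∑ k, eT θ k * pd k φ x) +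
      eZ j * (∑ k, frm 1 θ k * pd k φ x) := by
  have h := frame_resolution θ j
  have : ∑ k, (eR θ j * eR θ k + eT θ j * eT θ k + eZ j * eZ k) * pd k φ x = pd j φ x := by
    simp [h]
  rw [← this]
  simp only [Fin.sum_univ_three, frm, Matrix.cons_val_zero, Matrix.cons_val_one]
  ring

/-! ### Slices and lifts of test functions -/

/-- The restriction of a function on `ℝ³` to the half-plane at angle `θ`. -/
def slice (φ : Eu 3 → ℝ) (θ : ℝ) (X : Eu 2) : ℝ := if 0 < X 0 then φ (cyl X θ) else 0

theorem slice_eventuallyEq (φ : Eu 3 → ℝ) (θ : ℝ) {X : Eu 2} (hX : 0 < X 0) :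
    slice φ θ =ᶠ[𝓝 X] fun Y => φ (cyl Y θ) := by
  have : {Y : Eu 2 | 0 < Y 0} ∈ 𝓝 X := (isOpen_lt continuous_const (by fun_prop)).mem_nhds hX
  filter_upwards [this] with Y hY
  exact if_pos hY

theorem contDiff_cyl_left (θ : ℝ) : ContDiff ℝ ∞ fun Y : Eu 2 => cyl Y θ :=
  contDiff_cyl.comp (contDiff_id.prodMk contDiff_const)

/-- The support lies in the projection of `tsupport φ`, a compact subset of the open section, so the
cut at `r = 0` does not spoil smoothness. Without the cut the slice would reappear at `r < 0`, where
`cyl` reaches `Ω` from the opposite side. -/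
theorem IsAxiDomain.isTest_slice {Ω : Set (Eu 3)} (D : IsAxiDomain Ω) {φ : Eu 3 → ℝ}
    (hφ : IsTest Ω φ) (θ : ℝ) : IsTest (meridian Ω) (slice φ θ) := by
  obtain ⟨r₀, hr0, hr⟩ := D.away
  have hK : IsCompact (cylProj '' tsupport φ) := hφ.2.1.image continuous_cylProj
  have hsup : Function.support (slice φ θ) ⊆ cylProj '' tsupport φ := by
    intro X hX
    by_cases h : 0 < X 0
    · simp only [Function.mem_support, slice, if_pos h] at hX
      exact ⟨_, subset_tsupport _ hX, cylProj_cyl h.le θ⟩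
    · simp [slice, h] at hX
  have hts : tsupport (slice φ θ) ⊆ cylProj '' tsupport φ :=
    closure_minimal hsup hK.isClosed
  refine ⟨?_, HasCompactSupport.of_support_subset_isCompact hK hsup, hts.trans ?_⟩
  · rw [contDiff_iff_contDiffAt]
    intro X
    by_cases h : 0 < X 0
    · exact ((hφ.1.comp (contDiff_cyl_left θ)).contDiffAt).congr_of_eventuallyEq
        (slice_eventuallyEq φ θ h)
    · have hX : X ∉ tsupport (slice φ θ) := by
        intro hX
        obtain ⟨x, hx, rfl⟩ := hts hX
        exact h (D.cylRadius_pos (hφ.2.2 hx))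
      exact contDiffAt_const.congr_of_eventuallyEq (notMem_tsupport_iff_eventuallyEq.1 hX)
  · rintro _ ⟨x, hx, rfl⟩
    exact D.cylProj_mem (hφ.2.2 hx)

theorem contDiffAt_cylRadius {x : Eu 3} (hx : cylRadius x ≠ 0) : ContDiffAt ℝ ∞ cylRadius x := by
  unfold cylRadius at *
  have h : ContDiffAt ℝ ∞ (fun x : Eu 3 => x 0 ^ 2 + x 1 ^ 2) x :=
    (((contDiff_euclidean.1 contDiff_id 0).pow 2).add
      ((contDiff_euclidean.1 contDiff_id 1).pow 2)).contDiffAt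
  exact h.sqrt (fun h0 => hx (by rw [h0, Real.sqrt_zero]))

theorem contDiffAt_cylProj {x : Eu 3} (hx : cylRadius x ≠ 0) : ContDiffAt ℝ ∞ cylProj x := by
  rw [contDiffAt_euclidean]
  intro i
  fin_cases i
  · exact contDiffAt_cylRadius hx
  · exact (contDiff_euclidean.1 contDiff_id 2).contDiffAt

/-- The field `x ↦ p(x) ψ(r, z)`, for `p` smooth off the axis. -/
theorem IsAxiDomain.isTest_lift {Ω : Set (Eu 3)} (D : IsAxiDomain Ω) {F : Type*}
    [NormedAddCommGroup F] [NormedSpace ℝ F] {ψ : Eu 2 → ℝ}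
    (hψ : IsTest (meridian Ω) ψ) {p : Eu 3 → F}
    (hp : ∀ x, cylRadius x ≠ 0 → ContDiffAt ℝ ∞ p x) :
    IsTest Ω (fun x => ψ (cylProj x) • p x) := by
  set f : Eu 3 → F := fun x => ψ (cylProj x) • p x
  have hKc : IsClosed (cylProj ⁻¹' tsupport ψ) := (isClosed_tsupport ψ).preimage continuous_cylProj
  have hKΩ : cylProj ⁻¹' tsupport ψ ⊆ Ω := fun x hx => D.mem_of_cylProj_mem (hψ.2.2 hx)
  have hK : IsCompact (cylProj ⁻¹' tsupport ψ) :=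
    Metric.isCompact_of_isClosed_isBounded hKc (D.isBounded.subset hKΩ)
  have hsup : Function.support f ⊆ cylProj ⁻¹' tsupport ψ := by
    intro x hx
    refine subset_tsupport _ fun h0 => hx ?_
    simp [f, h0]
  have hts : tsupport f ⊆ cylProj ⁻¹' tsupport ψ := closure_minimal hsup hKc
  refine ⟨?_, HasCompactSupport.of_support_subset_isCompact hK hsup, hts.trans hKΩ⟩
  rw [contDiff_iff_contDiffAt]
  intro x
  by_cases h : cylRadius x = 0
  · have hx : x ∉ tsupport f := fun hx => (D.cylRadius_pos (hKΩ (hts hx))).ne' h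
    exact contDiffAt_const.congr_of_eventuallyEq (notMem_tsupport_iff_eventuallyEq.1 hx)
  · exact (hψ.1.contDiffAt.comp x (contDiffAt_cylProj h)).smul (hp x h)

/-! ### The gradient of an axisymmetric map -/

/-- `e_r` as a field on `ℝ³`. -/
def uR (x : Eu 3) : Fin 3 → ℝ := ![x 0 / cylRadius x, x 1 / cylRadius x, 0]
/-- `e_θ` as a field on `ℝ³`. -/
def uT (x : Eu 3) : Fin 3 → ℝ := ![-(x 1 / cylRadius x), x 0 / cylRadius x, 0]

theorem uR_cyl {X : Eu 2} (h : 0 < X 0) (θ : ℝ) : uR (cyl X θ) = eR θ := by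
  have := h.ne'
  ext i
  fin_cases i <;> simp [uR, eR, cylRadius_cyl h.le, this]

theorem uT_cyl {X : Eu 2} (h : 0 < X 0) (θ : ℝ) : uT (cyl X θ) = eT θ := by
  have := h.ne'
  ext i
  fin_cases i <;> simp [uT, eT, cylRadius_cyl h.le, this]

theorem measurable_uR (i : Fin 3) : Measurable fun x => uR x i := by
  have := continuous_cylRadius.measurable
  fin_cases i <;> simp [uR] <;> fun_prop

theorem measurable_uT (i : Fin 3) : Measurable fun x => uT x i := by
  have := continuous_cylRadius.measurable
  fin_cases i <;> simp [uT] <;> fun_prop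

theorem contDiffAt_uR {x : Eu 3} (hx : cylRadius x ≠ 0) (i : Fin 3) :
    ContDiffAt ℝ ∞ (fun y => uR y i) x := by
  have hc : ∀ k : Fin 3, ContDiffAt ℝ ∞ (fun y : Eu 3 => y k) x :=
    fun k => (contDiff_euclidean.1 contDiff_id k).contDiffAt
  fin_cases i
  · exact (hc 0).div (contDiffAt_cylRadius hx) hx
  · exact (hc 1).div (contDiffAt_cylRadius hx) hx
  · exact contDiffAt_const

/-- The vectors `e_r` and `e_z` have disjoint sets of nonzero Cartesian entries, so each component
of `v₁ e_r + v₂ e_z` is a single product; `prof` selects the profile component involved. This lets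
one formula treat all `i`. -/
theorem axiLift_apply (v : Eu 2 → Eu 2) (x : Eu 3) (i : Fin 3) :
    axiLift v x i = (uR x i + eZ i) * v (cylProj x) (prof i) := by
  fin_cases i <;> simp [axiLift, uR, eZ, prof, cylProj, mul_comm]

theorem axiLift_cyl (v : Eu 2 → Eu 2) {X : Eu 2} (h : 0 < X 0) (θ : ℝ) (i : Fin 3) :
    axiLift v (cyl X θ) i = (eR θ i + eZ i) * v X (prof i) := by
  rw [axiLift_apply, uR_cyl h, cylProj_cyl h.le]

/-- The gradient of `v₁ e_r + v₂ e_z`, in terms of `v` and of `G = Dv`, where `eR`, `eT` stand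
for the frame vectors. -/
def frameGrad (a t : Fin 3 → ℝ) (q : ℝ) (G : Matrix (Fin 2) (Fin 2) ℝ) :
    Matrix (Fin 3) (Fin 3) ℝ :=
  Matrix.of fun i j => (a i + eZ i) * (a j * G (prof i) 0 + eZ j * G (prof i) 1) + t i * t j * q

/-- The gradient of `v₁ e_r + v₂ e_z` as a field on `ℝ³`. -/
def liftGrad (v : Eu 2 → Eu 2) (G : Eu 2 → Matrix (Fin 2) (Fin 2) ℝ) (x : Eu 3) :
    Matrix (Fin 3) (Fin 3) ℝ :=
  frameGrad (uR x) (uT x) (v (cylProj x) 0 / cylRadius x) (G (cylProj x))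

theorem liftGrad_cyl (v : Eu 2 → Eu 2) (G : Eu 2 → Matrix (Fin 2) (Fin 2) ℝ) {X : Eu 2}
    (h : 0 < X 0) (θ : ℝ) :
    liftGrad v G (cyl X θ) = frameGrad (eR θ) (eT θ) (v X 0 / X 0) (G X) := by
  rw [liftGrad, uR_cyl h, uT_cyl h, cylProj_cyl h.le, cylRadius_cyl h.le]

/-! ### The weak gradient of a lifted profile -/

section Lift

variable {Ω : Set (Eu 3)}

theorem continuous_frame (i : Fin 3) : Continuous (fun p : Eu 2 × ℝ => eR p.2 i) ∧
    Continuous (fun p : Eu 2 × ℝ => eT p.2 i) :=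
  ⟨(continuous_eR i).comp continuous_snd, (continuous_eT i).comp continuous_snd⟩

theorem continuous_frm (k : Fin 2) (i : Fin 3) : Continuous (fun p : Eu 2 × ℝ => frm k p.2 i) := by
  fin_cases k
  · exact (continuous_eR i).comp continuous_snd
  · exact continuous_const

theorem pd_slice {φ : Eu 3 → ℝ} (hφ : IsTest Ω φ) {X : Eu 2} (hX : 0 < X 0) (θ : ℝ) (k : Fin 2) :
    pd k (slice φ θ) X = ∑ j, frm k θ j * pd j φ (cyl X θ) := by
  rw [← pd_comp_cyl (hφ.differentiable _) k, pd, pd,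
    (slice_eventuallyEq φ θ hX).fderiv_eq]

theorem isTest_radius_mul_slice (D : IsAxiDomain Ω) {φ : Eu 3 → ℝ} (hφ : IsTest Ω φ) (θ : ℝ) :
    IsTest (meridian Ω) (fun Y => Y 0 * slice φ θ Y) :=
  (D.isTest_slice hφ θ).mul_left (contDiff_euclidean.1 contDiff_id 0)

theorem pd_radius_mul {f : Eu 2 → ℝ} {X : Eu 2} (hf : DifferentiableAt ℝ f X) (k : Fin 2) :
    pd k (fun Y => Y 0 * f Y) X = (if k = 0 then f X else 0) + X 0 * pd k f X := by
  have h0 : DifferentiableAt ℝ (fun Y : Eu 2 => Y 0) X := by fun_prop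
  have e := pd_coord 0 k X
  rw [pd] at e ⊢
  rw [fderiv_fun_mul h0 hf]
  simp only [add_apply, smul_apply, smul_eq_mul, e, pd]
  by_cases hk : k = 0
  · simp [hk, add_comm]
  · simp [hk, Ne.symm hk]

theorem eT_mul_prof (θ : ℝ) (i : Fin 3) (w : Eu 2) : eT θ i * w (prof i) = eT θ i * w 0 := by
  fin_cases i <;> simp [eT, prof]

theorem integral_add_mul_eq_zero {α : Type*} [MeasurableSpace α] {μ : Measure α} {f g : α → ℝ}
    (hf : Integrable f μ) (hg : Integrable g μ) (hf0 : ∫ x, f x ∂μ = 0) (hg0 : ∫ x, g x ∂μ = 0)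
    (a b : ℝ) : ∫ x, (a * f x + b * g x) ∂μ = 0 := by
  rw [integral_add (hf.const_mul a) (hg.const_mul b), integral_const_mul, integral_const_mul, hf0,
    hg0]
  simp

/-- The derivative `∂_jφ` is expanded in the moving frame. Its radial and axial parts are handled at
fixed angle by the weak gradient of `v`, tested with `r φ` so that the volume weight is absorbed;
its angular part is integrated by parts in the angle, where the derivative of `e_r` creates the `e_θ
⊗ e_θ` entry of the gradient. -/
theorem isWeakGrad_axiLift (D : IsAxiDomain Ω) {v : Eu 2 → Eu 2} {G : Eu 2 → Matrix (Fin 2) (Fin 2) ℝ}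
    (hv : ∀ l, IntegrableOn (fun X => v X l) (meridian Ω))
    (hG : ∀ l k, IntegrableOn (fun X => G X l k) (meridian Ω))
    (h : IsWeakGrad (meridian Ω) v G) : IsWeakGrad Ω (axiLift v) (liftGrad v G) := by
  have mR := measurable_uR
  have mT := measurable_uT
  have mr := continuous_cylRadius.measurable
  have cR : ∀ i, Continuous (fun p : Eu 2 × ℝ => eR p.2 i) := fun i => (continuous_frame i).1
  have cT : ∀ i, Continuous (fun p : Eu 2 × ℝ => eT p.2 i) := fun i => (continuous_frame i).2
  have mv := fun l => D.aestronglyMeasurable_comp_cylProj (hv l).aestronglyMeasurable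
  have mG := fun l k => D.aestronglyMeasurable_comp_cylProj (hG l k).aestronglyMeasurable
  have c0 : Continuous (fun p : Eu 2 × ℝ => p.1 0) := by fun_prop
  have hu : ∀ i, IntegrableOn (fun x => axiLift v x i) Ω := by
    intro i
    refine D.integrableOn_of_cyl ?_ (D.integrable_mul_continuous (hv (prof i))
      (b := fun p => p.1 0 * (eR p.2 i + eZ i)) (by fun_prop)) ?_
    · simp_rw [axiLift_apply]
      exact (((mR i).add_const _).aestronglyMeasurable).mul (mv (prof i))
    · intro X hX θ
      rw [axiLift_cyl v hX.1]; ring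
  have hF : ∀ i j, IntegrableOn (fun x => liftGrad v G x i j) Ω := by
    intro i j
    refine D.integrableOn_of_cyl (g := fun p =>
      (G p.1 (prof i) 0 * (p.1 0 * ((eR p.2 i + eZ i) * eR p.2 j)) +
      G p.1 (prof i) 1 * (p.1 0 * ((eR p.2 i + eZ i) * eZ j))) +
      v p.1 0 * (eT p.2 i * eT p.2 j)) ?_ (((D.integrable_mul_continuous (hG (prof i) 0)
      (b := fun p => p.1 0 * ((eR p.2 i + eZ i) * eR p.2 j)) (by fun_prop)).add
      (D.integrable_mul_continuous (hG (prof i) 1)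
      (b := fun p => p.1 0 * ((eR p.2 i + eZ i) * eZ j)) (by fun_prop))).add
      (D.integrable_mul_continuous (hv 0)
      (b := fun p => (eT p.2 i * eT p.2 j)) (by fun_prop))) ?_
    · simp only [liftGrad, frameGrad, Matrix.of_apply]
      exact ((((mR i).add_const _).aestronglyMeasurable).mul
        (((mR j).aestronglyMeasurable.mul (mG (prof i) 0)).add
          (aestronglyMeasurable_const.mul (mG (prof i) 1)))).add
        (((mT i).mul (mT j)).aestronglyMeasurable.mul
          ((mv 0).mul mr.inv.aestronglyMeasurable))
    · intro X hX θ
      have := hX.1.ne'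
      rw [liftGrad_cyl v G hX.1]
      simp only [frameGrad, Matrix.of_apply]
      field_simp
  refine ⟨fun i => (hu i).locallyIntegrableOn, fun i j => (hF i j).locallyIntegrableOn,
    fun i j φ hφ => ?_⟩
  have i1 := integrable_mul_of_test (hu i).locallyIntegrableOn (hφ.pd j)
  have i2 := integrable_mul_of_test (hF i j).locallyIntegrableOn hφ
  rw [eq_neg_iff_add_eq_zero, ← integral_add i1 i2]
  refine (D.integral_cyl (i1.add i2).aestronglyMeasurable).trans ?_
  set ph : Eu 2 × ℝ → ℝ := fun p => φ (cyl p.1 p.2) with hph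
  have cphi : Continuous ph := hφ.1.continuous.comp continuous_cyl
  have cpd : ∀ k, Continuous (fun p : Eu 2 × ℝ => pd k φ (cyl p.1 p.2)) :=
    fun k => (hφ.pd k).1.continuous.comp continuous_cyl
  have cfrm := continuous_frm
  set dR : Eu 2 × ℝ → ℝ := fun p => ∑ k, frm 0 p.2 k * pd k φ (cyl p.1 p.2) with hdR
  set dZ : Eu 2 × ℝ → ℝ := fun p => ∑ k, frm 1 p.2 k * pd k φ (cyl p.1 p.2) with hdZ
  set dT : Eu 2 × ℝ → ℝ := fun p => ∑ k, eT p.2 k * pd k φ (cyl p.1 p.2) with hdT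
  have cdR : Continuous dR := by fun_prop
  have cdZ : Continuous dZ := by fun_prop
  have cdT : Continuous dT := by fun_prop
  -- The term `(e_r + e_z)_i (e_r)_j v φ`, which comes from `∂_r(r φ)`, is added in `J` and removed
  -- in `K`. It makes `J` a weak-gradient identity at fixed angle and `K` equal to `v` times the
  -- angular derivative of `(e_r + e_z)_i (e_θ)_j φ`.
  set J : Eu 2 × ℝ → ℝ := fun p =>
    (v p.1 (prof i) * ((eR p.2 i + eZ i) * (p.1 0 * (eR p.2 j * dR p + eZ j * dZ p)
      + eR p.2 j * ph p)) +
    G p.1 (prof i) 0 * (p.1 0 * ((eR p.2 i + eZ i) * eR p.2 j * ph p))) +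
    G p.1 (prof i) 1 * (p.1 0 * ((eR p.2 i + eZ i) * eZ j * ph p)) with hJ
  set K : Eu 2 × ℝ → ℝ := fun p => v p.1 (prof i) *
    (((eR p.2 i + eZ i) * eT p.2 j) * (p.1 0 * dT p) +
      (eT p.2 i * eT p.2 j + (eR p.2 i + eZ i) * (-eR p.2 j)) * ph p) with hK
  have iJ : Integrable J (cylMeas Ω) := by
    refine ((D.integrable_mul_continuous (hv (prof i)) ?_).add
      (D.integrable_mul_continuous (hG (prof i) 0) ?_)).add
      (D.integrable_mul_continuous (hG (prof i) 1) ?_) <;> fun_prop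
  have iK : Integrable K (cylMeas Ω) := by
    refine D.integrable_mul_continuous (hv (prof i)) ?_
    fun_prop
  have hJ0 : ∫ p, J p ∂(cylMeas Ω) = 0 := by
    refine IsAxiDomain.integral_eq_zero_of_forall_angle iJ fun θ => ?_
    have hs := D.isTest_slice hφ θ
    have ht := isTest_radius_mul_slice D hφ θ
    have e0 := h.2.2 (prof i) 0 _ ht
    have e1 := h.2.2 (prof i) 1 _ ht
    have a0 := integrable_mul_of_test (hv (prof i)).locallyIntegrableOn (ht.pd 0)
    have a1 := integrable_mul_of_test (hv (prof i)).locallyIntegrableOn (ht.pd 1)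
    have b0 := integrable_mul_of_test (hG (prof i) 0).locallyIntegrableOn ht
    have b1 := integrable_mul_of_test (hG (prof i) 1).locallyIntegrableOn ht
    rw [eq_neg_iff_add_eq_zero, ← integral_add a0 b0] at e0
    rw [eq_neg_iff_add_eq_zero, ← integral_add a1 b1] at e1
    have : ∀ X ∈ meridian Ω, J (X, θ) =
        ((eR θ i + eZ i) * eR θ j) * (v X (prof i) * pd 0 (fun Y => Y 0 * slice φ θ Y) X +
          G X (prof i) 0 * (X 0 * slice φ θ X)) +
        ((eR θ i + eZ i) * eZ j) * (v X (prof i) * pd 1 (fun Y => Y 0 * slice φ θ Y) X +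
          G X (prof i) 1 * (X 0 * slice φ θ X)) := by
      intro X hX
      rw [pd_radius_mul (hs.differentiable X), pd_radius_mul (hs.differentiable X),
        pd_slice hφ hX.1, pd_slice hφ hX.1]
      simp only [hJ, hph, hdR, hdZ, slice, if_pos hX.1, if_true, one_ne_zero, if_false]
      ring
    rw [setIntegral_congr_fun D.isOpen_meridian.measurableSet this]
    exact integral_add_mul_eq_zero (a0.add b0) (a1.add b1) e0 e1 _ _
  have hK0 : ∫ p, K p ∂(cylMeas Ω) = 0 := by
    refine D.integral_eq_zero_of_forall_meridian iK fun X hX => ?_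
    simp only [hK, hph]
    rw [integral_const_mul]
    have := integral_mul_deriv_angle (a := fun t => (eR t i + eZ i) * eT t j)
      (a' := fun t => eT t i * eT t j + (eR t i + eZ i) * (-eR t j))
      (b := fun t => φ (cyl X t)) (b' := fun t => X 0 * dT (X, t))
      (fun t => ((hasDerivAt_eR i t).add_const _).mul (hasDerivAt_eT j t))
      (fun t => by
        convert hasDerivAt_comp_cyl (X := X) (hφ.differentiable (cyl X t)) using 1
        simp only [hdT, Finset.mul_sum, mul_assoc])
      (by have := continuous_eR; have := continuous_eT; fun_prop)
      (by fun_prop) (by simp [eR_pi, eT_pi]) (by rw [cyl_pi])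
    rw [this, mul_zero]
  have : ∫ p, J p + K p ∂(cylMeas Ω) = 0 := by rw [integral_add iJ iK, hJ0, hK0, add_zero]
  rw [← this]
  refine integral_congr_ae ?_
  filter_upwards [D.ae_cylMeas_mem] with p hp
  have h0 := hp.1.ne'
  rw [Pi.add_apply, axiLift_cyl v hp.1, liftGrad_cyl v G hp.1, pd_eq_frame φ _ p.2 j]
  simp only [hJ, hK, hph, hdR, hdZ, hdT, frameGrad, Matrix.of_apply]
  -- `K` carries the component `v (prof i)` where the gradient has `v 0`; they agree whenever
  -- `(e_θ)_i` is nonzero.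
  have := eT_mul_prof p.2 i (v p.1)
  field_simp
  linear_combination -(eT p.2 j * φ (cyl p.1 p.2)) * this

end Lift

/-! ### The profile of an axisymmetric Sobolev map -/

/-- The frame vectors `e_r`, `e_z` as fields on `ℝ³`. -/
def uFrm (l : Fin 2) (x : Eu 3) : Fin 3 → ℝ := ![uR x, eZ] l

/-- The derivatives of `e_r`, `e_z` in the angle. -/
def frm' (l : Fin 2) (θ : ℝ) : Fin 3 → ℝ := ![eT θ, 0] l

theorem uFrm_cyl {X : Eu 2} (h : 0 < X 0) (l : Fin 2) (θ : ℝ) : uFrm l (cyl X θ) = frm l θ := by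
  fin_cases l
  · exact uR_cyl h θ
  · rfl

theorem contDiffAt_uFrm {x : Eu 3} (hx : cylRadius x ≠ 0) (l : Fin 2) (i : Fin 3) :
    ContDiffAt ℝ ∞ (fun y => uFrm l y i) x := by
  fin_cases l
  · exact contDiffAt_uR hx i
  · exact contDiffAt_const

theorem hasDerivAt_frm (l : Fin 2) (i : Fin 3) (θ : ℝ) :
    HasDerivAt (fun t => frm l t i) (frm' l θ i) θ := by
  fin_cases l
  · exact hasDerivAt_eR i θ
  · exact hasDerivAt_const _ _

section

variable {Ω : Set (Eu 3)}

/-- The fields `x ↦ (e_l)_i (e_k)_j ψ(r, z) / r`. -/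
def frameTest (l k : Fin 2) (ψ : Eu 2 → ℝ) (i j : Fin 3) (x : Eu 3) : ℝ :=
  ψ (cylProj x) • (uFrm l x i * uFrm k x j / cylRadius x)

theorem isTest_frameTest (D : IsAxiDomain Ω) {ψ : Eu 2 → ℝ} (hψ : IsTest (meridian Ω) ψ)
    (l k : Fin 2) (i j : Fin 3) : IsTest Ω (frameTest l k ψ i j) :=
  D.isTest_lift hψ fun _ hx =>
    ((contDiffAt_uFrm hx l i).mul (contDiffAt_uFrm hx k j)).div (contDiffAt_cylRadius hx) hx

theorem frameTest_cyl (l k : Fin 2) (ψ : Eu 2 → ℝ) (i j : Fin 3) {X : Eu 2} (h : 0 < X 0) (θ : ℝ) :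
    frameTest l k ψ i j (cyl X θ) = frm l θ i * frm k θ j * (1 / X 0 * ψ X) := by
  rw [frameTest, cylProj_cyl h.le, uFrm_cyl h, uFrm_cyl h, cylRadius_cyl h.le, smul_eq_mul]
  ring

theorem eventually_radius_pos {X : Eu 2} (h : 0 < X 0) : ∀ᶠ Y : Eu 2 in 𝓝 X, 0 < Y 0 :=
  (isOpen_lt continuous_const (by fun_prop)).mem_nhds h

theorem differentiableAt_inv_radius {X : Eu 2} (h : 0 < X 0) :
    DifferentiableAt ℝ (fun Y : Eu 2 => 1 / Y 0) X := by
  have : DifferentiableAt ℝ (fun Y : Eu 2 => Y 0) X := by fun_prop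
  simp only [one_div]
  exact DifferentiableAt.fun_inv this h.ne'

theorem pd_const_mul {n : ℕ} {f : Eu n → ℝ} {X : Eu n} (hf : DifferentiableAt ℝ f X) (c : ℝ)
    (k : Fin n) : pd k (fun Y => c * f Y) X = c * pd k f X := by
  rw [pd, fderiv_const_mul hf]; rfl

theorem pd_congr {n : ℕ} {f g : Eu n → ℝ} {X : Eu n} (h : f =ᶠ[𝓝 X] g) (k : Fin n) :
    pd k f X = pd k g X := by
  rw [pd, h.fderiv_eq]; rfl

theorem pd_eq_radius_mul {ψ : Eu 2 → ℝ} {X : Eu 2} (h : 0 < X 0) (hψ : DifferentiableAt ℝ ψ X)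
    (k : Fin 2) : pd k ψ X =
      (if k = 0 then 1 / X 0 * ψ X else 0) + X 0 * pd k (fun Y => 1 / Y 0 * ψ Y) X := by
  rw [← pd_radius_mul ((differentiableAt_inv_radius h).fun_mul hψ)]
  refine pd_congr ?_ k
  filter_upwards [eventually_radius_pos h] with Y hY
  have := hY.ne'
  field_simp

/-- Radial and axial derivatives act only on `ψ / r`, the angular derivative only on the frame
vectors. -/
theorem pd_frameTest_cyl (D : IsAxiDomain Ω) {ψ : Eu 2 → ℝ} (hψ : IsTest (meridian Ω) ψ)
    (l k : Fin 2) (i j n : Fin 3) {X : Eu 2} (h : 0 < X 0) (θ : ℝ) :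
    X 0 * pd n (frameTest l k ψ i j) (cyl X θ) =
      X 0 * (frm l θ i * frm k θ j) * (eR θ n * pd 0 (fun Y => 1 / Y 0 * ψ Y) X +
        eZ n * pd 1 (fun Y => 1 / Y 0 * ψ Y) X) +
      eT θ n * ((frm' l θ i * frm k θ j + frm l θ i * frm' k θ j) * (1 / X 0 * ψ X)) := by
  have ht := isTest_frameTest D hψ l k i j
  have hd : DifferentiableAt ℝ (fun Y : Eu 2 => 1 / Y 0 * ψ Y) X :=
    (differentiableAt_inv_radius h).mul (hψ.differentiable X)
  have e : ∀ q : Fin 2, ∑ n, frm q θ n * pd n (frameTest l k ψ i j) (cyl X θ) =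
      frm l θ i * frm k θ j * pd q (fun Y => 1 / Y 0 * ψ Y) X := by
    intro q
    rw [← pd_comp_cyl (ht.differentiable _), ← pd_const_mul hd]
    refine pd_congr ?_ q
    filter_upwards [eventually_radius_pos h] with Y hY using frameTest_cyl l k ψ i j hY θ
  have e2 : ∑ n, X 0 * eT θ n * pd n (frameTest l k ψ i j) (cyl X θ) =
      (frm' l θ i * frm k θ j + frm l θ i * frm' k θ j) * (1 / X 0 * ψ X) := by
    refine (hasDerivAt_comp_cyl (ht.differentiable _)).unique ?_
    have := ((hasDerivAt_frm l i θ).mul (hasDerivAt_frm k j θ)).mul_const (1 / X 0 * ψ X)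
    refine this.congr_of_eventuallyEq (Eventually.of_forall fun t => ?_)
    exact frameTest_cyl l k ψ i j h t
  rw [pd_eq_frame _ _ θ n, e, e, ← e2]
  simp only [mul_assoc, ← Finset.mul_sum]
  ring

/-- The angular terms leave only the divergence of `e_k`, present for `e_r` alone. With `S = ψ / r`
and `P`, `Q` its derivatives, the bracket on the right is `∂_kψ` by `pd_eq_radius_mul`; this is why
the test fields carry the factor `1 / r`. -/
theorem sum_frame_pd (l k : Fin 2) (θ r P Q S : ℝ) (w : Eu 2) :
    ∑ i, ∑ j, ((eR θ i + eZ i) * w (prof i)) * (r * (frm l θ i * frm k θ j) *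
      (eR θ j * P + eZ j * Q) + eT θ j * ((frm' l θ i * frm k θ j + frm l θ i * frm' k θ j) * S)) =
    w l * ((if k = 0 then S else 0) + r * ![P, Q] k) := by
  have h := Real.sin_sq θ
  fin_cases l <;> fin_cases k <;>
    simp [Fin.sum_univ_three, frm, frm', eR, eT, eZ, prof] <;> ring_nf <;>
    simp only [h, show Real.sin θ ^ 4 = (Real.sin θ ^ 2) ^ 2 by ring] <;> ring

theorem sum_frm_lift (l : Fin 2) (θ : ℝ) (w : Eu 2) :
    ∑ i, frm l θ i * ((eR θ i + eZ i) * w (prof i)) = w l := by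
  have := Real.cos_sq_add_sin_sq θ
  fin_cases l <;> simp [Fin.sum_univ_three, frm, eR, eZ, prof]
  linear_combination w 0 * this

theorem memLp_two_sq {α : Type*} [MeasurableSpace α] {μ : Measure α} {f : α → ℝ}
    (hf : AEStronglyMeasurable f μ) (h : Integrable (fun x => f x ^ 2) μ) : MemLp f 2 μ :=
  (memLp_two_iff_integrable_sq hf).2 h

/-- The angular average `(2π)⁻¹ ∫ ⟨e_l, F e_k⟩ dθ`. -/
def angAverage (F : Eu 3 → Matrix (Fin 3) (Fin 3) ℝ) (X : Eu 2) : Matrix (Fin 2) (Fin 2) ℝ :=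
  Matrix.of fun l k =>
    (2 * Real.pi)⁻¹ * ∫ θ, ∑ i, ∑ j, frm l θ i * F (cyl X θ) i j * frm k θ j ∂angMeas

theorem MemLp.integrableOn_coord {n : ℕ} (D : IsAxiDomain Ω) {u : Eu 3 → Eu n}
    (hu : MemLp u 2 (volume.restrict Ω)) (i : Fin n) :
    IntegrableOn (fun x => u x i) Ω ∧ IntegrableOn (fun x => u x i ^ 2) Ω := by
  have := D.finite_volume
  have h : MemLp (fun x => u x i) 2 (volume.restrict Ω) :=
    hu.of_le ((EuclideanSpace.proj (𝕜 := ℝ) i).continuous.comp_aestronglyMeasurable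
      hu.aestronglyMeasurable) (Eventually.of_forall fun x => PiLp.norm_apply_le (u x) i)
  exact ⟨h.integrable (by norm_num), h.integrable_sq⟩

variable (D : IsAxiDomain Ω) {u : Eu 3 → Eu 3} {v : Eu 2 → Eu 2}
include D

theorem IsProfile.ae_cyl (hp : IsProfile Ω u v) :
    ∀ᵐ p ∂(cylMeas Ω), ∀ i, u (cyl p.1 p.2) i = (eR p.2 i + eZ i) * v p.1 (prof i) := by
  filter_upwards [D.quasiMeasurePreserving_cyl.ae hp.1, D.ae_cylMeas_mem] with p h1 h2 i
  rw [h1, axiLift_cyl v h2.1]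

theorem integrable_frm_comp {f : Fin 3 → Eu 3 → ℝ} (hf : ∀ i, IntegrableOn (f i) Ω)
    {b : Fin 3 → ℝ → ℝ} (hb : ∀ i, Continuous (b i)) (hb1 : ∀ i θ, |b i θ| ≤ 1) :
    Integrable (fun p => ∑ i, b i p.2 * f i (cyl p.1 p.2)) (cylMeas Ω) := by
  refine integrable_finsetSum _ fun i _ => ?_
  refine (D.integrable_comp_cyl (hf i)).bdd_mul (c := 1)
    ((hb i).comp continuous_snd).aestronglyMeasurable (Eventually.of_forall fun p => hb1 i p.2)

theorem IsProfile.integrableOn (hu : MemLp u 2 (volume.restrict Ω)) (hp : IsProfile Ω u v)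
    (l : Fin 2) : IntegrableOn (fun X => v X l) (meridian Ω) := by
  have h1 : Integrable (fun p => ∑ i, frm l p.2 i * u (cyl p.1 p.2) i) (cylMeas Ω) :=
    integrable_frm_comp D (f := fun i x => u x i) (b := fun i t => frm l t i)
      (fun i => (MemLp.integrableOn_coord D hu i).1)
      (fun i => continuous_iff_continuousAt.2 fun t => (hasDerivAt_frm l i t).continuousAt)
      (fun i t => by
        fin_cases l
        · exact abs_eR_le i t
        · fin_cases i <;> simp [frm, eZ])
  refine Integrable.of_comp_fst (ν := angMeas) (h1.congr ?_) angMeas_ne_zero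
  filter_upwards [hp.ae_cyl D] with p h
  simp only [h]
  exact sum_frm_lift l p.2 (v p.1)

omit D in
theorem abs_frm_le (l : Fin 2) (i : Fin 3) (t : ℝ) : |frm l t i| ≤ 1 := by
  fin_cases l
  · exact abs_eR_le i t
  · fin_cases i <;> simp [frm, eZ]

theorem integrable_frm_quad {F : Eu 3 → Matrix (Fin 3) (Fin 3) ℝ}
    (hF : ∀ i j, IntegrableOn (fun x => F x i j) Ω) (l k : Fin 2) :
    Integrable (fun p => ∑ i, ∑ j, frm l p.2 i * F (cyl p.1 p.2) i j * frm k p.2 j)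
      (cylMeas Ω) := by
  refine integrable_finsetSum _ fun i _ => integrable_finsetSum _ fun j _ => ?_
  exact ((D.integrable_comp_cyl (hF i j)).bdd_mul (c := 1) (continuous_frm l i).aestronglyMeasurable
    (Eventually.of_forall fun p => abs_frm_le l i p.2)).mul_bdd (c := 1)
    (continuous_frm k j).aestronglyMeasurable (Eventually.of_forall fun p => abs_frm_le k j p.2)

theorem integrableOn_angAverage {F : Eu 3 → Matrix (Fin 3) (Fin 3) ℝ}
    (hF : ∀ i j, IntegrableOn (fun x => F x i j) Ω) (l k : Fin 2) :
    IntegrableOn (fun X => angAverage F X l k) (meridian Ω) := by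
  have h := (integrable_frm_quad D hF l k).integral_prod_left
  exact h.const_mul _

/-- The weak gradient of `u` is tested with `(e_l)_i (e_k)_j ψ / r` and summed over `i, j`. The
factor `1 / r` cancels the volume weight, the terms in `u` reduce to `v_l ∂_kψ`, and integration
over the angle produces `2π` times the identity for `v`. -/
theorem IsProfile.isWeakGrad_angAverage (hp : IsProfile Ω u v)
    (hu2 : MemLp u 2 (volume.restrict Ω))
    {F : Eu 3 → Matrix (Fin 3) (Fin 3) ℝ} (hF : IsWeakGrad Ω u F)
    (hFi : ∀ i j, IntegrableOn (fun x => F x i j) Ω) :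
    IsWeakGrad (meridian Ω) v (angAverage F) := by
  have hv := hp.integrableOn D hu2
  have hG := integrableOn_angAverage D hFi
  refine ⟨fun l => (hv l).locallyIntegrableOn, fun l k => (hG l k).locallyIntegrableOn,
    fun l k ψ hψ => ?_⟩
  have a1 := integrable_mul_of_test (hv l).locallyIntegrableOn (hψ.pd k)
  have a2 := integrable_mul_of_test (hG l k).locallyIntegrableOn hψ
  rw [eq_neg_iff_add_eq_zero, ← integral_add a1 a2]
  have ht := fun i j => isTest_frameTest D hψ l k i j
  have i1 := fun i j => integrable_mul_of_test (hF.1 i) ((ht i j).pd j)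
  have i2 := fun i j => integrable_mul_of_test (hF.2.1 i j) (ht i j)
  have i3 : ∀ i j, Integrable (fun x => u x i * pd j (frameTest l k ψ i j) x +
      F x i j * frameTest l k ψ i j x) (volume.restrict Ω) := fun i j => (i1 i j).add (i2 i j)
  have i4 : Integrable (fun x => ∑ i, ∑ j, (u x i * pd j (frameTest l k ψ i j) x +
      F x i j * frameTest l k ψ i j x)) (volume.restrict Ω) :=
    integrable_finsetSum _ fun i _ => integrable_finsetSum _ fun j _ => i3 i j
  have hz : ∫ x in Ω, ∑ i, ∑ j, (u x i * pd j (frameTest l k ψ i j) x +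
      F x i j * frameTest l k ψ i j x) = 0 := by
    rw [integral_finsetSum _ fun i _ => integrable_finsetSum _ fun j _ => i3 i j]
    refine Finset.sum_eq_zero fun i _ => ?_
    rw [integral_finsetSum _ fun j _ => i3 i j]
    refine Finset.sum_eq_zero fun j _ => ?_
    rw [integral_add (i1 i j) (i2 i j), hF.2.2 i j _ (ht i j), neg_add_cancel]
  rw [D.integral_cyl i4.aestronglyMeasurable] at hz
  have key : ∀ᵐ p ∂(cylMeas Ω), p.1 0 * ∑ i, ∑ j, (u (cyl p.1 p.2) i *
      pd j (frameTest l k ψ i j) (cyl p.1 p.2) +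
      F (cyl p.1 p.2) i j * frameTest l k ψ i j (cyl p.1 p.2)) =
      v p.1 l * pd k ψ p.1 +
        ψ p.1 * ∑ i, ∑ j, frm l p.2 i * F (cyl p.1 p.2) i j * frm k p.2 j := by
    filter_upwards [hp.ae_cyl D, D.ae_cylMeas_mem] with p h1 h2
    have h0 := h2.1.ne'
    have e := sum_frame_pd l k p.2 (p.1 0) (pd 0 (fun Y => 1 / Y 0 * ψ Y) p.1)
      (pd 1 (fun Y => 1 / Y 0 * ψ Y) p.1) (1 / p.1 0 * ψ p.1) (v p.1)
    have e' : ![pd 0 (fun Y : Eu 2 => 1 / Y 0 * ψ Y) p.1, pd 1 (fun Y => 1 / Y 0 * ψ Y) p.1] k =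
        pd k (fun Y => 1 / Y 0 * ψ Y) p.1 := by fin_cases k <;> rfl
    rw [pd_eq_radius_mul h2.1 (hψ.differentiable _), ← e', ← e, Finset.mul_sum, Finset.mul_sum,
      ← Finset.sum_add_distrib]
    refine Finset.sum_congr rfl fun i _ => ?_
    rw [Finset.mul_sum, Finset.mul_sum, ← Finset.sum_add_distrib]
    refine Finset.sum_congr rfl fun j _ => ?_
    rw [h1, ← pd_frameTest_cyl D hψ l k i j j h2.1, frameTest_cyl l k ψ i j h2.1]
    field_simp
  rw [integral_congr_ae key] at hz
  have i5 : Integrable (fun p => v p.1 l * pd k ψ p.1 +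
        ψ p.1 * ∑ i, ∑ j, frm l p.2 i * F (cyl p.1 p.2) i j * frm k p.2 j) (cylMeas Ω) :=
    ((D.integrable_cyl i4.aestronglyMeasurable).1 i4).congr key
  rw [cylMeas, integral_prod _ i5] at hz
  have hπ := Real.pi_pos
  have e6 : ∀ᵐ X ∂(volume.restrict (meridian Ω)), ∫ θ, (v X l * pd k ψ X +
        ψ X * ∑ i, ∑ j, frm l θ i * F (cyl X θ) i j * frm k θ j) ∂angMeas =
      2 * Real.pi * (v X l * pd k ψ X + angAverage F X l k * ψ X) := by
    filter_upwards [(integrable_frm_quad D hFi l k).prod_right_ae] with X hX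
    rw [integral_add (integrable_const _) (hX.const_mul _), integral_const, angMeas_univ,
      integral_const_mul, angAverage]
    simp only [Matrix.of_apply, smul_eq_mul]
    field_simp
  rw [integral_congr_ae e6, integral_const_mul] at hz
  exact (mul_eq_zero.1 hz).resolve_left (by positivity)

theorem MemW12.integrableOn_weakGrad (hu : MemW12 Ω u) (i j : Fin 3) :
    IntegrableOn (fun x => weakGrad Ω u x i j) Ω := by
  have := D.finite_volume
  exact (hu.memLp_weakGrad D.isOpen i j).integrable (by norm_num)

omit D in
theorem frm_frameGrad (θ q : ℝ) (G : Matrix (Fin 2) (Fin 2) ℝ) (l k : Fin 2) :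
    ∑ i, ∑ j, frm l θ i * frameGrad (eR θ) (eT θ) q G i j * frm k θ j = G l k := by
  have h := Real.sin_sq θ
  fin_cases l <;> fin_cases k <;>
    simp [Fin.sum_univ_three, frm, eR, eT, eZ, prof, frameGrad] <;> ring_nf <;>
    simp only [h, show Real.sin θ ^ 4 = (Real.sin θ ^ 2) ^ 2 by ring] <;> ring

/-- The profile of an axisymmetric `W^{1,2}` map is `W^{1,2}`, and its gradient is the gradient of
the map in the moving frame. -/
theorem IsProfile.memW12 (hp : IsProfile Ω u v) (hu : MemW12 Ω u) :
    MemW12 (meridian Ω) v ∧ ∀ᵐ p ∂(cylMeas Ω), weakGrad Ω u (cyl p.1 p.2) =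
      frameGrad (eR p.2) (eT p.2) (v p.1 0 / p.1 0) (weakGrad (meridian Ω) v p.1) := by
  have hFi := MemW12.integrableOn_weakGrad D hu
  have hw := hp.isWeakGrad_angAverage D hu.1 hu.isWeakGrad hFi
  have hv := hp.integrableOn D hu.1
  have hG := integrableOn_angAverage D hFi
  -- The averaged gradient is lifted back to `Ω` and compared with `Du` by uniqueness of weak
  -- gradients; hence averaging has lost nothing.
  have hl := isWeakGrad_axiLift D hv hG hw
  have hae : ∀ᵐ x ∂(volume.restrict Ω), weakGrad Ω u x = liftGrad v (angAverage (weakGrad Ω u)) x :=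
    hu.isWeakGrad.ae_eq D.isOpen (hl.congr_ae (by
      filter_upwards [hp.1] with x hx using hx.symm))
  have h1 : ∀ᵐ p ∂(cylMeas Ω), weakGrad Ω u (cyl p.1 p.2) =
      frameGrad (eR p.2) (eT p.2) (v p.1 0 / p.1 0) (angAverage (weakGrad Ω u) p.1) := by
    filter_upwards [D.quasiMeasurePreserving_cyl.ae hae, D.ae_cylMeas_mem] with p h2 h3
    rw [h2, liftGrad_cyl _ _ h3.1]
  have hGe := hw.weakGrad_ae_eq D.isOpen_meridian
  refine ⟨⟨?_, _, hw, fun l k => ?_⟩, ?_⟩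
  · have hvl : ∀ l, MemLp (fun X => v X l) 2 (volume.restrict (meridian Ω)) := by
      intro l
      refine memLp_two_sq (hv l).aestronglyMeasurable ?_
      refine Integrable.of_comp_fst (ν := angMeas) ?_ angMeas_ne_zero
      -- The frame is orthonormal, so `|v|² = |u|²`.
      have hi : Integrable (fun p : Eu 2 × ℝ => ∑ i, u (cyl p.1 p.2) i ^ 2) (cylMeas Ω) :=
        integrable_finsetSum _ fun i _ =>
          D.integrable_comp_cyl (MemLp.integrableOn_coord D hu.1 i).2
      refine hi.mono' ((hv l).aestronglyMeasurable.pow 2).comp_fst ?_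
      filter_upwards [hp.ae_cyl D] with p h
      have hs := Real.cos_sq_add_sin_sq p.2
      simp only [h, Fin.sum_univ_three, eR, eZ, prof, Real.norm_eq_abs, abs_sq]
      have : ∀ l, v p.1 l ^ 2 ≤ v p.1 0 ^ 2 + v p.1 1 ^ 2 := by
        intro l
        fin_cases l
        · simpa using sq_nonneg (v p.1 1)
        · simpa using sq_nonneg (v p.1 0)
      refine (this l).trans (le_of_eq ?_)
      simp
      linear_combination -(v p.1 0 ^ 2) * hs
    exact MemLp.of_eval_piLp hvl
  · refine memLp_two_sq (hG l k).aestronglyMeasurable ?_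
    refine Integrable.of_comp_fst (ν := angMeas) ?_ angMeas_ne_zero
    -- The double sum of ones is the constant `9` of Cauchy–Schwarz over the nine entries; the frame
    -- coefficients are at most `1` in absolute value.
    have hi : Integrable (fun p : Eu 2 × ℝ => (∑ i : Fin 3, ∑ j : Fin 3, (1 : ℝ)) * ∑ i, ∑ j,
        weakGrad Ω u (cyl p.1 p.2) i j ^ 2) (cylMeas Ω) :=
      (integrable_finsetSum _ fun i _ => integrable_finsetSum _ fun j _ =>
        D.integrable_comp_cyl (hu.memLp_weakGrad D.isOpen i j).integrable_sq).const_mul _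
    refine hi.mono' ((hG l k).aestronglyMeasurable.pow 2).comp_fst ?_
    filter_upwards [h1] with p h
    rw [← frm_frameGrad p.2 (v p.1 0 / p.1 0) (angAverage (weakGrad Ω u) p.1) l k, ← h,
      Real.norm_eq_abs, abs_sq]
    simp only [← Finset.sum_product']
    refine (sq_sum_le_card_mul_sum_sq).trans ?_
    simp only [Finset.sum_const, nsmul_eq_mul, mul_one]
    refine mul_le_mul_of_nonneg_left (Finset.sum_le_sum fun q _ => ?_) (by positivity)
    have b1 := abs_frm_le l q.1 p.2
    have b2 := abs_frm_le k q.2 p.2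
    rw [sq_le_sq, abs_mul, abs_mul]
    calc _ ≤ 1 * |weakGrad Ω u (cyl p.1 p.2) q.1 q.2| * 1 := by gcongr
      _ = _ := by ring
  · filter_upwards [h1, Measure.quasiMeasurePreserving_fst.ae hGe] with p h2 h3
    rw [h2, h3]

end

/-! ### Algebra of axisymmetric tensors -/

/-- In the orthonormal frame these tensors are block diagonal, so products, determinants and inner
products are computed block by block. In Cartesian entries this amounts to polynomial identities
modulo `sin² + cos² = 1`, so higher powers of the sine are eliminated before `ring`. -/
theorem frameGrad_transpose_mul (θ q : ℝ) (G : Matrix (Fin 2) (Fin 2) ℝ) :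
    (frameGrad (eR θ) (eT θ) q G).transpose * frameGrad (eR θ) (eT θ) q G =
      frameGrad (eR θ) (eT θ) (q ^ 2) (G.transpose * G) := by
  have h := Real.sin_sq θ
  have h3 : Real.sin θ ^ 3 = Real.sin θ * (1 - Real.cos θ ^ 2) := by rw [← h]; ring
  have h4 : Real.sin θ ^ 4 = (1 - Real.cos θ ^ 2) ^ 2 := by rw [← h]; ring
  ext i j
  fin_cases i <;> fin_cases j <;>
    simp [Matrix.mul_apply, Fin.sum_univ_three, Fin.sum_univ_two, eR, eT, eZ, prof, frameGrad] <;>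
    ring_nf <;> simp only [h, h3, h4] <;> ring

theorem frameGrad_one (θ : ℝ) :
    frameGrad (eR θ) (eT θ) 1 1 = (1 : Matrix (Fin 3) (Fin 3) ℝ) := by
  have h := Real.cos_sq_add_sin_sq θ
  ext i j
  fin_cases i <;> fin_cases j <;> simp [eR, eT, eZ, prof, frameGrad, Matrix.one_apply] <;> linarith

theorem frameGrad_apply (a t : Fin 3 → ℝ) (q : ℝ) (G : Matrix (Fin 2) (Fin 2) ℝ) (i j : Fin 3) :
    frameGrad a t q G i j =
      (a i + eZ i) * (a j * G (prof i) 0 + eZ j * G (prof i) 1) + t i * t j * q :=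
  rfl

theorem frameGrad_add (a t : Fin 3 → ℝ) (q q' : ℝ) (G G' : Matrix (Fin 2) (Fin 2) ℝ) :
    frameGrad a t q G + frameGrad a t q' G' = frameGrad a t (q + q') (G + G') := by
  ext i j
  simp only [frameGrad, Matrix.add_apply, Matrix.of_apply]; ring

theorem frameGrad_smul (a t : Fin 3 → ℝ) (c q : ℝ) (G : Matrix (Fin 2) (Fin 2) ℝ) :
    c • frameGrad a t q G = frameGrad a t (c * q) (c • G) := by
  ext i j
  simp only [frameGrad, Matrix.smul_apply, Matrix.of_apply, smul_eq_mul]; ring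

theorem det_frameGrad (θ q : ℝ) (G : Matrix (Fin 2) (Fin 2) ℝ) :
    (frameGrad (eR θ) (eT θ) q G).det = q * G.det := by
  have h := Real.sin_sq θ
  have h4 : Real.sin θ ^ 4 = (1 - Real.cos θ ^ 2) ^ 2 := by rw [← h]; ring
  rw [Matrix.det_fin_three, Matrix.det_fin_two]
  simp [eR, eT, eZ, prof, frameGrad]
  ring_nf
  simp only [h, h4]
  ring

/-- The Frobenius inner product of two axisymmetric tensors. -/
theorem sum_frameGrad_mul (θ q q' : ℝ) (G G' : Matrix (Fin 2) (Fin 2) ℝ) :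
    ∑ i, ∑ j, frameGrad (eR θ) (eT θ) q G i j * frameGrad (eR θ) (eT θ) q' G' i j =
      q * q' + ∑ l, ∑ k, G l k * G' l k := by
  have h := Real.sin_sq θ
  have h4 : Real.sin θ ^ 4 = (1 - Real.cos θ ^ 2) ^ 2 := by rw [← h]; ring
  simp [Fin.sum_univ_three, Fin.sum_univ_two, eR, eT, eZ, prof, frameGrad]
  ring_nf
  simp only [h, h4]
  ring

theorem frobSq_frameGrad (θ q : ℝ) (G : Matrix (Fin 2) (Fin 2) ℝ) :
    frobSq (frameGrad (eR θ) (eT θ) q G) = q ^ 2 + frobSq G := by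
  have := sum_frameGrad_mul θ q q G G
  simpa only [frobSq, sq] using this

/-- The energy-momentum tensor in the moving frame. -/
theorem energyMomentum_frame {H : ℝ → ℝ} {Ω : Set (Eu 3)} {u : Eu 3 → Eu 3} {v : Eu 2 → Eu 2}
    {x : Eu 3} {X : Eu 2} {θ : ℝ} (h : weakGrad Ω u x =
      frameGrad (eR θ) (eT θ) (v X 0 / X 0) (weakGrad (meridian Ω) v X)) :
    energyMomentum H Ω u x = frameGrad (eR θ) (eT θ) (coeffTT H Ω v X)
      !![coeffRR H Ω v X, 2 * drDotDz Ω v X; 2 * drDotDz Ω v X, coeffZZ H Ω v X] := by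
  simp only [energyMomentum]
  rw [h, frameGrad_transpose_mul, det_frameGrad, frobSq_frameGrad, ← frameGrad_one θ,
    frameGrad_smul, frameGrad_smul, frameGrad_add]
  congr 1
  · simp only [coeffTT, redPressure, redDet, drSq, dzSq, frobSq, Fin.sum_univ_two, div_pow]
    ring
  · ext i j
    fin_cases i <;> fin_cases j <;>
      simp [coeffRR, coeffZZ, redPressure, redDet, drSq, dzSq, drDotDz, frobSq, Fin.sum_univ_two,
        div_pow, Matrix.mul_apply] <;> ring

/-! ### Axisymmetric test fields -/

section

variable {Ω : Set (Eu 3)}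

theorem isTest_axiLift (D : IsAxiDomain Ω) {ξ : Eu 2 → Eu 2} (hξ : IsTest (meridian Ω) ξ) :
    IsTest Ω (axiLift ξ) := by
  have h0 := D.isTest_lift (hξ.coord 0) (p := fun x : Eu 3 => (WithLp.toLp 2 (uR x) : Eu 3))
    (fun x hx => by rw [contDiffAt_euclidean]; exact fun i => contDiffAt_uR hx i)
  have h1 := D.isTest_lift (hξ.coord 1) (p := fun _ : Eu 3 => (WithLp.toLp 2 eZ : Eu 3))
    (fun x _ => contDiffAt_const)
  have := h0.add h1
  convert this using 1
  funext x
  ext i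
  rw [axiLift_apply]
  fin_cases i <;> simp [uR, eZ, prof, mul_comm]

theorem jacobian_axiLift_cyl (D : IsAxiDomain Ω) {ξ : Eu 2 → Eu 2} (hξ : IsTest (meridian Ω) ξ)
    {X : Eu 2} (h : 0 < X 0) (θ : ℝ) : jacobian (axiLift ξ) (cyl X θ) =
      frameGrad (eR θ) (eT θ) (ξ X 0 / X 0) (jacobian ξ X) := by
  have ht := isTest_axiLift D hξ
  ext i j
  have hti := ht.coord i
  have hd : ∀ l, DifferentiableAt ℝ (fun Y => ξ Y l) X := fun l => (hξ.coord l).differentiable X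
  have e : ∀ q : Fin 2, ∑ n, frm q θ n * pd n (fun x => axiLift ξ x i) (cyl X θ) =
      (eR θ i + eZ i) * jacobian ξ X (prof i) q := by
    intro q
    rw [← pd_comp_cyl (hti.differentiable _)]
    have : jacobian ξ X (prof i) q = pd q (fun Y => ξ Y (prof i)) X := by
      rw [pd, fderiv_coord (hξ.differentiable X)]; rfl
    rw [this, ← pd_const_mul (hd _)]
    refine pd_congr ?_ q
    filter_upwards [eventually_radius_pos h] with Y hY using axiLift_cyl ξ hY θ i
  have e2 : ∑ n, X 0 * eT θ n * pd n (fun x => axiLift ξ x i) (cyl X θ) =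
      eT θ i * ξ X (prof i) := by
    refine (hasDerivAt_comp_cyl (hti.differentiable _)).unique ?_
    have := ((hasDerivAt_eR i θ).add_const (eZ i)).mul_const (ξ X (prof i))
    refine this.congr_of_eventuallyEq (Eventually.of_forall fun t => ?_)
    exact axiLift_cyl ξ h t i
  have e3 : jacobian (axiLift ξ) (cyl X θ) i j = pd j (fun x => axiLift ξ x i) (cyl X θ) := by
    rw [pd, fderiv_coord (ht.differentiable _)]; rfl
  have h0 := h.ne'
  rw [eT_mul_prof] at e2
  simp only [mul_assoc, ← Finset.mul_sum] at e2
  rw [e3, pd_eq_frame _ _ θ j, e, e]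
  simp only [frameGrad, Matrix.of_apply]
  field_simp
  linear_combination eT θ j * e2

theorem isTest_inv_radius_mul {ψ : Eu 2 → ℝ} (hψ : IsTest (meridian Ω) ψ) :
    IsTest (meridian Ω) (fun Y => 1 / Y 0 * ψ Y) := by
  have hs : tsupport (fun Y : Eu 2 => 1 / Y 0 * ψ Y) ⊆ tsupport ψ := tsupport_mul_subset_right
  refine ⟨?_, hψ.2.1.mul_left, hs.trans hψ.2.2⟩
  rw [contDiff_iff_contDiffAt]
  intro X
  by_cases h : X ∈ tsupport ψ
  · have h0 := (hψ.2.2 h).1.ne'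
    have hc : ContDiffAt ℝ ∞ (fun Y : Eu 2 => Y 0) X :=
      (contDiff_euclidean.1 contDiff_id 0).contDiffAt
    have hi : ContDiffAt ℝ ∞ (fun Y : Eu 2 => (Y 0)⁻¹) X := hc.inv h0
    simp only [one_div]
    exact hi.mul hψ.1.contDiffAt
  · exact contDiffAt_const.congr_of_eventuallyEq
      (notMem_tsupport_iff_eventuallyEq.1 fun h' => h (hs h'))

/-- Stationarity of a tensor field against axisymmetric test fields. -/
def AxiStationary (Ω : Set (Eu 3)) (T : Eu 3 → Matrix (Fin 3) (Fin 3) ℝ) : Prop :=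
  ∀ ξ : Eu 2 → Eu 2, IsTest (meridian Ω) ξ →
    ∫ x in Ω, ∑ i, ∑ j, T x i j * jacobian (axiLift ξ) x i j = 0

variable {T : Eu 3 → Matrix (Fin 3) (Fin 3) ℝ} {A B Z C : Eu 2 → ℝ}

theorem DistribDivFree.axiStationary (D : IsAxiDomain Ω) (h : DistribDivFree Ω T) :
    AxiStationary Ω T := by
  intro ξ hξ
  have ht := isTest_axiLift D hξ
  have e : ∀ x i j, jacobian (axiLift ξ) x i j = pd j (fun x => axiLift ξ x i) x := by
    intro x i j
    rw [pd, fderiv_coord (ht.differentiable _)]; rfl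
  simp only [e]
  have hi := fun i j => integrable_mul_of_test (h.1 i j) ((ht.coord i).pd j)
  rw [integral_finsetSum _ fun i _ => integrable_finsetSum _ fun j _ => hi i j]
  refine Finset.sum_eq_zero fun i _ => ?_
  rw [integral_finsetSum _ fun j _ => hi i j]
  exact neg_eq_zero.1 (h.2 i _ (ht.coord i))

theorem integral_distribEq {a b c : Eu 2 → ℝ} (ha : LocallyIntegrableOn a (meridian Ω))
    (hb : LocallyIntegrableOn b (meridian Ω)) (hc : LocallyIntegrableOn c (meridian Ω))
    {ψ : Eu 2 → ℝ} (hψ : IsTest (meridian Ω) ψ) :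
    ∫ X in meridian Ω, ((X 0 * a X) * pd 0 (fun Y => 1 / Y 0 * ψ Y) X +
        b X * pd 1 ψ X + 1 / X 0 * c X * ψ X) =
      (∫ X in meridian Ω, (X 0 * a X) * pd 0 (fun Y => 1 / Y 0 * ψ Y) X) +
        (∫ X in meridian Ω, b X * pd 1 ψ X) + ∫ X in meridian Ω, 1 / X 0 * c X * ψ X := by
  have hψ' := isTest_inv_radius_mul hψ
  have i1 : Integrable (fun X => (X 0 * a X) * pd 0 (fun Y => 1 / Y 0 * ψ Y) X)
      (volume.restrict (meridian Ω)) := by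
    have := integrable_mul_of_test ha
      ((hψ'.pd 0).mul_left (ψ := fun Y : Eu 2 => Y 0) (contDiff_euclidean.1 contDiff_id 0))
    refine this.congr (Eventually.of_forall fun X => ?_)
    simp only; ring
  have i2 := integrable_mul_of_test hb (hψ.pd 1)
  have i3 : Integrable (fun X => 1 / X 0 * c X * ψ X) (volume.restrict (meridian Ω)) := by
    refine (integrable_mul_of_test hc hψ').congr
      (Eventually.of_forall fun X => ?_)
    simp only; ring
  have e := integral_add (i1.add i2) i3
  have e2 := integral_add i1 i2
  simp only [Pi.add_apply] at e e2
  rw [e, e2]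

/-- For `ξ = (ψ / r) e_l` the frame form of `r T : DX` is free of the angle and equals the integrand
of the `l`-th reduced equation, so stationarity is `2π` times that equation. The entry `ξ₁ / r` of
`DX` on `e_θ ⊗ e_θ` pairs with `C` and produces the right-hand side. -/
theorem AxiStationary.distribEq (D : IsAxiDomain Ω) (h : AxiStationary Ω T)
    (hT : ∀ i j, IntegrableOn (fun x => T x i j) Ω)
    (hA : IntegrableOn A (meridian Ω)) (hB : IntegrableOn B (meridian Ω))
    (hZ : IntegrableOn Z (meridian Ω)) (hC : IntegrableOn C (meridian Ω))
    (hfr : ∀ᵐ p ∂(cylMeas Ω), T (cyl p.1 p.2) =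
      frameGrad (eR p.2) (eT p.2) (C p.1) !![A p.1, B p.1; B p.1, Z p.1]) :
    DistribEq (meridian Ω) A B C ∧ DistribEq (meridian Ω) B Z (fun _ => 0) := by
  have key : ∀ ψ : Eu 2 → ℝ, IsTest (meridian Ω) ψ → ∀ l : Fin 2,
      ∫ X in meridian Ω, ((X 0 * ![A X, B X] l) * pd 0 (fun Y => 1 / Y 0 * ψ Y) X +
        ![B X, Z X] l * pd 1 ψ X + 1 / X 0 * ![C X, 0] l * ψ X) = 0 := by
    intro ψ hψ l
    have hψ' := isTest_inv_radius_mul hψ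
    set ξ : Eu 2 → Eu 2 := fun Y => (1 / Y 0 * ψ Y) • basisVec l with hξd
    have hξ : IsTest (meridian Ω) ξ :=
      hψ'.clm_comp ((ContinuousLinearMap.id ℝ ℝ).smulRight (basisVec l))
    have hξ0 : ∀ Y i, ξ Y i = (if i = l then 1 else 0) * (1 / Y 0 * ψ Y) := by
      intro Y i
      simp only [hξd, basisVec, PiLp.smul_apply, PiLp.single_apply, smul_eq_mul]
      ring
    clear_value ξ
    have h0 := h ξ hξ
    have ht := isTest_axiLift D hξ
    have hm : AEStronglyMeasurable (fun x => ∑ i, ∑ j, T x i j * jacobian (axiLift ξ) x i j)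
        (volume.restrict Ω) := by
      have : ∀ i j, AEStronglyMeasurable (fun x => T x i j * jacobian (axiLift ξ) x i j)
          (volume.restrict Ω) := fun i j =>
        (hT i j).aestronglyMeasurable.mul
          ((ht.fderiv_apply (basisVec j)).coord i).1.continuous.aestronglyMeasurable
      exact Finset.aestronglyMeasurable_fun_sum _ fun i _ =>
        Finset.aestronglyMeasurable_fun_sum _ fun j _ => this i j
    rw [D.integral_cyl hm] at h0
    have hj : ∀ X i k, jacobian ξ X i k = (if i = l then 1 else 0) *
        pd k (fun Y => 1 / Y 0 * ψ Y) X := by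
      intro X i k
      have : jacobian ξ X i k = pd k (fun Y => ξ Y i) X := by
        rw [pd, fderiv_coord (hξ.differentiable X)]; rfl
      rw [this, ← pd_const_mul (hψ'.differentiable X)]
      simp only [hξ0]
    have hae : ∀ᵐ p ∂(cylMeas Ω), p.1 0 * ∑ i, ∑ j, T (cyl p.1 p.2) i j *
        jacobian (axiLift ξ) (cyl p.1 p.2) i j =
        (p.1 0 * ![A p.1, B p.1] l) * pd 0 (fun Y => 1 / Y 0 * ψ Y) p.1 +
        ![B p.1, Z p.1] l * pd 1 ψ p.1 + 1 / p.1 0 * ![C p.1, 0] l * ψ p.1 := by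
      filter_upwards [hfr, D.ae_cylMeas_mem] with p h1 h2
      have h3 := h2.1.ne'
      rw [h1, jacobian_axiLift_cyl D hξ h2.1, sum_frameGrad_mul,
        pd_eq_radius_mul h2.1 (hψ.differentiable _)]
      simp only [hj, hξ0, Fin.sum_univ_two]
      fin_cases l
      · simp
        field_simp
        ring
      · simp
        field_simp
    rw [integral_congr_ae hae] at h0
    have := integral_fun_fst (μ := volume.restrict (meridian Ω)) (ν := angMeas) (fun X =>
      (X 0 * ![A X, B X] l) * pd 0 (fun Y => 1 / Y 0 * ψ Y) X +
        ![B X, Z X] l * pd 1 ψ X + 1 / X 0 * ![C X, 0] l * ψ X)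
    rw [cylMeas, this, angMeas_univ, smul_eq_mul] at h0
    exact (mul_eq_zero.1 h0).resolve_left (by have := Real.pi_pos; positivity)
  have fin : ∀ (a b c : Eu 2 → ℝ), IntegrableOn a (meridian Ω) → IntegrableOn b (meridian Ω) →
      IntegrableOn c (meridian Ω) → (∀ ψ : Eu 2 → ℝ, IsTest (meridian Ω) ψ →
      ∫ X in meridian Ω, ((X 0 * a X) * pd 0 (fun Y => 1 / Y 0 * ψ Y) X +
        b X * pd 1 ψ X + 1 / X 0 * c X * ψ X) = 0) → DistribEq (meridian Ω) a b c := by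
    intro a b c ha hb hc hk
    refine ⟨ha.locallyIntegrableOn, hb.locallyIntegrableOn, hc.locallyIntegrableOn,
      fun ψ hψ => ?_⟩
    have e3 := integral_distribEq ha.locallyIntegrableOn hb.locallyIntegrableOn
      hc.locallyIntegrableOn hψ
    have h0 := hk ψ hψ
    linarith
  exact ⟨fin A B C hA hB hC fun ψ hψ => by simpa using key ψ hψ 0,
    fin B Z (fun _ => 0) hB hZ (integrable_zero _ _ _) fun ψ hψ => by simpa using key ψ hψ 1⟩

/-- The test function need not be axisymmetric. Its radial and axial derivatives are treated at
fixed angle by the reduced equations, tested with `r φ`; its angular derivative is treated by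
periodicity. -/
theorem DistribEq.distribDivFree (D : IsAxiDomain Ω)
    (h0 : DistribEq (meridian Ω) A B C) (h1 : DistribEq (meridian Ω) B Z (fun _ => 0))
    (hT : ∀ i j, IntegrableOn (fun x => T x i j) Ω)
    (hA : IntegrableOn A (meridian Ω)) (hB : IntegrableOn B (meridian Ω))
    (hZ : IntegrableOn Z (meridian Ω)) (hC : IntegrableOn C (meridian Ω))
    (hfr : ∀ᵐ p ∂(cylMeas Ω), T (cyl p.1 p.2) =
      frameGrad (eR p.2) (eT p.2) (C p.1) !![A p.1, B p.1; B p.1, Z p.1]) :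
    DistribDivFree Ω T := by
  refine ⟨fun i j => (hT i j).locallyIntegrableOn, fun i φ hφ => ?_⟩
  have hi := fun j => integrable_mul_of_test (hT i j).locallyIntegrableOn (hφ.pd j)
  rw [neg_eq_zero, ← integral_finsetSum _ fun j _ => hi j,
    D.integral_cyl (integrable_finsetSum _ fun j _ => hi j).aestronglyMeasurable]
  -- The two horizontal rows use the first reduced equation, the vertical row the second. In the
  -- latter `c = 0` is consistent with `C` because the vertical entry of `e_r` is zero.
  obtain ⟨a, b, c, hl, ha, hb, hfrm, hc, hcC⟩ : ∃ a b c : Eu 2 → ℝ,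
      DistribEq (meridian Ω) a b c ∧ IntegrableOn a (meridian Ω) ∧ IntegrableOn b (meridian Ω) ∧
      (∀ X, !![A X, B X; B X, Z X] (prof i) 0 = a X ∧ !![A X, B X; B X, Z X] (prof i) 1 = b X) ∧
      LocallyIntegrableOn c (meridian Ω) ∧ ∀ θ X, (eR θ i + eZ i) * c X = eR θ i * C X := by
    fin_cases i
    · exact ⟨A, B, C, h0, hA, hB, fun X => ⟨rfl, rfl⟩, hC.locallyIntegrableOn,
        fun θ X => by simp [eZ]⟩
    · exact ⟨A, B, C, h0, hA, hB, fun X => ⟨rfl, rfl⟩, hC.locallyIntegrableOn,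
        fun θ X => by simp [eZ]⟩
    · exact ⟨B, Z, fun _ => 0, h1, hB, hZ, fun X => ⟨rfl, rfl⟩, h1.2.2.1,
        fun θ X => by simp [eR]⟩
  have cR : ∀ i, Continuous (fun p : Eu 2 × ℝ => eR p.2 i) := fun i => (continuous_frame i).1
  have cT : ∀ i, Continuous (fun p : Eu 2 × ℝ => eT p.2 i) := fun i => (continuous_frame i).2
  have c0 : Continuous (fun p : Eu 2 × ℝ => p.1 0) := by fun_prop
  set ph : Eu 2 × ℝ → ℝ := fun p => φ (cyl p.1 p.2) with hph
  have cphi : Continuous ph := hφ.1.continuous.comp continuous_cyl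
  have cpd : ∀ k, Continuous (fun p : Eu 2 × ℝ => pd k φ (cyl p.1 p.2)) :=
    fun k => (hφ.pd k).1.continuous.comp continuous_cyl
  have cfrm := continuous_frm
  set dR : Eu 2 × ℝ → ℝ := fun p => ∑ k, frm 0 p.2 k * pd k φ (cyl p.1 p.2) with hdR
  set dZ : Eu 2 × ℝ → ℝ := fun p => ∑ k, frm 1 p.2 k * pd k φ (cyl p.1 p.2) with hdZ
  set dT : Eu 2 × ℝ → ℝ := fun p => ∑ k, eT p.2 k * pd k φ (cyl p.1 p.2) with hdT
  have cdR : Continuous dR := by fun_prop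
  have cdZ : Continuous dZ := by fun_prop
  have cdT : Continuous dT := by fun_prop
  -- The term `C (e_r)_i φ` is added in `J`, where it is the right-hand side of the reduced
  -- equation, and removed in `K`, which becomes `C` times the angular derivative of `(e_θ)_i φ`.
  set J : Eu 2 × ℝ → ℝ := fun p => (a p.1 * ((eR p.2 i + eZ i) * (p.1 0 * dR p)) +
    b p.1 * ((eR p.2 i + eZ i) * (p.1 0 * dZ p))) + C p.1 * (eR p.2 i * ph p) with hJ
  set K : Eu 2 × ℝ → ℝ := fun p => C p.1 * (eT p.2 i * (p.1 0 * dT p) + -eR p.2 i * ph p) with hK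
  have iJ : Integrable J (cylMeas Ω) := by
    refine ((D.integrable_mul_continuous ha ?_).add (D.integrable_mul_continuous hb ?_)).add
      (D.integrable_mul_continuous hC ?_) <;> fun_prop
  have iK : Integrable K (cylMeas Ω) := by
    refine D.integrable_mul_continuous hC ?_
    fun_prop
  have hJ0 : ∫ p, J p ∂(cylMeas Ω) = 0 := by
    refine IsAxiDomain.integral_eq_zero_of_forall_angle iJ fun θ => ?_
    have hs := D.isTest_slice hφ θ
    have ht := isTest_radius_mul_slice D hφ θ
    have e0 := hl.2.2.2 _ ht
    have e1 := integral_distribEq ha.locallyIntegrableOn hb.locallyIntegrableOn hc ht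
    have : ∀ X ∈ meridian Ω, J (X, θ) = (eR θ i + eZ i) *
        (X 0 * a X * pd 0 (fun Y => 1 / Y 0 * (Y 0 * slice φ θ Y)) X +
          b X * pd 1 (fun Y => Y 0 * slice φ θ Y) X + 1 / X 0 * c X * (X 0 * slice φ θ X)) := by
      intro X hX
      have h3 := hX.1.ne'
      have e2 : pd 0 (fun Y => 1 / Y 0 * (Y 0 * slice φ θ Y)) X = pd 0 (slice φ θ) X := by
        refine pd_congr ?_ 0
        filter_upwards [eventually_radius_pos hX.1] with Y hY
        have := hY.ne'
        field_simp
      rw [pd_radius_mul (hs.differentiable X), e2, pd_slice hφ hX.1, pd_slice hφ hX.1]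
      simp only [hJ, hph, hdR, hdZ, slice, if_pos hX.1, one_ne_zero, if_false]
      field_simp
      linear_combination -(φ (cyl X θ)) * hcC θ X
    rw [setIntegral_congr_fun D.isOpen_meridian.measurableSet this, integral_const_mul, e1]
    have : ∀ x y z : ℝ, -x - y = z → x + y + z = 0 := fun x y z h => by linarith
    rw [this _ _ _ e0, mul_zero]
  have hK0 : ∫ p, K p ∂(cylMeas Ω) = 0 := by
    refine D.integral_eq_zero_of_forall_meridian iK fun X hX => ?_
    simp only [hK, hph]
    rw [integral_const_mul]
    have := integral_mul_deriv_angle (a := fun t => eT t i) (a' := fun t => -eR t i)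
      (b := fun t => φ (cyl X t)) (b' := fun t => X 0 * dT (X, t))
      (fun t => hasDerivAt_eT i t)
      (fun t => by
        convert hasDerivAt_comp_cyl (X := X) (hφ.differentiable (cyl X t)) using 1
        simp only [hdT, Finset.mul_sum, mul_assoc])
      (by have := continuous_eR; fun_prop)
      (by fun_prop) (eT_pi i) (by rw [cyl_pi])
    rw [this, mul_zero]
  have : ∫ p, J p + K p ∂(cylMeas Ω) = 0 := by rw [integral_add iJ iK, hJ0, hK0, add_zero]
  rw [← this]
  refine integral_congr_ae ?_
  filter_upwards [hfr] with p hp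
  rw [hp]
  simp only [frameGrad_apply, (hfrm p.1).1, (hfrm p.1).2]
  simp only [hJ, hK, hdR, hdZ, hdT, frm, Fin.sum_univ_three, Matrix.cons_val_zero,
    Matrix.cons_val_one]
  ring

end

/-! ### Growth of the stored energy -/

section Growth

variable {H : ℝ → ℝ} (hH : IsStoredEnergy H)
include hH

theorem IsStoredEnergy.differentiableAt {t : ℝ} (ht : 0 < t) : DifferentiableAt ℝ H t :=
  (hH.contDiffOn.differentiableOn (by simp)).differentiableAt (Ioi_mem_nhds ht)

theorem IsStoredEnergy.continuousOn_deriv : ContinuousOn (deriv H) (Set.Ioi 0) :=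
  hH.contDiffOn.continuousOn_deriv_of_isOpen isOpen_Ioi (by simp)

theorem IsStoredEnergy.tangent_le {a t : ℝ} (ha : 0 < a) (ht : 0 < t) :
    H a + deriv H a * (t - a) ≤ H t := by
  rcases lt_trichotomy a t with h | h | h
  · have := hH.convex.deriv_le_slope ha ht h (hH.differentiableAt ha)
    rw [slope_def_field, le_div_iff₀ (by linarith)] at this
    linarith
  · simp [h]
  · have := hH.convex.slope_le_deriv ht ha h (hH.differentiableAt ha)
    rw [slope_def_field, div_le_iff₀ (by linarith)] at this
    linarith

/-- Near zero and near infinity, `H'(a) a` and `H(t)` are comparable to the same power, and changing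
`t` by a factor of at most two changes a power by a bounded factor. In between, `a` stays in a
compact subset of `(0, ∞)`. -/
theorem IsStoredEnergy.exists_deriv_bound : ∃ C, 0 < C ∧ ∀ t a, 0 < t → t / 2 ≤ a → a ≤ 2 * t →
    |deriv H a| * a ≤ C * (1 + H t) := by
  obtain ⟨s, c₁, c₂, d₀, hs, hc₁, hc₂, hd₀, h0⟩ := hH.growth_zero
  obtain ⟨τ, c₃, c₄, d₁, hτ, hc₃, hc₄, hd₁, h1⟩ := hH.growth_infty
  -- If neither `2t < d₀` nor `t ≥ 2d₁`, then `t/2 ≤ a ≤ 2t` places `a` in this interval.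
  have hK : IsCompact (Set.Icc (d₀ / 4) (4 * d₁)) := isCompact_Icc
  obtain ⟨M, hM⟩ := hK.exists_bound_of_continuousOn
    ((hH.continuousOn_deriv.mono (fun x hx => show (0 : ℝ) < x by linarith [hx.1])).mul
      continuousOn_id)
  set C₁ := c₂ / c₁ * 2 ^ s with hC₁
  set C₂ := c₄ / c₃ * 4 ^ (τ + 2) with hC₂
  have p1 : 0 < C₁ := by positivity
  have p2 : 0 < C₂ := by positivity
  refine ⟨C₁ + C₂ + |M|, by positivity, fun t a ht ha1 ha2 => ?_⟩
  have ha : 0 < a := by linarith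
  have hHt := hH.nonneg t ht
  suffices h : |deriv H a| * a ≤ C₁ * H t ∨ |deriv H a| * a ≤ C₂ * H t ∨ |deriv H a| * a ≤ |M| by
    have q1 : 0 ≤ C₁ * H t := by positivity
    have q2 : 0 ≤ C₂ * H t := by positivity
    have q3 : 0 ≤ |M| * H t := by positivity
    rcases h with h | h | h <;> nlinarith [abs_nonneg M]
  by_cases ht0 : 2 * t < d₀
  · left
    obtain ⟨-, h2, h3⟩ := h0 a ha (by linarith)
    obtain ⟨⟨h4, -⟩, -⟩ := h0 t ht (by linarith)
    have hneg : |deriv H a| = -deriv H a :=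
      abs_of_neg (by have : 0 < c₁ * a ^ (-s - 1) := by positivity
                     linarith)
    have e1 : a ^ (-s - 1) * a = a ^ (-s) := by
      rw [Real.rpow_sub_one ha.ne']; field_simp
    have e2 : a ^ (-s) ≤ 2 ^ s * t ^ (-s) := by
      have : a ^ (-s) ≤ (t / 2) ^ (-s) :=
        Real.rpow_le_rpow_of_nonpos (by linarith) ha1 (by linarith)
      refine this.trans (le_of_eq ?_)
      rw [Real.div_rpow ht.le (by norm_num), Real.rpow_neg (by norm_num : (0:ℝ) ≤ 2), div_inv_eq_mul,
        mul_comm]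
    calc |deriv H a| * a ≤ c₂ * a ^ (-s - 1) * a := by rw [hneg]; gcongr
      _ = c₂ * a ^ (-s) := by rw [mul_assoc, e1]
      _ ≤ c₂ * (2 ^ s * t ^ (-s)) := by gcongr
      _ = C₁ * (c₁ * t ^ (-s)) := by rw [hC₁]; field_simp
      _ ≤ C₁ * H t := by gcongr
  by_cases ht1 : 2 * d₁ ≤ t
  · right; left
    obtain ⟨h2, h3⟩ := h1 a (by linarith)
    obtain ⟨h4, -⟩ := h1 (t / 2) (by linarith)
    have hpos : |deriv H a| = deriv H a :=
      abs_of_pos (by have : 0 < c₃ * a ^ (τ + 1) := by positivity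
                     linarith)
    have ht2 : 0 < t / 2 := by linarith
    have h5 := hH.tangent_le ht2 ht
    have h6 := hH.nonneg _ ht2
    have e : ∀ x : ℝ, 0 < x → x ^ (τ + 1) * x = x ^ (τ + 2) := by
      intro x hx
      rw [← Real.rpow_add_one hx.ne']; congr 1; ring
    -- Near infinity only `H'` is controlled; the tangent at `t/2` and `H(t/2) ≥ 0` give `H(t) ≥
    -- H'(t/2) t/2`.
    have h7 : c₃ * (t / 2) ^ (τ + 2) ≤ H t := by
      have : c₃ * (t / 2) ^ (τ + 1) * (t / 2) ≤ deriv H (t / 2) * (t / 2) := by gcongr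
      rw [mul_assoc, e _ ht2] at this
      have h8 : t - t / 2 = t / 2 := by ring
      rw [h8] at h5
      linarith
    have h9 : a ^ (τ + 2) ≤ 4 ^ (τ + 2) * (t / 2) ^ (τ + 2) := by
      rw [← Real.mul_rpow (by norm_num) ht2.le]
      exact Real.rpow_le_rpow ha.le (by linarith) (by linarith)
    calc |deriv H a| * a ≤ c₄ * a ^ (τ + 1) * a := by rw [hpos]; gcongr
      _ = c₄ * a ^ (τ + 2) := by rw [mul_assoc, e a ha]
      _ ≤ c₄ * (4 ^ (τ + 2) * (t / 2) ^ (τ + 2)) := by gcongr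
      _ = C₂ * (c₃ * (t / 2) ^ (τ + 2)) := by rw [hC₂]; field_simp
      _ ≤ C₂ * H t := by gcongr
  · right; right
    have := hM a ⟨by linarith, by linarith⟩
    simp only [id, Real.norm_eq_abs, abs_mul, Pi.mul_apply] at this
    rw [abs_of_pos ha] at this
    exact this.trans (le_abs_self M)

/-- The tangent at `a` gives `H(a) ≤ H(t) + |H'(a)| |t - a|`, and `|t - a| ≤ a` in this range. -/
theorem IsStoredEnergy.exists_bound : ∃ C, 0 < C ∧ ∀ t a, 0 < t → t / 2 ≤ a → a ≤ 2 * t →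
    |deriv H a| * a ≤ C * (1 + H t) ∧ |H a| ≤ C * (1 + H t) := by
  obtain ⟨C, hC, h⟩ := hH.exists_deriv_bound
  refine ⟨C + 1, by linarith, fun t a ht h1 h2 => ?_⟩
  have ha : 0 < a := by linarith
  have hHt := hH.nonneg t ht
  have hHa := hH.nonneg a ha
  have hb := h t a ht h1 h2
  refine ⟨by linarith, ?_⟩
  rw [abs_of_nonneg hHa]
  have h3 := hH.tangent_le ha ht
  have h4 : -(deriv H a * (t - a)) ≤ |deriv H a| * a := by
    calc -(deriv H a * (t - a)) ≤ |deriv H a * (t - a)| := neg_le_abs _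
      _ = |deriv H a| * |t - a| := abs_mul _ _
      _ ≤ |deriv H a| * a := by
        gcongr
        rw [abs_le]; constructor <;> linarith
  linarith

theorem IsStoredEnergy.aestronglyMeasurable_comp {α : Type*} [MeasurableSpace α] {μ : Measure α}
    {f : α → ℝ} (hf : AEStronglyMeasurable f μ) (hpos : ∀ᵐ x ∂μ, 0 < f x) :
    AEStronglyMeasurable (fun x => H (f x)) μ := by
  -- Nothing is known about `H` off the half-line, so it is replaced there by zero.
  have hm : Measurable ((Set.Ioi (0 : ℝ)).indicator H) := by
    classical
    rw [← Set.piecewise_eq_indicator]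
    exact hH.contDiffOn.continuousOn.measurable_piecewise continuousOn_const measurableSet_Ioi
  refine ((hm.comp_aemeasurable hf.aemeasurable).aestronglyMeasurable).congr ?_
  filter_upwards [hpos] with x hx
  simp [Set.indicator_of_mem (show f x ∈ Set.Ioi 0 from hx)]

end Growth

/-! ### Integrability of the energy-momentum tensor -/

section Integrability

variable {H : ℝ → ℝ} {Ω : Set (Eu 3)} {u : Eu 3 → Eu 3}

theorem integrableOn_mul_weakGrad {m n : ℕ} {U : Set (Eu m)} {u : Eu m → Eu n} (hU : IsOpen U)
    (hu : MemW12 U u) (i k : Fin n) (j l : Fin m) :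
    IntegrableOn (fun x => weakGrad U u x i j * weakGrad U u x k l) U :=
  (hu.memLp_weakGrad hU i j).integrable_mul (hu.memLp_weakGrad hU k l)

theorem integrableOn_frobSq {m n : ℕ} {U : Set (Eu m)} {u : Eu m → Eu n} (hU : IsOpen U)
    (hu : MemW12 U u) : IntegrableOn (fun x => frobSq (weakGrad U u x)) U :=
  integrable_finsetSum _ fun i _ => integrable_finsetSum _ fun j _ =>
    (hu.memLp_weakGrad hU i j).integrable_sq

theorem aestronglyMeasurable_det {n : ℕ} {U : Set (Eu n)} {u : Eu n → Eu n} (hU : IsOpen U)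
    (hu : MemW12 U u) :
    AEStronglyMeasurable (fun x => (weakGrad U u x).det) (volume.restrict U) := by
  simp only [Matrix.det_apply']
  refine Finset.aestronglyMeasurable_fun_sum _ fun σ _ => aestronglyMeasurable_const.mul ?_
  exact Finset.aestronglyMeasurable_fun_prod _ fun i _ =>
    (hu.memLp_weakGrad hU _ _).aestronglyMeasurable

theorem integrableOn_storedEnergy (hH : IsStoredEnergy H) (hU : IsOpen Ω) (hu : MemW12 Ω u)
    (hdet : ∀ᵐ x ∂(volume.restrict Ω), 0 < (weakGrad Ω u x).det) (hE : energy H Ω u < ⊤) :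
    IntegrableOn (fun x => H (weakGrad Ω u x).det) Ω := by
  have hm := hH.aestronglyMeasurable_comp (aestronglyMeasurable_det hU hu) hdet
  refine ⟨hm, ?_⟩
  rw [hasFiniteIntegral_iff_norm]
  refine lt_of_le_of_lt (lintegral_mono_ae ?_) hE
  filter_upwards [hdet] with x hx
  have := hH.nonneg _ hx
  rw [Real.norm_eq_abs, abs_of_nonneg this]
  exact ENNReal.ofReal_le_ofReal (by linarith [frobSq_nonneg (weakGrad Ω u x)])

/-- The growth bound is used with `a = t`; the constant `1` in it is integrable because `Ω` is
bounded. -/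
theorem integrableOn_deriv_mul (hH : IsStoredEnergy H) (D : IsAxiDomain Ω) (hu : MemW12 Ω u)
    (hdet : ∀ᵐ x ∂(volume.restrict Ω), 0 < (weakGrad Ω u x).det) (hE : energy H Ω u < ⊤) :
    IntegrableOn (fun x => deriv H (weakGrad Ω u x).det * (weakGrad Ω u x).det) Ω := by
  have := D.finite_volume
  obtain ⟨C, hC, hb⟩ := hH.exists_bound
  have hi := integrableOn_storedEnergy hH D.isOpen hu hdet hE
  have hm := aestronglyMeasurable_det D.isOpen hu
  have hi2 : Integrable (fun x => C * (1 + H (weakGrad Ω u x).det)) (volume.restrict Ω) :=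
    ((integrable_const _).add hi).const_mul C
  refine hi2.mono' (((measurable_deriv H).comp_aemeasurable
    hm.aemeasurable).aestronglyMeasurable.mul hm) ?_
  filter_upwards [hdet] with x hx
  have := (hb _ (weakGrad Ω u x).det hx (by linarith) (by linarith)).1
  rwa [Real.norm_eq_abs, abs_mul, abs_of_pos hx]

theorem integrableOn_energyMomentum (hH : IsStoredEnergy H) (D : IsAxiDomain Ω) (hu : MemW12 Ω u)
    (hdet : ∀ᵐ x ∂(volume.restrict Ω), 0 < (weakGrad Ω u x).det) (hE : energy H Ω u < ⊤)
    (i j : Fin 3) : IntegrableOn (fun x => energyMomentum H Ω u x i j) Ω := by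
  have h1 : Integrable (fun x => (2 : ℝ) * ∑ k, weakGrad Ω u x k i * weakGrad Ω u x k j)
      (volume.restrict Ω) :=
    (integrable_finsetSum _ fun k _ => integrableOn_mul_weakGrad D.isOpen hu k k i j).const_mul 2
  have h2 := (((integrableOn_deriv_mul hH D hu hdet hE).sub (integrableOn_frobSq D.isOpen hu)).sub
    (integrableOn_storedEnergy hH D.isOpen hu hdet hE)).mul_const
      ((1 : Matrix (Fin 3) (Fin 3) ℝ) i j)
  exact h1.add h2

variable {v : Eu 2 → Eu 2}

theorem IsProfile.energyMomentum_ae (D : IsAxiDomain Ω) (hu : MemW12 Ω u) (hp : IsProfile Ω u v) :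
    ∀ᵐ p ∂(cylMeas Ω), energyMomentum H Ω u (cyl p.1 p.2) =
      frameGrad (eR p.2) (eT p.2) (coeffTT H Ω v p.1)
        !![coeffRR H Ω v p.1, 2 * drDotDz Ω v p.1; 2 * drDotDz Ω v p.1, coeffZZ H Ω v p.1] := by
  filter_upwards [(hp.memW12 D hu).2] with p h
  exact energyMomentum_frame h

/-- Each coefficient is recovered by contracting `T` with two bounded frame vectors. -/
theorem integrableOn_coeff (D : IsAxiDomain Ω) {T : Eu 3 → Matrix (Fin 3) (Fin 3) ℝ}
    (hT : ∀ i j, IntegrableOn (fun x => T x i j) Ω) {S : Eu 2 → Matrix (Fin 2) (Fin 2) ℝ}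
    {C : Eu 2 → ℝ} (h : ∀ᵐ p ∂(cylMeas Ω), T (cyl p.1 p.2) =
      frameGrad (eR p.2) (eT p.2) (C p.1) (S p.1)) :
    (∀ l k, IntegrableOn (fun X => S X l k) (meridian Ω)) ∧ IntegrableOn C (meridian Ω) := by
  constructor
  · intro l k
    refine Integrable.of_comp_fst (ν := angMeas)
      ((integrable_frm_quad D hT l k).congr ?_) angMeas_ne_zero
    filter_upwards [h] with p hp
    rw [hp, frm_frameGrad]
  · have hi : Integrable (fun p => ∑ i, ∑ j, eT p.2 i * T (cyl p.1 p.2) i j * eT p.2 j)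
        (cylMeas Ω) := by
      refine integrable_finsetSum _ fun i _ => integrable_finsetSum _ fun j _ => ?_
      exact ((D.integrable_comp_cyl (hT i j)).bdd_mul (c := 1)
        (continuous_frame i).2.aestronglyMeasurable
        (Eventually.of_forall fun p => abs_eT_le i p.2)).mul_bdd (c := 1)
        (continuous_frame j).2.aestronglyMeasurable
        (Eventually.of_forall fun p => abs_eT_le j p.2)
    refine Integrable.of_comp_fst (ν := angMeas) (hi.congr ?_) angMeas_ne_zero
    filter_upwards [h] with p hp
    rw [hp]
    have h := Real.sin_sq p.2
    simp [Fin.sum_univ_three, eR, eT, eZ, frameGrad]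
    ring_nf
    simp only [h, show Real.sin p.2 ^ 4 = (Real.sin p.2 ^ 2) ^ 2 by ring]
    ring

/-- For maps of finite energy, the reduced equations, the full equations, and stationarity with
respect to axisymmetric variations are equivalent. -/
theorem reducedEquations_tfae (hH : IsStoredEnergy H) (D : IsAxiDomain Ω) (hu : MemW12 Ω u)
    (hdet : ∀ᵐ x ∂(volume.restrict Ω), 0 < (weakGrad Ω u x).det) (hE : energy H Ω u < ⊤)
    (hp : IsProfile Ω u v) :
    List.TFAE [ReducedEquations H Ω v, DistribDivFree Ω (energyMomentum H Ω u),
      AxiStationary Ω (energyMomentum H Ω u)] := by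
  have hT := integrableOn_energyMomentum hH D hu hdet hE
  have hfr := hp.energyMomentum_ae (H := H) D hu
  obtain ⟨hS, hC⟩ := integrableOn_coeff D hT (S := fun X =>
    !![coeffRR H Ω v X, 2 * drDotDz Ω v X; 2 * drDotDz Ω v X, coeffZZ H Ω v X]) hfr
  have hA : IntegrableOn (coeffRR H Ω v) (meridian Ω) := hS 0 0
  have hB : IntegrableOn (fun X => 2 * drDotDz Ω v X) (meridian Ω) := hS 0 1
  have hZ : IntegrableOn (coeffZZ H Ω v) (meridian Ω) := hS 1 1
  tfae_have 1 → 2 := fun h => h.1.distribDivFree D h.2 hT hA hB hZ hC hfr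
  tfae_have 2 → 3 := fun h => h.axiStationary D
  tfae_have 3 → 1 := fun h => h.distribEq D hT hA hB hZ hC hfr
  tfae_finish

end Integrability

/-! ### Diffeomorphisms equal to the identity near the boundary -/

/-- `ψ` is a diffeomorphism of `ℝⁿ` with inverse `χ`, with positive Jacobian, that is the identity
outside a compact subset of `Ω`. -/
structure IsInnerDiffeo {n : ℕ} (Ω : Set (Eu n)) (ψ χ : Eu n → Eu n) : Prop where
  contDiff : ContDiff ℝ ∞ ψ
  contDiff_inv : ContDiff ℝ ∞ χ
  left_inv : ∀ x, χ (ψ x) = x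
  right_inv : ∀ x, ψ (χ x) = x
  compact : ∃ K : Set (Eu n), IsCompact K ∧ K ⊆ Ω ∧ ∀ x ∉ K, ψ x = x
  det_pos : ∀ x, 0 < (jacobian ψ x).det

theorem toMatrix_fderiv {n : ℕ} (ψ : Eu n → Eu n) (x : Eu n) :
    LinearMap.toMatrix (EuclideanSpace.basisFun (Fin n) ℝ).toBasis
      (EuclideanSpace.basisFun (Fin n) ℝ).toBasis (fderiv ℝ ψ x : Eu n →ₗ[ℝ] Eu n) =
      jacobian ψ x := by
  ext i j
  simp [LinearMap.toMatrix_apply, jacobian, basisVec]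

theorem det_fderiv {n : ℕ} (ψ : Eu n → Eu n) (x : Eu n) :
    (fderiv ℝ ψ x).det = (jacobian ψ x).det := by
  rw [← toMatrix_fderiv, LinearMap.det_toMatrix]

theorem jacobian_comp {l m n : ℕ} {f : Eu m → Eu n} {g : Eu l → Eu m} {x : Eu l}
    (hf : DifferentiableAt ℝ f (g x)) (hg : DifferentiableAt ℝ g x) :
    jacobian (fun y => f (g y)) x = jacobian f (g x) * jacobian g x := by
  have e : fderiv ℝ (fun y => f (g y)) x = (fderiv ℝ f (g x)).comp (fderiv ℝ g x) :=
    fderiv_comp x hf hg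
  ext i j
  simp only [jacobian, Matrix.of_apply, Matrix.mul_apply, e, ContinuousLinearMap.comp_apply]
  have hx : fderiv ℝ g x (basisVec j) = ∑ k, fderiv ℝ g x (basisVec j) k • (basisVec k : Eu m) := by
    have := (EuclideanSpace.basisFun (Fin m) ℝ).sum_repr (fderiv ℝ g x (basisVec j))
    simpa [basisVec] using this.symm
  conv_lhs => rw [hx]
  simp [mul_comm]

theorem jacobian_id {n : ℕ} (x : Eu n) : jacobian (fun y : Eu n => y) x = 1 := by
  ext i j
  simp [jacobian, basisVec, Matrix.one_apply]

theorem pd_eq_jacobian {m n : ℕ} {f : Eu m → Eu n} {x : Eu m} (hf : DifferentiableAt ℝ f x)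
    (i : Fin n) (j : Fin m) : pd j (fun y => f y i) x = jacobian f x i j := by
  rw [pd, fderiv_coord hf]; rfl

theorem pd_comp {m n : ℕ} {φ : Eu n → ℝ} {g : Eu m → Eu n} {x : Eu m}
    (hf : DifferentiableAt ℝ φ (g x)) (hg : DifferentiableAt ℝ g x) (k : Fin m) :
    pd k (fun y => φ (g y)) x = ∑ j, pd j φ (g x) * jacobian g x j k := by
  have e : fderiv ℝ (fun y => φ (g y)) x = (fderiv ℝ φ (g x)).comp (fderiv ℝ g x) :=
    fderiv_comp x hf hg
  have hx : fderiv ℝ g x (basisVec k) = ∑ j, fderiv ℝ g x (basisVec k) j • (basisVec j : Eu n) := by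
    have := (EuclideanSpace.basisFun (Fin n) ℝ).sum_repr (fderiv ℝ g x (basisVec k))
    simpa [basisVec] using this.symm
  rw [pd, e, ContinuousLinearMap.comp_apply, hx]
  simp [jacobian, pd, mul_comm]

theorem contDiff_jacobian {m n : ℕ} {f : Eu m → Eu n} (hf : ContDiff ℝ ∞ f) (i : Fin n)
    (j : Fin m) : ContDiff ℝ ∞ (fun x => jacobian f x i j) :=
  contDiff_euclidean.1 ((hf.fderiv_right (m := ∞) (by simp)).clm_apply contDiff_const) i

/-! ### Change of variables along inner diffeomorphisms -/

namespace IsInnerDiffeo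

variable {n : ℕ} {Ω : Set (Eu n)} {ψ χ : Eu n → Eu n} (P : IsInnerDiffeo Ω ψ χ)
include P

theorem differentiable : Differentiable ℝ ψ := P.contDiff.differentiable (by simp)

theorem differentiable_inv : Differentiable ℝ χ := P.contDiff_inv.differentiable (by simp)

theorem jacobian_mul (x : Eu n) : jacobian χ (ψ x) * jacobian ψ x = 1 := by
  rw [← jacobian_comp (P.differentiable_inv _) (P.differentiable _)]
  simp only [P.left_inv]
  exact jacobian_id x

theorem det_mul (x : Eu n) : (jacobian χ (ψ x)).det * (jacobian ψ x).det = 1 := by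
  rw [← Matrix.det_mul, P.jacobian_mul, Matrix.det_one]

theorem symm : IsInnerDiffeo Ω χ ψ where
  contDiff := P.contDiff_inv
  contDiff_inv := P.contDiff
  left_inv := P.right_inv
  right_inv := P.left_inv
  compact := by
    obtain ⟨K, hK, hKΩ, h⟩ := P.compact
    refine ⟨K, hK, hKΩ, fun x hx => ?_⟩
    conv_lhs => rw [← h x hx]
    exact P.left_inv x
  det_pos := by
    intro y
    have h1 := P.det_mul (χ y)
    rw [P.right_inv] at h1
    have h2 := P.det_pos (χ y)
    by_contra hneg
    nlinarith

theorem injective : Function.Injective ψ := Function.LeftInverse.injective P.left_inv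

theorem mem_iff (x : Eu n) : ψ x ∈ Ω ↔ x ∈ Ω := by
  obtain ⟨K, -, hKΩ, h⟩ := P.compact
  constructor
  · intro hx
    by_contra hx'
    rw [h x fun hK => hx' (hKΩ hK)] at hx
    exact hx' hx
  · intro hx
    by_contra hx'
    have := P.injective (h (ψ x) fun hK => hx' (hKΩ hK))
    rw [this] at hx'
    exact hx' hx

theorem image_eq : ψ '' Ω = Ω := by
  ext y
  constructor
  · rintro ⟨x, hx, rfl⟩
    exact (P.mem_iff x).2 hx
  · intro hy
    exact ⟨χ y, (P.symm.mem_iff y).2 hy, P.right_inv y⟩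

theorem abs_det (x : Eu n) : |(fderiv ℝ ψ x).det| = (jacobian ψ x).det := by
  rw [det_fderiv, abs_of_pos (P.det_pos x)]

theorem hasFDerivWithinAt (x : Eu n) : HasFDerivWithinAt ψ (fderiv ℝ ψ x) Ω x :=
  (P.differentiable x).hasFDerivAt.hasFDerivWithinAt

theorem integral_eq (hΩ : MeasurableSet Ω) (f : Eu n → ℝ) :
    ∫ y in Ω, f y = ∫ x in Ω, (jacobian ψ x).det * f (ψ x) := by
  have := integral_image_eq_integral_abs_det_fderiv_smul volume hΩ
    (fun x _ => P.hasFDerivWithinAt x) P.injective.injOn f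
  rw [P.image_eq] at this
  simpa only [P.abs_det, smul_eq_mul] using this

theorem integrableOn_iff (hΩ : MeasurableSet Ω) (f : Eu n → ℝ) :
    IntegrableOn f Ω ↔ IntegrableOn (fun x => (jacobian ψ x).det * f (ψ x)) Ω := by
  have := integrableOn_image_iff_integrableOn_abs_det_fderiv_smul volume hΩ
    (fun x _ => P.hasFDerivWithinAt x) P.injective.injOn f
  rw [P.image_eq] at this
  simpa only [P.abs_det, smul_eq_mul] using this

theorem lintegral_eq (hΩ : MeasurableSet Ω) (f : Eu n → ENNReal) :
    ∫⁻ y in Ω, f y = ∫⁻ x in Ω, ENNReal.ofReal (jacobian ψ x).det * f (ψ x) := by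
  have := lintegral_image_eq_lintegral_abs_det_fderiv_mul volume hΩ
    (fun x _ => P.hasFDerivWithinAt x) P.injective.injOn f
  rw [P.image_eq] at this
  simpa only [P.abs_det] using this

theorem continuous_det : Continuous fun x => (jacobian ψ x).det := by
  simp only [Matrix.det_apply']
  have := fun i j => (contDiff_jacobian P.contDiff i j).continuous
  fun_prop

theorem map_eq (hΩ : MeasurableSet Ω) : Measure.map χ (volume.restrict Ω) =
    (volume.restrict Ω).withDensity fun x => ENNReal.ofReal (jacobian ψ x).det := by
  have h := map_withDensity_abs_det_fderiv_eq_addHaar volume hΩ.nullMeasurableSet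
    (fun x _ => P.hasFDerivWithinAt x) P.injective.injOn
  rw [P.image_eq] at h
  conv_lhs => rw [← h]
  rw [Measure.map_map P.contDiff_inv.continuous.measurable P.contDiff.continuous.measurable]
  have : χ ∘ ψ = id := funext P.left_inv
  rw [this, Measure.map_id]
  simp only [P.abs_det]

theorem quasiMeasurePreserving_inv (hΩ : MeasurableSet Ω) :
    Measure.QuasiMeasurePreserving χ (volume.restrict Ω) (volume.restrict Ω) := by
  refine ⟨P.contDiff_inv.continuous.measurable, ?_⟩
  rw [P.map_eq hΩ]
  exact withDensity_absolutelyContinuous _ _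

theorem map_le (hΩ : MeasurableSet Ω) (hb : Bornology.IsBounded Ω) : ∃ C : ENNReal, C ≠ ⊤ ∧
    Measure.map χ (volume.restrict Ω) ≤ C • volume.restrict Ω := by
  obtain ⟨C, hC⟩ := hb.isCompact_closure.exists_bound_of_continuousOn P.continuous_det.continuousOn
  refine ⟨ENNReal.ofReal C, ENNReal.ofReal_ne_top, ?_⟩
  rw [P.map_eq hΩ, ← withDensity_const]
  refine withDensity_mono ?_
  filter_upwards [ae_restrict_mem hΩ] with x hx
  exact ENNReal.ofReal_le_ofReal ((le_abs_self _).trans (hC x (subset_closure hx)))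

theorem memLp_comp (hΩ : MeasurableSet Ω) (hb : Bornology.IsBounded Ω) {E : Type*}
    [NormedAddCommGroup E] {f : Eu n → E} {p : ENNReal} (hf : MemLp f p (volume.restrict Ω)) :
    MemLp (fun y => f (χ y)) p (volume.restrict Ω) := by
  obtain ⟨C, hC, hle⟩ := P.map_le hΩ hb
  have h := hf.of_measure_le_smul hC hle
  exact (memLp_map_measure_iff h.aestronglyMeasurable
    P.contDiff_inv.continuous.aemeasurable).1 h

theorem integrableOn_comp (hΩ : MeasurableSet Ω) (hb : Bornology.IsBounded Ω)
    {f : Eu n → ℝ} (hf : IntegrableOn f Ω) : IntegrableOn (fun y => f (χ y)) Ω :=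
  memLp_one_iff_integrable.1 (P.memLp_comp hΩ hb (memLp_one_iff_integrable.2 hf))

theorem isTest_comp {E F : Type*} [NormedAddCommGroup E] [NormedSpace ℝ E] [NormedAddCommGroup F]
    [NormedSpace ℝ F] {φ : Eu n × E → F} (hφ : IsTest (Ω ×ˢ Set.univ) φ) :
    IsTest (Ω ×ˢ Set.univ) (fun p => φ (ψ p.1, p.2)) := by
  have hc : Continuous (fun p : Eu n × E => (ψ p.1, p.2)) :=
    (P.contDiff.continuous.comp continuous_fst).prodMk continuous_snd
  have hc' : Continuous (fun p : Eu n × E => (χ p.1, p.2)) :=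
    (P.contDiff_inv.continuous.comp continuous_fst).prodMk continuous_snd
  have hK : IsCompact ((fun p : Eu n × E => (χ p.1, p.2)) '' tsupport φ) := hφ.2.1.image hc'
  have hs : Function.support (fun p : Eu n × E => φ (ψ p.1, p.2)) ⊆
      (fun p : Eu n × E => (χ p.1, p.2)) '' tsupport φ := fun p hp =>
    ⟨(ψ p.1, p.2), subset_tsupport _ hp, by simp [P.left_inv]⟩
  refine ⟨hφ.1.comp ((P.contDiff.comp contDiff_fst).prodMk contDiff_snd),
    HasCompactSupport.of_support_subset_isCompact hK hs,
    (closure_minimal hs hK.isClosed).trans ?_⟩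
  rintro _ ⟨q, hq, rfl⟩
  exact ⟨(P.symm.mem_iff _).2 (hφ.2.2 hq).1, trivial⟩

theorem isTest_comp_left {F : Type*} [NormedAddCommGroup F]
    [NormedSpace ℝ F] {φ : Eu n → F} (hφ : IsTest Ω φ) : IsTest Ω (fun x => φ (ψ x)) := by
  have hK : IsCompact (χ '' tsupport φ) := hφ.2.1.image P.contDiff_inv.continuous
  have hs : Function.support (fun x => φ (ψ x)) ⊆ χ '' tsupport φ := fun p hp =>
    ⟨ψ p, subset_tsupport _ hp, P.left_inv p⟩
  refine ⟨hφ.1.comp P.contDiff, HasCompactSupport.of_support_subset_isCompact hK hs,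
    (closure_minimal hs hK.isClosed).trans ?_⟩
  rintro _ ⟨q, hq, rfl⟩
  exact (P.symm.mem_iff _).2 (hφ.2.2 hq)

end IsInnerDiffeo

/-! ### Piola identity and the chain rule -/

theorem pd_comm {n : ℕ} {f : Eu n → ℝ} (hf : ContDiff ℝ ∞ f) (j k : Fin n) (x : Eu n) :
    pd j (pd k f) x = pd k (pd j f) x := by
  have hd : Differentiable ℝ (fderiv ℝ f) :=
    (hf.fderiv_right (m := ∞) (by simp)).differentiable (by simp)
  have e : ∀ a b : Fin n, pd a (pd b f) x = fderiv ℝ (fderiv ℝ f) x (basisVec a) (basisVec b) := by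
    intro a b
    change fderiv ℝ (fun y => fderiv ℝ f y (basisVec b)) x (basisVec a) = _
    rw [fderiv_clm_apply (hd x) (differentiableAt_const _)]
    simp
  rw [e, e]
  exact (hf.contDiffAt.isSymmSndFDerivAt (by simpa using ENat.LEInfty.out)).eq _ _

theorem pd_mul {n : ℕ} {f g : Eu n → ℝ} {x : Eu n} (hf : DifferentiableAt ℝ f x)
    (hg : DifferentiableAt ℝ g x) (k : Fin n) :
    pd k (fun y => f y * g y) x = f x * pd k g x + pd k f x * g x := by
  rw [pd, fderiv_fun_mul hf hg]
  simp [pd, mul_comm]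

theorem pd_sub {n : ℕ} {f g : Eu n → ℝ} {x : Eu n} (hf : DifferentiableAt ℝ f x)
    (hg : DifferentiableAt ℝ g x) (k : Fin n) :
    pd k (fun y => f y - g y) x = pd k f x - pd k g x := by
  rw [pd, fderiv_fun_sub hf hg]; rfl

theorem pd_mul_sub_mul {n : ℕ} {a b c d : Eu n → ℝ} {x : Eu n} (ha : DifferentiableAt ℝ a x)
    (hb : DifferentiableAt ℝ b x) (hc : DifferentiableAt ℝ c x) (hd : DifferentiableAt ℝ d x)
    (k : Fin n) : pd k (fun y => a y * b y - c y * d y) x =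
      (a x * pd k b x + pd k a x * b x) - (c x * pd k d x + pd k c x * d x) := by
  rw [pd_sub (ha.fun_mul hb) (hc.fun_mul hd), pd_mul ha hb, pd_mul hc hd]

theorem contDiff_pd {n : ℕ} {f : Eu n → ℝ} (hf : ContDiff ℝ ∞ f) (k : Fin n) :
    ContDiff ℝ ∞ (pd k f) :=
  (hf.fderiv_right (m := ∞) (by simp)).clm_apply contDiff_const

theorem contDiff_adjugate {ψ : Eu 3 → Eu 3} (hψ : ContDiff ℝ ∞ ψ) (k j : Fin 3) :
    ContDiff ℝ ∞ (fun x => (jacobian ψ x).adjugate k j) := by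
  have h := fun a b => contDiff_jacobian hψ a b
  simp only [Matrix.adjugate_fin_three]
  fin_cases k <;> fin_cases j <;> simp <;> fun_prop

/-- The rows of the adjugate of a Jacobian matrix are divergence free. -/
theorem piola {ψ : Eu 3 → Eu 3} (hψ : ContDiff ℝ ∞ ψ) (j : Fin 3) (x : Eu 3) :
    ∑ k, pd k (fun y => (jacobian ψ y).adjugate k j) x = 0 := by
  have hc : ∀ a, ContDiff ℝ ∞ (fun y => ψ y a) := fun a => contDiff_euclidean.1 hψ a
  have hJ : ∀ a b, (fun y => jacobian ψ y a b) = pd b (fun y => ψ y a) := by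
    intro a b; funext y
    rw [pd_eq_jacobian (hψ.differentiable (by simp) y)]
  have hJ' : ∀ y a b, jacobian ψ y a b = pd b (fun y => ψ y a) y := fun y a b =>
    congrFun (hJ a b) y
  have hd : ∀ a b, DifferentiableAt ℝ (pd b (fun y => ψ y a)) x := fun a b =>
    (contDiff_pd (hc a) b).differentiable (by simp) x
  have s10 := fun a => pd_comm (hc a) 1 0 x
  have s20 := fun a => pd_comm (hc a) 2 0 x
  have s21 := fun a => pd_comm (hc a) 2 1 x
  rw [Fin.sum_univ_three]
  simp only [Matrix.adjugate_fin_three, hJ']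
  fin_cases j <;> simp [neg_add_eq_sub] <;>
    rw [pd_mul_sub_mul (hd _ _) (hd _ _) (hd _ _) (hd _ _),
      pd_mul_sub_mul (hd _ _) (hd _ _) (hd _ _) (hd _ _),
      pd_mul_sub_mul (hd _ _) (hd _ _) (hd _ _) (hd _ _)] <;>
    simp only [s10, s20, s21] <;> ring

section ChainRule

variable {Ω : Set (Eu 3)} {ψ χ : Eu 3 → Eu 3} (P : IsInnerDiffeo Ω ψ χ)
include P

theorem IsInnerDiffeo.adjugate_eq (x : Eu 3) :
    (jacobian ψ x).adjugate = (jacobian ψ x).det • jacobian χ (ψ x) := by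
  have h1 := P.jacobian_mul x
  have h2 := Matrix.mul_adjugate (jacobian ψ x)
  calc (jacobian ψ x).adjugate = (jacobian χ (ψ x) * jacobian ψ x) * (jacobian ψ x).adjugate := by
        rw [h1, one_mul]
    _ = _ := by rw [mul_assoc, h2]; simp

/-- After the substitution `y = ψ(x)`, the Piola identity moves the coefficients `adj Dψ` under the
derivative. The weak gradient of `u` can then be tested with the smooth functions `(adj Dψ)_kj
φ(ψ(x))`, and no approximation of `u` is needed. -/
theorem IsInnerDiffeo.isWeakGrad_comp {m : ℕ} (hΩ : MeasurableSet Ω) (hb : Bornology.IsBounded Ω)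
    {u : Eu 3 → Eu m} {F : Eu 3 → Matrix (Fin m) (Fin 3) ℝ}
    (hu : ∀ i, IntegrableOn (fun x => u x i) Ω) (hF : ∀ i j, IntegrableOn (fun x => F x i j) Ω)
    (h : IsWeakGrad Ω u F) :
    IsWeakGrad Ω (fun y => u (χ y)) (fun y => F (χ y) * jacobian χ y) := by
  have hJ : ∀ i j, IntegrableOn (fun y => (F (χ y) * jacobian χ y) i j) Ω := by
    intro i j
    simp only [Matrix.mul_apply]
    refine integrable_finsetSum _ fun k _ => ?_
    have hc := (contDiff_jacobian P.contDiff_inv k j).continuous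
    obtain ⟨C, hC⟩ := hb.isCompact_closure.exists_bound_of_continuousOn hc.continuousOn
    refine Integrable.mul_bdd (c := C) (P.integrableOn_comp hΩ hb (hF i k))
      hc.aestronglyMeasurable ?_
    filter_upwards [ae_restrict_mem hΩ] with x hx using hC x (subset_closure hx)
  refine ⟨fun i => (P.integrableOn_comp hΩ hb (hu i)).locallyIntegrableOn,
    fun i j => (hJ i j).locallyIntegrableOn, fun i j φ hφ => ?_⟩
  rw [P.integral_eq hΩ (fun y => u (χ y) i * pd j φ y),
    P.integral_eq hΩ (fun y => (F (χ y) * jacobian χ y) i j * φ y)]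
  simp only [P.left_inv]
  have ht := P.isTest_comp_left hφ
  have htk : ∀ k, IsTest Ω (fun x => (jacobian ψ x).adjugate k j * φ (ψ x)) := fun k =>
    ht.mul_left (contDiff_adjugate P.contDiff k j)
  -- The derivatives of the adjugate cancel by Piola; those of `φ ∘ ψ` recombine through `Dψ adj Dψ
  -- = det Dψ`.
  have e1 : ∀ x, (jacobian ψ x).det * (u x i * pd j φ (ψ x)) =
      ∑ k, u x i * pd k (fun x => (jacobian ψ x).adjugate k j * φ (ψ x)) x := by
    intro x
    have hp := piola P.contDiff j x
    have hd : ∀ k, DifferentiableAt ℝ (fun y => (jacobian ψ y).adjugate k j) x := fun k =>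
      (contDiff_adjugate P.contDiff k j).differentiable (by simp) x
    simp_rw [fun k => pd_mul (hd k) (ht.differentiable x) k]
    rw [← Finset.mul_sum, Finset.sum_add_distrib, ← Finset.sum_mul, hp]
    simp_rw [pd_comp (hφ.differentiable _) (P.differentiable x)]
    have : ∑ k, (jacobian ψ x).adjugate k j * ∑ l, pd l φ (ψ x) * jacobian ψ x l k =
        ∑ l, pd l φ (ψ x) * (jacobian ψ x * (jacobian ψ x).adjugate) l j := by
      simp only [Matrix.mul_apply, Finset.mul_sum]
      rw [Finset.sum_comm]
      exact Finset.sum_congr rfl fun l _ => Finset.sum_congr rfl fun k _ => by ring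
    rw [this, Matrix.mul_adjugate]
    simp [Matrix.one_apply]
    ring
  have e2 : ∀ x, (jacobian ψ x).det * ((F x * jacobian χ (ψ x)) i j * φ (ψ x)) =
      ∑ k, F x i k * ((jacobian ψ x).adjugate k j * φ (ψ x)) := by
    intro x
    rw [P.adjugate_eq]
    simp only [Matrix.mul_apply, Matrix.smul_apply, smul_eq_mul, Finset.sum_mul, Finset.mul_sum]
    exact Finset.sum_congr rfl fun k _ => by ring
  simp only [e1, e2]
  rw [integral_finsetSum _ fun k _ => integrable_mul_of_test (h.1 i) ((htk k).pd k),
    integral_finsetSum _ fun k _ => integrable_mul_of_test (h.2.1 i k) (htk k),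
    ← Finset.sum_neg_distrib]
  exact Finset.sum_congr rfl fun k _ => h.2.2 i k _ (htk k)

theorem IsInnerDiffeo.memW12_comp {m : ℕ} (hΩ : IsOpen Ω) (hb : Bornology.IsBounded Ω)
    {u : Eu 3 → Eu m} (hu : MemW12 Ω u) :
    MemW12 Ω (fun y => u (χ y)) ∧ ∀ᵐ y ∂(volume.restrict Ω),
      weakGrad Ω (fun y => u (χ y)) y = weakGrad Ω u (χ y) * jacobian χ y := by
  have := isFiniteMeasure_restrict_of_isBounded hb
  have hui : ∀ i, IntegrableOn (fun x => u x i) Ω := fun i =>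
    (hu.1.eval_piLp i).integrable (by norm_num)
  have hFi : ∀ i j, IntegrableOn (fun x => weakGrad Ω u x i j) Ω := fun i j =>
    (hu.memLp_weakGrad hΩ i j).integrable (by norm_num)
  have hw := P.isWeakGrad_comp hΩ.measurableSet hb hui hFi hu.isWeakGrad
  refine ⟨⟨P.memLp_comp hΩ.measurableSet hb hu.1, _, hw, fun i j => ?_⟩, hw.weakGrad_ae_eq hΩ⟩
  simp only [Matrix.mul_apply]
  refine memLp_finsetSum _ fun k _ => ?_
  have hc := (contDiff_jacobian P.contDiff_inv k j).continuous
  obtain ⟨C, hC⟩ := hb.isCompact_closure.exists_bound_of_continuousOn hc.continuousOn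
  have h1 := P.memLp_comp hΩ.measurableSet hb (hu.memLp_weakGrad hΩ i k)
  refine MemLp.of_le_mul (c := C) h1 (h1.aestronglyMeasurable.mul hc.aestronglyMeasurable) ?_
  filter_upwards [ae_restrict_mem hΩ.measurableSet] with x hx
  rw [norm_mul, mul_comm]
  exact mul_le_mul_of_nonneg_right (hC x (subset_closure hx)) (norm_nonneg _)

end ChainRule

/-! ### Functions with vanishing trace -/

theorem frobSq_add_le {m n : ℕ} (A B : Matrix (Fin n) (Fin m) ℝ) :
    frobSq (A + B) ≤ 2 * frobSq A + 2 * frobSq B := by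
  simp only [frobSq, Finset.mul_sum, ← Finset.sum_add_distrib]
  refine Finset.sum_le_sum fun i _ => Finset.sum_le_sum fun j _ => ?_
  rw [Matrix.add_apply]
  nlinarith [sq_nonneg (A i j - B i j)]

theorem frobSq_mul_le {l m n : ℕ} (A : Matrix (Fin n) (Fin m) ℝ) (B : Matrix (Fin m) (Fin l) ℝ) :
    frobSq (A * B) ≤ frobSq A * frobSq B := by
  have h : ∀ i k, (A * B) i k ^ 2 ≤ (∑ j, A i j ^ 2) * ∑ j, B j k ^ 2 := fun i k => by
    rw [Matrix.mul_apply]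
    exact Finset.sum_mul_sq_le_sq_mul_sq _ _ _
  calc frobSq (A * B) ≤ ∑ i, ∑ k, (∑ j, A i j ^ 2) * ∑ j, B j k ^ 2 :=
        Finset.sum_le_sum fun i _ => Finset.sum_le_sum fun k _ => h i k
    _ = frobSq A * frobSq B := by
        simp only [← Finset.mul_sum]
        rw [← Finset.sum_mul, frobSq, frobSq, Finset.sum_comm (f := fun j k => B j k ^ 2)]

theorem MemW120.add {m n : ℕ} {U : Set (Eu m)} (hU : IsOpen U) {u w : Eu m → Eu n}
    (hu : MemW120 U u) (hw : MemW120 U w) : MemW120 U (fun x => u x + w x) := by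
  obtain ⟨hu, φ, hφ, hφ0, hφ1⟩ := hu
  obtain ⟨hw, ψ, hψ, hψ0, hψ1⟩ := hw
  have key : ∀ {f g h : ℕ → Eu m → ℝ}, (∀ k, ∀ᵐ x ∂(volume.restrict U),
      f k x ≤ 2 * g k x + 2 * h k x) → (∀ k x, 0 ≤ g k x) → (∀ k x, 0 ≤ h k x) →
      (∀ k, AEMeasurable (fun x => ENNReal.ofReal (g k x)) (volume.restrict U)) →
      Tendsto (fun k => ∫⁻ x in U, ENNReal.ofReal (g k x)) atTop (𝓝 0) →
      Tendsto (fun k => ∫⁻ x in U, ENNReal.ofReal (h k x)) atTop (𝓝 0) →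
      Tendsto (fun k => ∫⁻ x in U, ENNReal.ofReal (f k x)) atTop (𝓝 0) := by
    intro f g h hf hg hh hm h1 h2
    have h3 : Tendsto (fun k => 2 * (∫⁻ x in U, ENNReal.ofReal (g k x)) +
        2 * ∫⁻ x in U, ENNReal.ofReal (h k x)) atTop (𝓝 (2 * 0 + 2 * 0)) :=
      (ENNReal.Tendsto.const_mul h1 (Or.inr (by simp))).add
        (ENNReal.Tendsto.const_mul h2 (Or.inr (by simp)))
    simp only [mul_zero, add_zero] at h3
    refine tendsto_of_tendsto_of_tendsto_of_le_of_le tendsto_const_nhds h3 (fun _ => zero_le)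
      fun k => ?_
    calc ∫⁻ x in U, ENNReal.ofReal (f k x)
        ≤ ∫⁻ x in U, (2 * ENNReal.ofReal (g k x) + 2 * ENNReal.ofReal (h k x)) := by
          refine lintegral_mono_ae ?_
          filter_upwards [hf k] with x hx
          refine (ENNReal.ofReal_le_ofReal hx).trans (le_of_eq ?_)
          rw [ENNReal.ofReal_add (by linarith [hg k x]) (by linarith [hh k x]),
            ENNReal.ofReal_mul (by norm_num), ENNReal.ofReal_mul (by norm_num)]
          simp
      _ = _ := by
          rw [lintegral_add_left' ((hm k).const_mul _), lintegral_const_mul' _ _ (by simp),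
            lintegral_const_mul' _ _ (by simp)]
  refine ⟨hu.add hw, fun k x => φ k x + ψ k x, fun k => (hφ k).add (hψ k), ?_, ?_⟩
  · refine key (fun k => ae_of_all _ fun x => ?_) (fun k x => by positivity)
      (fun k x => by positivity) (fun k => ?_) hφ0 hψ0
    · have e : φ k x + ψ k x - (u x + w x) = (φ k x - u x) + (ψ k x - w x) := by abel
      rw [e]
      have h1 := norm_add_le (φ k x - u x) (ψ k x - w x)
      have h2 := norm_nonneg (φ k x - u x + (ψ k x - w x))
      nlinarith [sq_nonneg (‖φ k x - u x‖ - ‖ψ k x - w x‖), norm_nonneg (φ k x - u x),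
        norm_nonneg (ψ k x - w x)]
    · exact (((hφ k).1.continuous.aestronglyMeasurable.sub
        hu.1.aestronglyMeasurable).norm.pow 2).aemeasurable.ennreal_ofReal
  · refine key (fun k => ?_) (fun k x => frobSq_nonneg _)
      (fun k x => frobSq_nonneg _) (fun k => ?_) hφ1 hψ1
    · filter_upwards [(hu.isWeakGrad.add hw.isWeakGrad).weakGrad_ae_eq hU] with x hx
      rw [hx]
      refine le_trans (le_of_eq (congrArg frobSq ?_)) (frobSq_add_le _ _)
      have : jacobian (fun x => φ k x + ψ k x) x = jacobian (φ k) x + jacobian (ψ k) x := by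
        ext i j
        simp only [jacobian, Matrix.of_apply, Matrix.add_apply]
        rw [fderiv_fun_add ((hφ k).differentiable x) ((hψ k).differentiable x)]
        rfl
      rw [this]; abel
    · refine AEMeasurable.ennreal_ofReal ?_
      simp only [frobSq, Matrix.sub_apply]
      refine Finset.aemeasurable_fun_sum _ fun i _ => Finset.aemeasurable_fun_sum _ fun j _ => ?_
      exact (((contDiff_jacobian (hφ k).1 i j).continuous.aemeasurable).sub
        (hu.memLp_weakGrad hU i j).aestronglyMeasurable.aemeasurable).pow_const 2

/-- Mollification of a compactly supported `C¹` map, uniformly close in `C¹`. -/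
theorem exists_isTest_approx {m n : ℕ} {U : Set (Eu m)} (hU : IsOpen U) {h : Eu m → Eu n}
    (hh : ContDiff ℝ 1 h) (hc : HasCompactSupport h) (hs : tsupport h ⊆ U) {ε : ℝ} (hε : 0 < ε) :
    ∃ φ, IsTest U φ ∧ (∀ x, ‖φ x - h x‖ ≤ ε) ∧
      ∀ x i j, |jacobian φ x i j - jacobian h x i j| ≤ ε := by
  -- The mollification radius must keep the support inside `U` (`δ₀`) and respect the uniform
  -- continuity of `h` (`δ₁`) and of each partial derivative (`δ₂ j`).
  obtain ⟨δ₀, hδ₀, hsub⟩ := hc.isCompact.exists_cthickening_subset_open hU hs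
  obtain ⟨δ₁, hδ₁, h1⟩ := Metric.uniformContinuous_iff.1
    (hc.uniformContinuous_of_continuous hh.continuous) ε hε
  have hcd : Continuous (fderiv ℝ h) := hh.continuous_fderiv (by simp)
  have hd : ∀ j : Fin m, ∃ δ > 0, ∀ x y, dist x y < δ →
      dist (fderiv ℝ h x (basisVec j)) (fderiv ℝ h y (basisVec j)) < ε := by
    intro j
    obtain ⟨δ, hδ, h2⟩ := Metric.uniformContinuous_iff.1
      ((hc.fderiv_apply (𝕜 := ℝ) (basisVec j)).uniformContinuous_of_continuous
        (hcd.clm_apply continuous_const)) ε hε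
    exact ⟨δ, hδ, fun x y hxy => h2 hxy⟩
  choose δ₂ hδ₂ h2 using hd
  obtain ⟨δ, hδ, hle⟩ : ∃ δ > 0, δ ≤ δ₀ ∧ δ ≤ δ₁ ∧ ∀ j, δ ≤ δ₂ j := by
    obtain ⟨d, hd, hdle⟩ : ∃ d > 0, ∀ j, d ≤ δ₂ j := by
      have : ∀ᶠ d in 𝓝[>] (0 : ℝ), ∀ j, d ≤ δ₂ j :=
        eventually_all.2 fun j => nhdsWithin_le_nhds (Iic_mem_nhds (hδ₂ j))
      obtain ⟨d, h1, h2⟩ := (this.and self_mem_nhdsWithin).exists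
      exact ⟨d, h2, h1⟩
    exact ⟨min d (min δ₀ δ₁), by positivity, by simp, by simp, fun j => by simp [hdle j]⟩
  let b : ContDiffBump (0 : Eu m) := ⟨δ / 2, δ, by positivity, by linarith⟩
  have hbi : LocallyIntegrable (b.normed volume) volume := b.continuous_normed.locallyIntegrable
  let φ := MeasureTheory.convolution (b.normed volume) h (ContinuousLinearMap.lsmul ℝ ℝ) volume
  have hφs : Function.support φ ⊆ Metric.cthickening δ₀ (tsupport h) := by
    refine (support_convolution_subset _).trans ?_
    rw [b.support_normed_eq]
    rintro _ ⟨y, hy, z, hz, rfl⟩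
    refine Metric.mem_cthickening_of_dist_le _ z _ _ (subset_tsupport _ hz) ?_
    have hy' : ‖y‖ < δ := by simpa [b] using hy
    simp only [dist_eq_norm, add_sub_cancel_right]
    linarith [hle.1]
  have hK : IsCompact (Metric.cthickening δ₀ (tsupport h)) := hc.isCompact.cthickening
  refine ⟨φ, ⟨?_, HasCompactSupport.of_support_subset_isCompact hK hφs,
    (closure_minimal hφs hK.isClosed).trans hsub⟩, fun x => ?_, fun x i j => ?_⟩
  · exact b.hasCompactSupport_normed.contDiff_convolution_left _ b.contDiff_normed
      hh.continuous.locallyIntegrable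
  · rw [← dist_eq_norm]
    refine b.dist_normed_convolution_le hh.continuous.aestronglyMeasurable fun y hy => ?_
    exact (h1 (lt_of_lt_of_le hy hle.2.1)).le
  · have hf := hc.hasFDerivAt_convolution_right (ContinuousLinearMap.lsmul ℝ ℝ) hbi hh x
    have e : fderiv ℝ φ x (basisVec j) = MeasureTheory.convolution (b.normed volume)
        (fun a => fderiv ℝ h a (basisVec j)) (ContinuousLinearMap.lsmul ℝ ℝ) volume x := by
      rw [show fderiv ℝ φ x = _ from hf.fderiv]
      exact convolution_precompR_apply _ hbi (hc.fderiv (𝕜 := ℝ)) hcd x _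
    have hdist : dist (fderiv ℝ φ x (basisVec j)) (fderiv ℝ h x (basisVec j)) ≤ ε := by
      rw [e]
      refine b.dist_normed_convolution_le
        (hcd.clm_apply continuous_const).aestronglyMeasurable fun y hy => ?_
      exact (h2 j _ _ (lt_of_lt_of_le hy (hle.2.2 j))).le
    simp only [jacobian, Matrix.of_apply]
    rw [dist_eq_norm] at hdist
    exact (PiLp.norm_apply_le (fderiv ℝ φ x (basisVec j) - fderiv ℝ h x (basisVec j)) i).trans hdist

theorem continuous_jacobian_of_contDiff_one {m n : ℕ} {h : Eu m → Eu n} (hh : ContDiff ℝ 1 h)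
    (i : Fin n) (j : Fin m) : Continuous (fun x => jacobian h x i j) := by
  have : Continuous fun x => fderiv ℝ h x (basisVec j) :=
    (hh.continuous_fderiv (by simp)).clm_apply continuous_const
  simp only [jacobian, Matrix.of_apply]
  fun_prop

theorem isWeakGrad_jacobian {m n : ℕ} (U : Set (Eu m)) {h : Eu m → Eu n}
    (hh : ContDiff ℝ 1 h) : IsWeakGrad U h (jacobian h) := by
  have hcj := continuous_jacobian_of_contDiff_one hh
  have hci : ∀ i, Continuous (fun x => h x i) := fun i => by
    have := hh.continuous
    fun_prop
  refine ⟨fun i => (hci i).locallyIntegrable.locallyIntegrableOn _,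
    fun i j => (hcj i j).locallyIntegrable.locallyIntegrableOn _, fun i j φ hφ => ?_⟩
  have hpd := hφ.pd j
  rw [setIntegral_eq_integral_of_forall_compl_eq_zero fun x hx => by
      rw [hpd.eq_zero_of_notMem hx, mul_zero],
    setIntegral_eq_integral_of_forall_compl_eq_zero fun x hx => by
      rw [hφ.eq_zero_of_notMem hx, mul_zero]]
  have hhd : Differentiable ℝ h := hh.differentiable (by simp)
  have e : ∀ x, fderiv ℝ (fun y => h y i) x (basisVec j) = jacobian h x i j := fun x => by
    rw [fderiv_coord (hhd x)]; rfl
  have := integral_mul_fderiv_eq_neg_fderiv_mul_of_integrable (μ := (volume : Measure (Eu m)))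
    (f := fun y => h y i) (g := φ) (v := basisVec j) ?_ ?_ ?_ ?_ ?_
  · simpa only [e, pd] using this
  · simp only [e]
    exact ((hcj i j).mul hφ.1.continuous).integrable_of_hasCompactSupport hφ.2.1.mul_left
  · exact ((hci i).mul hpd.1.continuous).integrable_of_hasCompactSupport hpd.2.1.mul_left
  · exact ((hci i).mul hφ.1.continuous).integrable_of_hasCompactSupport hφ.2.1.mul_left
  · intro x _
    exact differentiableAt_euclidean.1 (hhd x) i
  · exact fun x _ => hφ.differentiable x

/-- Uniform `C¹` approximation suffices because `U` has finite measure. The lemma is needed for `g ∘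
χ - g`, which is only `C¹`. -/
theorem memW120_of_contDiff {m n : ℕ} {U : Set (Eu m)} (hU : IsOpen U)
    (hb : Bornology.IsBounded U) {h : Eu m → Eu n} (hh : ContDiff ℝ 1 h)
    (hc : HasCompactSupport h) (hs : tsupport h ⊆ U) : MemW120 U h := by
  have := isFiniteMeasure_restrict_of_isBounded hb
  have hcj := continuous_jacobian_of_contDiff_one hh
  have hw := isWeakGrad_jacobian U hh
  have hjc : ∀ i j, HasCompactSupport (fun x => jacobian h x i j) := fun i j =>
    (hc.fderiv_apply (𝕜 := ℝ) (basisVec j)).comp_left (g := fun w : Eu n => w i) rfl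
  have hmem : MemW12 U h := ⟨(hh.continuous.memLp_of_hasCompactSupport hc).restrict _,
    jacobian h, hw, fun i j => ((hcj i j).memLp_of_hasCompactSupport (hjc i j)).restrict _⟩
  have hpos : ∀ k : ℕ, (0 : ℝ) < 1 / ((k : ℝ) + 1) := fun k => by positivity
  choose φ hφ h0 h1 using fun k : ℕ => exists_isTest_approx hU hh hc hs (hpos k)
  have key : ∀ (c : ℝ) (f : ℕ → Eu m → ℝ), (∀ k, ∀ᵐ x ∂(volume.restrict U),
      f k x ≤ c * (1 / ((k : ℝ) + 1)) ^ 2) →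
      Tendsto (fun k => ∫⁻ x in U, ENNReal.ofReal (f k x)) atTop (𝓝 0) := by
    intro c f hf
    have h3 : Tendsto (fun k : ℕ => ENNReal.ofReal (c * (1 / ((k : ℝ) + 1)) ^ 2) * volume U)
        atTop (𝓝 (ENNReal.ofReal (c * 0 ^ 2) * volume U)) := by
      refine ENNReal.Tendsto.mul_const (ENNReal.tendsto_ofReal ?_) (Or.inr hb.measure_lt_top.ne)
      exact ((tendsto_one_div_add_atTop_nhds_zero_nat).pow 2).const_mul c
    simp only [ne_eq, OfNat.ofNat_ne_zero, not_false_eq_true, zero_pow, mul_zero,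
      ENNReal.ofReal_zero, zero_mul] at h3
    refine tendsto_of_tendsto_of_tendsto_of_le_of_le tendsto_const_nhds h3 (fun _ => zero_le)
      fun k => ?_
    calc ∫⁻ x in U, ENNReal.ofReal (f k x)
        ≤ ∫⁻ x in U, ENNReal.ofReal (c * (1 / ((k : ℝ) + 1)) ^ 2) :=
          lintegral_mono_ae ((hf k).mono fun x hx => ENNReal.ofReal_le_ofReal hx)
      _ = _ := by simp
  refine ⟨hmem, φ, hφ, key 1 _ fun k => ae_of_all _ fun x => ?_, key (n * m) _ fun k => ?_⟩
  · rw [one_mul]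
    exact pow_le_pow_left₀ (norm_nonneg _) (h0 k x) 2
  · filter_upwards [hw.weakGrad_ae_eq hU] with x hx
    rw [hx]
    calc frobSq (jacobian (φ k) x - jacobian h x)
        ≤ ∑ i : Fin n, ∑ j : Fin m, (1 / ((k : ℝ) + 1)) ^ 2 := by
          refine Finset.sum_le_sum fun i _ => Finset.sum_le_sum fun j _ => ?_
          rw [Matrix.sub_apply, ← sq_abs]
          exact pow_le_pow_left₀ (abs_nonneg _) (h1 k x i j) 2
      _ = _ := by simp [mul_assoc]

theorem IsInnerDiffeo.lintegral_comp_le {n : ℕ} {Ω : Set (Eu n)} {ψ χ : Eu n → Eu n}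
    (P : IsInnerDiffeo Ω ψ χ) (hΩ : MeasurableSet Ω) (hb : Bornology.IsBounded Ω) :
    ∃ C : ENNReal, C ≠ ⊤ ∧ ∀ f : Eu n → ENNReal,
      ∫⁻ y in Ω, f (χ y) ≤ C * ∫⁻ x in Ω, f x := by
  obtain ⟨C, hC⟩ := hb.isCompact_closure.exists_bound_of_continuousOn P.continuous_det.continuousOn
  refine ⟨ENNReal.ofReal C, ENNReal.ofReal_ne_top, fun f => ?_⟩
  rw [P.lintegral_eq hΩ, ← lintegral_const_mul' _ _ ENNReal.ofReal_ne_top]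
  simp only [P.left_inv]
  refine lintegral_mono_ae ?_
  filter_upwards [ae_restrict_mem hΩ] with x hx
  gcongr
  exact (le_abs_self _).trans (hC x (subset_closure hx))

/-- If `φ_k` approximates `w`, then `φ_k ∘ χ` approximates `w ∘ χ`: the two `L²` errors grow at most
by bounds for `det Dψ` and `|Dχ|²` on the closure of `Ω`. -/
theorem IsInnerDiffeo.memW120_comp {m : ℕ} {Ω : Set (Eu 3)} {ψ χ : Eu 3 → Eu 3}
    (P : IsInnerDiffeo Ω ψ χ) (hΩ : IsOpen Ω) (hb : Bornology.IsBounded Ω)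
    {w : Eu 3 → Eu m} (hw : MemW120 Ω w) : MemW120 Ω (fun y => w (χ y)) := by
  obtain ⟨hw, φ, hφ, h0, h1⟩ := hw
  obtain ⟨hwc, hgrad⟩ := P.memW12_comp hΩ hb hw
  obtain ⟨C, hC, hle⟩ := P.lintegral_comp_le hΩ.measurableSet hb
  have hcj : Continuous fun y => frobSq (jacobian χ y) := by
    have := fun i j => (contDiff_jacobian P.contDiff_inv i j).continuous
    simp only [frobSq]
    fun_prop
  obtain ⟨B, hB⟩ := hb.isCompact_closure.exists_bound_of_continuousOn hcj.continuousOn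
  have hlim : ∀ (A : ENNReal), A ≠ ⊤ → ∀ (f : ℕ → ENNReal), Tendsto f atTop (𝓝 0) →
      Tendsto (fun k => A * f k) atTop (𝓝 0) := fun A hA f hf => by
    simpa using ENNReal.Tendsto.const_mul hf (Or.inr hA)
  refine ⟨hwc, fun k y => φ k (χ y), fun k => P.symm.isTest_comp_left (hφ k), ?_, ?_⟩
  · exact tendsto_of_tendsto_of_tendsto_of_le_of_le tendsto_const_nhds (hlim C hC _ h0)
      (fun _ => zero_le) fun k => hle fun x => ENNReal.ofReal (‖φ k x - w x‖ ^ 2)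
  · refine tendsto_of_tendsto_of_tendsto_of_le_of_le tendsto_const_nhds
      (hlim (ENNReal.ofReal B * C) (ENNReal.mul_ne_top ENNReal.ofReal_ne_top hC) _ h1)
      (fun _ => zero_le) fun k => ?_
    have : ∫⁻ y in Ω, ENNReal.ofReal
          (frobSq (jacobian (fun y => φ k (χ y)) y - weakGrad Ω (fun y => w (χ y)) y)) ≤
        ∫⁻ y in Ω, ENNReal.ofReal B *
          ENNReal.ofReal (frobSq (jacobian (φ k) (χ y) - weakGrad Ω w (χ y))) := by
      refine lintegral_mono_ae ?_
      filter_upwards [hgrad, ae_restrict_mem hΩ.measurableSet] with y hy hyΩ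
      have hBy := (le_abs_self _).trans (hB y (subset_closure hyΩ))
      rw [hy, jacobian_comp ((hφ k).differentiable _) (P.differentiable_inv y), ← Matrix.sub_mul,
        ← ENNReal.ofReal_mul ((frobSq_nonneg _).trans hBy)]
      refine ENNReal.ofReal_le_ofReal ((frobSq_mul_le _ _).trans ?_)
      rw [mul_comm]
      exact mul_le_mul_of_nonneg_right hBy (frobSq_nonneg _)
    refine this.trans ?_
    rw [lintegral_const_mul' _ _ ENNReal.ofReal_ne_top, mul_assoc]
    exact mul_le_mul_right (hle fun x =>
      ENNReal.ofReal (frobSq (jacobian (φ k) x - weakGrad Ω w x))) _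

/-- Composition with an inner diffeomorphism does not change the trace. -/
theorem IsInnerDiffeo.memW120_comp_sub {m : ℕ} {Ω : Set (Eu 3)} {ψ χ : Eu 3 → Eu 3}
    (P : IsInnerDiffeo Ω ψ χ) (hΩ : IsOpen Ω) (hb : Bornology.IsBounded Ω)
    {u g : Eu 3 → Eu m} (hg : ContDiffOn ℝ 1 g Ω) (hu : MemW120 Ω (fun x => u x - g x)) :
    MemW120 Ω (fun y => u (χ y) - g y) := by
  obtain ⟨K, hK, hKΩ, hKχ⟩ := P.symm.compact
  have hsupp : Function.support (fun y => g (χ y) - g y) ⊆ K := by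
    intro y hy
    by_contra hyK
    exact hy (by simp [hKχ y hyK])
  have hts : tsupport (fun y => g (χ y) - g y) ⊆ K := closure_minimal hsupp hK.isClosed
  have hsm : ContDiff ℝ 1 (fun y => g (χ y) - g y) := by
    rw [contDiff_iff_contDiffAt]
    intro y
    by_cases hy : y ∈ Ω
    · have h1 : ContDiffAt ℝ 1 g (χ y) :=
        (hg _ ((P.symm.mem_iff y).2 hy)).contDiffAt (hΩ.mem_nhds ((P.symm.mem_iff y).2 hy))
      exact (h1.comp y (P.contDiff_inv.of_le (by simp)).contDiffAt).sub
        ((hg y hy).contDiffAt (hΩ.mem_nhds hy))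
    · have : (fun y => g (χ y) - g y) =ᶠ[𝓝 y] fun _ => 0 := by
        filter_upwards [hK.isClosed.isOpen_compl.mem_nhds fun h => hy (hKΩ h)] with z hz
        simp [hKχ z hz]
      exact contDiffAt_const.congr_of_eventuallyEq this
  -- `u ∘ χ - g = (u - g) ∘ χ + (g ∘ χ - g)`, and the last term is `C¹` with compact support in `Ω`.
  have h := (P.memW120_comp hΩ hb hu).add hΩ (memW120_of_contDiff hΩ hb hsm
    (HasCompactSupport.of_support_subset_isCompact hK hsupp) (hts.trans hKΩ))
  simpa using h

/-! ### Inner variations of admissible maps -/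

theorem fderiv_prod_comp {ψ : Eu 3 → Eu 3} {f : Eu 3 × Eu 3 → Eu 3} (hf : Differentiable ℝ f)
    (hψ : Differentiable ℝ ψ) (x y a b : Eu 3) :
    fderiv ℝ (fun p : Eu 3 × Eu 3 => f (ψ p.1, p.2)) (x, y) (a, b) =
      fderiv ℝ f (ψ x, y) (fderiv ℝ ψ x a, b) := by
  have h1 : HasFDerivAt (fun p : Eu 3 × Eu 3 => (ψ p.1, p.2))
      (((fderiv ℝ ψ x).comp (ContinuousLinearMap.fst ℝ (Eu 3) (Eu 3))).prod
        (ContinuousLinearMap.snd ℝ (Eu 3) (Eu 3))) (x, y) :=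
    ((hψ x).hasFDerivAt.comp (x, y) hasFDerivAt_fst).prodMk hasFDerivAt_snd
  have h2 := (hf (ψ x, y)).hasFDerivAt.comp (x, y) h1
  rw [show fderiv ℝ (fun p : Eu 3 × Eu 3 => f (ψ p.1, p.2)) (x, y) = _ from h2.fderiv]
  simp

namespace IsInnerDiffeo

variable {Ω : Set (Eu 3)} {ψ χ : Eu 3 → Eu 3} (P : IsInnerDiffeo Ω ψ χ)
include P

theorem det_smul_adjugate (x : Eu 3) :
    (jacobian ψ x).det • (jacobian χ (ψ x)).adjugate = jacobian ψ x := by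
  have h := P.symm.adjugate_eq (ψ x)
  rw [P.left_inv] at h
  rw [h, smul_smul, mul_comm, P.det_mul, one_smul]

/-- In the coordinates `y = ψ(x)` the Jacobian factor cancels `det Dχ` in the determinant term and
turns `cof Dχ` into `(Dψ)ᵀ` in the cofactor term. The latter is exactly the factor that the chain
rule produces in the `x`-derivative of `f(ψ(x), y)`. -/
theorem surfaceFunctional_comp (hΩ : IsOpen Ω) (hb : Bornology.IsBounded Ω) {u : Eu 3 → Eu 3}
    (hu : MemW12 Ω u) {f : Eu 3 × Eu 3 → Eu 3} (hf : Differentiable ℝ f) :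
    surfaceFunctional Ω (fun y => u (χ y)) f =
      surfaceFunctional Ω u (fun p => f (ψ p.1, p.2)) := by
  have hg := (P.memW12_comp hΩ hb hu).2
  have e1 : surfaceFunctional Ω (fun y => u (χ y)) f = ∫ y in Ω,
      ((∑ i, ∑ j, cof (weakGrad Ω u (χ y) * jacobian χ y) i j *
          fderiv ℝ f (y, u (χ y)) (basisVec j, 0) i) +
        (weakGrad Ω u (χ y) * jacobian χ y).det *
          ∑ i, fderiv ℝ f (y, u (χ y)) (0, basisVec i) i) := by
    refine integral_congr_ae ?_
    filter_upwards [hg] with y hy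
    rw [hy]
  rw [e1, P.integral_eq hΩ.measurableSet]
  refine integral_congr_ae (ae_of_all _ fun x => ?_)
  simp only [P.left_inv]
  have hd : (jacobian ψ x).det * (weakGrad Ω u x * jacobian χ (ψ x)).det =
      (weakGrad Ω u x).det := by
    rw [Matrix.det_mul]
    linear_combination (weakGrad Ω u x).det * P.det_mul x
  have hc : (jacobian ψ x).det • cof (weakGrad Ω u x * jacobian χ (ψ x)) =
      cof (weakGrad Ω u x) * (jacobian ψ x).transpose := by
    rw [cof, Matrix.adjugate_mul_distrib, Matrix.transpose_mul, cof,
      ← Matrix.mul_smul, ← Matrix.transpose_smul, P.det_smul_adjugate]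
  have hx : ∀ k i, fderiv ℝ (fun p : Eu 3 × Eu 3 => f (ψ p.1, p.2)) (x, u x) (basisVec k, 0) i =
      ∑ j, jacobian ψ x j k * fderiv ℝ f (ψ x, u x) (basisVec j, 0) i := by
    intro k i
    rw [fderiv_prod_comp hf P.differentiable]
    have h1 : (fderiv ℝ ψ x (basisVec k), (0 : Eu 3)) =
        ∑ j, jacobian ψ x j k • ((basisVec j : Eu 3), (0 : Eu 3)) := by
      have := (EuclideanSpace.basisFun (Fin 3) ℝ).sum_repr (fderiv ℝ ψ x (basisVec k))
      have h2 : fderiv ℝ ψ x (basisVec k) = ∑ j, jacobian ψ x j k • (basisVec j : Eu 3) := by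
        simpa [basisVec, jacobian] using this.symm
      rw [h2]
      ext : 1
      · simp [Prod.fst_sum]
      · simp [Prod.snd_sum]
    rw [h1, map_sum]
    simp only [map_smul, WithLp.ofLp_sum, WithLp.ofLp_smul, Finset.sum_apply, Pi.smul_apply,
      smul_eq_mul]
  have hy : ∀ i, fderiv ℝ (fun p : Eu 3 × Eu 3 => f (ψ p.1, p.2)) (x, u x) (0, basisVec i) i =
      fderiv ℝ f (ψ x, u x) (0, basisVec i) i := by
    intro i
    rw [fderiv_prod_comp hf P.differentiable, map_zero]
  simp only [hx, hy]
  rw [mul_add, ← mul_assoc, hd]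
  congr 1
  have hc' : ∀ i j, (jacobian ψ x).det * cof (weakGrad Ω u x * jacobian χ (ψ x)) i j =
      ∑ k, cof (weakGrad Ω u x) i k * jacobian ψ x j k := by
    intro i j
    have := congrFun (congrFun hc i) j
    simpa [Matrix.mul_apply] using this
  simp only [Finset.mul_sum, ← mul_assoc, hc', Finset.sum_mul]
  exact Finset.sum_congr rfl fun i _ => Finset.sum_comm

/-- The substitution `f ↦ f(ψ(x), y)` preserves test fields and the bound on them. The reverse
inequality follows by exchanging `ψ` and `χ`. -/
theorem surfaceEnergy_comp_le (hΩ : IsOpen Ω) (hb : Bornology.IsBounded Ω) {u : Eu 3 → Eu 3}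
    (hu : MemW12 Ω u) : surfaceEnergy Ω (fun y => u (χ y)) ≤ surfaceEnergy Ω u := by
  refine iSup_le fun f => ?_
  rw [P.surfaceFunctional_comp hΩ hb hu f.2.1.differentiable]
  exact le_iSup (fun f : {f : Eu 3 × Eu 3 → Eu 3 // IsTest (Ω ×ˢ Set.univ) f ∧ ∀ p, ‖f p‖ ≤ 1} =>
    (surfaceFunctional Ω u f.1 : EReal))
    ⟨fun p => f.1 (ψ p.1, p.2), P.isTest_comp f.2.1, fun p => f.2.2 _⟩

theorem surfaceEnergy_comp (hΩ : IsOpen Ω) (hb : Bornology.IsBounded Ω) {u : Eu 3 → Eu 3}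
    (hu : MemW12 Ω u) : surfaceEnergy Ω (fun y => u (χ y)) = surfaceEnergy Ω u := by
  refine le_antisymm (P.surfaceEnergy_comp_le hΩ hb hu) ?_
  have h := P.symm.surfaceEnergy_comp_le hΩ hb (P.memW12_comp hΩ hb hu).1
  simpa only [P.left_inv] using h

theorem injectiveAE_comp {u : Eu 3 → Eu 3} (hu : InjectiveAE Ω u) :
    InjectiveAE Ω (fun y => u (χ y)) := by
  obtain ⟨N, hN, hinj⟩ := hu
  refine ⟨ψ '' N, addHaar_image_eq_zero_of_differentiableOn_of_addHaar_eq_zero volume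
    P.differentiable.differentiableOn hN, ?_⟩
  have hmem : ∀ y ∈ Ω \ ψ '' N, χ y ∈ Ω \ N := fun y hy =>
    ⟨(P.symm.mem_iff y).2 hy.1, fun h => hy.2 ⟨χ y, h, P.right_inv y⟩⟩
  intro y hy z hz h
  exact P.symm.injective (hinj (hmem y hy) (hmem z hz) h)

theorem isAxisymmetricMap_comp (D : IsAxiDomain Ω)
    (hχ : ∀ X ∈ meridian Ω, ∃ Y : Eu 2, 0 < Y 0 ∧ ∀ θ, χ (cyl X θ) = cyl Y θ)
    {u : Eu 3 → Eu 3} (hu : IsAxisymmetricMap Ω u) : IsAxisymmetricMap Ω (fun y => u (χ y)) := by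
  obtain ⟨v, hv, hv0⟩ := hu
  let q : Eu 2 → Eu 2 := fun X => cylProj (χ (cyl X 0))
  have hq : ∀ X ∈ meridian Ω, 0 < q X 0 ∧ ∀ θ, χ (cyl X θ) = cyl (q X) θ := by
    intro X hX
    obtain ⟨Y, hY, h⟩ := hχ X hX
    have : q X = Y := by simp only [q, h, cylProj_cyl hY.le]
    rw [this]
    exact ⟨hY, h⟩
  -- Truncation makes the first component nonnegative everywhere, so composition with `q` keeps the
  -- sign without any control of null sets under `q`.
  let w : Eu 2 → Eu 2 := fun X => !₂[max (v X 0) 0, v X 1]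
  have hvw : ∀ᵐ x ∂(volume.restrict Ω), u x = axiLift w x := by
    filter_upwards [hv, D.quasiMeasurePreserving_cylProj.ae hv0] with x hx h0
    rw [hx]
    have e : w (cylProj x) = v (cylProj x) := by
      ext i; fin_cases i <;> simp [w, h0]
    ext i
    rw [axiLift_apply, axiLift_apply]
    rw [e]
  refine ⟨fun X => w (q X), ?_, ae_of_all _ fun X => by simp [w]⟩
  filter_upwards [(P.quasiMeasurePreserving_inv D.isOpen.measurableSet).ae hvw,
    ae_restrict_mem D.isOpen.measurableSet] with x hx hxΩ
  rw [hx]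
  obtain ⟨θ, hθ⟩ := exists_eq_cyl x
  have hX := D.cylProj_mem hxΩ
  obtain ⟨h0, hc⟩ := hq _ hX
  ext i
  rw [hθ, hc, axiLift_cyl _ h0, axiLift_cyl _ hX.1]

theorem admissibleNcAxi_comp (D : IsAxiDomain Ω)
    (hχ : ∀ X ∈ meridian Ω, ∃ Y : Eu 2, 0 < Y 0 ∧ ∀ θ, χ (cyl X θ) = cyl Y θ)
    {g : Eu 3 → Eu 3} (hg : ContDiffOn ℝ 1 g Ω) {M : ℝ} {u : Eu 3 → Eu 3}
    (hu : AdmissibleNcAxi Ω g M u) : AdmissibleNcAxi Ω g M (fun y => u (χ y)) := by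
  have hm := D.isOpen.measurableSet
  obtain ⟨h12, hgrad⟩ := P.memW12_comp D.isOpen D.isBounded hu.memW12
  have hq := P.quasiMeasurePreserving_inv hm
  refine ⟨⟨h12, P.memW120_comp_sub D.isOpen D.isBounded hg hu.trace_eq, hq.ae hu.bound, ?_,
    P.injectiveAE_comp hu.injective⟩, ?_,
    (P.surfaceEnergy_comp D.isOpen D.isBounded hu.memW12).trans hu.surfaceEnergy_eq_zero,
    P.isAxisymmetricMap_comp D hχ hu.axisymmetric⟩
  · filter_upwards [hgrad, hq.ae hu.det_pos] with y hy h0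
    rw [hy, Matrix.det_mul]
    exact mul_pos h0 (P.symm.det_pos y)
  · have h1 : IntegrableOn (fun y => (weakGrad Ω u (χ y) * jacobian χ y).det) Ω := by
      rw [P.integrableOn_iff hm]
      refine hu.det_integrable.congr (ae_of_all _ fun x => ?_)
      simp only [P.left_inv, Matrix.det_mul]
      linear_combination -(weakGrad Ω u x).det * P.det_mul x
    refine h1.congr ?_
    filter_upwards [hgrad] with y hy
    rw [hy]

end IsInnerDiffeo

/-! ### Perturbations of the identity -/

theorem isCompact_matrix_bounded (n : ℕ) (C : ℝ) :
    IsCompact {A : Matrix (Fin n) (Fin n) ℝ | ∀ i j, |A i j| ≤ C} := by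
  have h : IsCompact (Set.univ.pi fun _ : Fin n => Set.univ.pi fun _ : Fin n => Set.Icc (-C) C) :=
    isCompact_univ_pi fun _ => isCompact_univ_pi fun _ => isCompact_Icc
  refine (congrArg IsCompact (Set.ext fun A => ?_)).mp h
  exact ⟨fun hA i j => abs_le.2 (hA i trivial j trivial),
    fun hA i _ j _ => abs_le.1 (hA i j)⟩

/-- Compactness of the set of matrices with bounded entries makes the threshold for `t` uniform. The
bounds `1/2` and `2` match the window of the growth estimate for `H`. -/
theorem eventually_det_bounds (n : ℕ) (C : ℝ) : ∀ᶠ t in 𝓝 (0 : ℝ),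
    ∀ A : Matrix (Fin n) (Fin n) ℝ, (∀ i j, |A i j| ≤ C) →
      1 / 2 < (1 + t • A).det ∧ (1 + t • A).det < 2 := by
  refine (isCompact_matrix_bounded n C).eventually_forall_of_forall_eventually fun A _ => ?_
  have hc : Continuous fun z : ℝ × Matrix (Fin n) (Fin n) ℝ => (1 + z.1 • z.2).det := by fun_prop
  have h1 : (1 + (0 : ℝ) • A).det = 1 := by simp
  have h := hc.tendsto (0, A)
  simp only [h1] at h
  exact (h.eventually (lt_mem_nhds (by norm_num))).and (h.eventually (gt_mem_nhds (by norm_num)))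

theorem IsTest.exists_jacobian_bound {m n : ℕ} {U : Set (Eu m)} {X : Eu m → Eu n}
    (hX : IsTest U X) : ∃ C : ℝ, ∀ x i j, |jacobian X x i j| ≤ C := by
  choose c hc using fun j : Fin m => (hX.fderiv_apply (basisVec j)).exists_bound
  refine ⟨∑ j, |c j|, fun x i j => ?_⟩
  calc |jacobian X x i j| ≤ ‖fderiv ℝ X x (basisVec j)‖ :=
        PiLp.norm_apply_le (fderiv ℝ X x (basisVec j)) i
    _ ≤ |c j| := (hc j x).trans (le_abs_self _)
    _ ≤ _ := Finset.single_le_sum (fun j _ => abs_nonneg (c j)) (Finset.mem_univ j)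

theorem jacobian_id_add_smul {n : ℕ} {X : Eu n → Eu n} (hX : Differentiable ℝ X) (t : ℝ)
    (x : Eu n) : jacobian (fun x => x + t • X x) x = 1 + t • jacobian X x := by
  have e : fderiv ℝ (fun x => x + t • X x) x =
      ContinuousLinearMap.id ℝ (Eu n) + t • fderiv ℝ X x :=
     ((hasFDerivAt_id x).add ((hX x).hasFDerivAt.const_smul t)).fderiv
  ext i j
  simp [jacobian, e, basisVec, Matrix.one_apply]

/-- The maps `x ↦ x + t X(x)` are inner diffeomorphisms for small `t`. -/
theorem IsTest.eventually_isInnerDiffeo {n : ℕ} {Ω : Set (Eu n)} {X : Eu n → Eu n}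
    (hX : IsTest Ω X) : ∀ᶠ t in 𝓝 (0 : ℝ), ∃ χ, IsInnerDiffeo Ω (fun x => x + t • X x) χ := by
  obtain ⟨L, hL⟩ := ContDiff.lipschitzWith_of_hasCompactSupport hX.2.1 hX.1 (by simp)
  obtain ⟨C, hC⟩ := hX.exists_jacobian_bound
  have hsmall : ∀ᶠ t in 𝓝 (0 : ℝ), |t| * (L : ℝ) < 1 / 2 := by
    have : Continuous fun t : ℝ => |t| * (L : ℝ) := by fun_prop
    exact (this.tendsto 0).eventually (gt_mem_nhds (by simp))
  filter_upwards [hsmall, eventually_det_bounds n C] with t ht hdet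
  have hsm : ContDiff ℝ ∞ (fun x => x + t • X x) := contDiff_id.add (hX.1.const_smul t)
  -- The map differs from the identity by a map of Lipschitz constant at most `1/2`, so it is a
  -- homeomorphism; its derivative is invertible everywhere, so the inverse is smooth.
  have happ : ApproximatesLinearOn (fun x => x + t • X x)
      ((ContinuousLinearEquiv.refl ℝ (Eu n) : Eu n ≃L[ℝ] Eu n) : Eu n →L[ℝ] Eu n)
      Set.univ (1 / 2) := by
    intro x _ y _
    have e : x + t • X x - (y + t • X y) -
        ((ContinuousLinearEquiv.refl ℝ (Eu n) : Eu n ≃L[ℝ] Eu n) : Eu n →L[ℝ] Eu n) (x - y) =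
        t • (X x - X y) := by
      simp only [ContinuousLinearEquiv.coe_coe, ContinuousLinearEquiv.coe_refl', id, smul_sub]
      abel
    rw [e, norm_smul, Real.norm_eq_abs]
    have h1 := hL.norm_sub_le x y
    calc |t| * ‖X x - X y‖ ≤ |t| * (L * ‖x - y‖) := by gcongr
      _ = |t| * L * ‖x - y‖ := by ring
      _ ≤ _ := by push_cast; gcongr
  have hN : Subsingleton (Eu n) ∨ (1 / 2 : NNReal) <
      ‖((ContinuousLinearEquiv.refl ℝ (Eu n)).symm : Eu n →L[ℝ] Eu n)‖₊⁻¹ := by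
    rcases subsingleton_or_nontrivial (Eu n) with h | h
    · exact Or.inl h
    · right
      have : ‖((ContinuousLinearEquiv.refl ℝ (Eu n)).symm : Eu n →L[ℝ] Eu n)‖₊ = 1 := by
        rw [← NNReal.coe_inj, coe_nnnorm]
        exact ContinuousLinearMap.norm_id
      rw [this, inv_one]
      exact NNReal.half_lt_self one_ne_zero
  let Ψ := happ.toHomeomorph _ hN
  have hdetx : ∀ x, 0 < (jacobian (fun x => x + t • X x) x).det := fun x => by
    rw [jacobian_id_add_smul hX.differentiable]
    linarith [(hdet _ (hC x)).1]
  have hne : ∀ x, (fderiv ℝ (fun x => x + t • X x) x).det ≠ 0 := fun x => by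
    rw [det_fderiv]
    exact (hdetx x).ne'
  have hinv : ContDiff ℝ ∞ Ψ.symm := by
    refine Ψ.contDiff_symm (f₀' := fun x =>
      (fderiv ℝ (fun x => x + t • X x) x).toContinuousLinearEquivOfDetNeZero (hne x))
      (fun x => ?_) hsm
    rw [ContinuousLinearMap.coe_toContinuousLinearEquivOfDetNeZero]
    exact (hsm.differentiable (by simp) x).hasFDerivAt
  exact ⟨Ψ.symm, hsm, hinv, Ψ.symm_apply_apply, Ψ.apply_symm_apply,
    ⟨tsupport X, hX.2.1, hX.2.2, fun x hx => by simp [image_eq_zero_of_notMem_tsupport hx]⟩, hdetx⟩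

theorem cyl_add_smul_axiLift (ξ : Eu 2 → Eu 2) (t : ℝ) {Y : Eu 2} (hY : 0 < Y 0) (θ : ℝ) :
    cyl Y θ + t • axiLift ξ (cyl Y θ) = cyl (Y + t • ξ Y) θ := by
  ext i
  rw [PiLp.add_apply, PiLp.smul_apply, axiLift_cyl ξ hY]
  fin_cases i <;> simp [eR, eZ, prof] <;> ring

/-- For small `t` the inverse of `x ↦ x + t X(x)`, `X = ξ₁ e_r + ξ₂ e_z`, is axisymmetric. -/
theorem IsAxiDomain.eventually_axisymmetric_inv {Ω : Set (Eu 3)} (D : IsAxiDomain Ω)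
    {ξ : Eu 2 → Eu 2} (hξ : IsTest (meridian Ω) ξ) : ∀ᶠ t in 𝓝 (0 : ℝ), ∀ χ : Eu 3 → Eu 3,
      IsInnerDiffeo Ω (fun x => x + t • axiLift ξ x) χ →
      ∀ X ∈ meridian Ω, ∃ Y : Eu 2, 0 < Y 0 ∧ ∀ θ, χ (cyl X θ) = cyl Y θ := by
  obtain ⟨r₀, hr₀, hr⟩ := D.exists_radius_le
  obtain ⟨C, hC⟩ := hξ.exists_bound
  -- The displaced radius stays positive, so the displaced point has genuine cylindrical
  -- coordinates.
  have hsmall : ∀ᶠ t in 𝓝 (0 : ℝ), |t| * C < r₀ := by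
    have : Continuous fun t : ℝ => |t| * C := by fun_prop
    exact (this.tendsto 0).eventually (gt_mem_nhds (by simpa using hr₀))
  filter_upwards [hsmall] with t ht χ P X hX
  have hmem : χ (cyl X 0) ∈ Ω := (P.symm.mem_iff _).2 (D.cyl_mem hX 0)
  have hY := D.cylProj_mem hmem
  set Y := cylProj (χ (cyl X 0)) with hYdef
  obtain ⟨η, hη⟩ := exists_eq_cyl (χ (cyl X 0))
  have hpos : 0 < (Y + t • ξ Y) 0 := by
    have h1 : |t * ξ Y 0| ≤ |t| * C := by
      rw [abs_mul]
      gcongr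
      exact (PiLp.norm_apply_le (ξ Y) 0).trans (hC Y)
    have h2 := hr Y hY
    have h3 := neg_abs_le (t * ξ Y 0)
    simp only [PiLp.add_apply, PiLp.smul_apply, smul_eq_mul]
    linarith
  -- Only the existence of the angle `η` of the preimage is known; `cylProj` discards it. Applying
  -- `χ` along the whole circle over `Y` then yields the claim for every angle.
  have hXY : Y + t • ξ Y = X := by
    have h1 := P.right_inv (cyl X 0)
    beta_reduce at h1
    rw [hη, ← hYdef, cyl_add_smul_axiLift ξ t hY.1] at h1
    rw [← cylProj_cyl hpos.le η, h1, cylProj_cyl hX.1.le]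
  refine ⟨Y, hY.1, fun θ => ?_⟩
  have h2 := P.left_inv (cyl Y θ)
  simp only [cyl_add_smul_axiLift ξ t hY.1, hXY] at h2
  exact h2

/-! ### The energy of an inner variation -/

/-- The adjugate of `1 + t A`. -/
def varAdj (A : Matrix (Fin 3) (Fin 3) ℝ) (t : ℝ) : Matrix (Fin 3) (Fin 3) ℝ :=
  1 + t • (A.trace • 1 - A) + t ^ 2 • A.adjugate

/-- The derivative of `varAdj A`. -/
def varAdjDeriv (A : Matrix (Fin 3) (Fin 3) ℝ) (t : ℝ) : Matrix (Fin 3) (Fin 3) ℝ :=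
  (A.trace • 1 - A) + (2 * t) • A.adjugate

/-- The determinant of `1 + t A`. -/
def varDet (A : Matrix (Fin 3) (Fin 3) ℝ) (t : ℝ) : ℝ :=
  1 + t * A.trace + t ^ 2 * A.adjugate.trace + t ^ 3 * A.det

/-- The derivative of `varDet A`. -/
def varDetDeriv (A : Matrix (Fin 3) (Fin 3) ℝ) (t : ℝ) : ℝ :=
  A.trace + 2 * t * A.adjugate.trace + 3 * t ^ 2 * A.det

theorem adjugate_one_add_smul (A : Matrix (Fin 3) (Fin 3) ℝ) (t : ℝ) :
    (1 + t • A).adjugate = varAdj A t := by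
  ext i j
  simp only [varAdj, Matrix.adjugate_fin_three, Matrix.trace_fin_three]
  fin_cases i <;> fin_cases j <;> simp <;> ring

theorem det_one_add_smul_eq (A : Matrix (Fin 3) (Fin 3) ℝ) (t : ℝ) :
    (1 + t • A).det = varDet A t := by
  simp only [varDet, Matrix.det_fin_three, Matrix.adjugate_fin_three, Matrix.trace_fin_three]
  simp
  ring

theorem hasDerivAt_varAdj (A : Matrix (Fin 3) (Fin 3) ℝ) (t : ℝ) (i j : Fin 3) :
    HasDerivAt (fun t => varAdj A t i j) (varAdjDeriv A t i j) t := by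
  have h := (((hasDerivAt_const t ((1 : Matrix (Fin 3) (Fin 3) ℝ) i j)).add
    ((hasDerivAt_id t).mul_const ((A.trace • 1 - A : Matrix (Fin 3) (Fin 3) ℝ) i j))).add
    ((hasDerivAt_pow 2 t).mul_const (A.adjugate i j)))
  refine h.congr_deriv ?_
  simp [varAdjDeriv]

theorem hasDerivAt_varDet (A : Matrix (Fin 3) (Fin 3) ℝ) (t : ℝ) :
    HasDerivAt (varDet A) (varDetDeriv A t) t := by
  have h := (((hasDerivAt_const t (1 : ℝ)).add ((hasDerivAt_id t).mul_const A.trace)).add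
    ((hasDerivAt_pow 2 t).mul_const A.adjugate.trace)).add ((hasDerivAt_pow 3 t).mul_const A.det)
  refine h.congr_deriv ?_
  simp [varDetDeriv]

/-- The energy density of the inner variation with gradient `1 + t A`, in the reference
coordinates, at a point where the gradient is `F`. -/
def varDensity (H : ℝ → ℝ) (F A : Matrix (Fin 3) (Fin 3) ℝ) (t : ℝ) : ℝ :=
  frobSq (F * varAdj A t) / varDet A t + varDet A t * H (F.det / varDet A t)

/-- The derivative of `varDensity H F A`. -/
def varDensityDeriv (H : ℝ → ℝ) (F A : Matrix (Fin 3) (Fin 3) ℝ) (t : ℝ) : ℝ :=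
  ((2 * ∑ i, ∑ j, (F * varAdj A t) i j * (F * varAdjDeriv A t) i j) * varDet A t -
      frobSq (F * varAdj A t) * varDetDeriv A t) / varDet A t ^ 2 +
    varDetDeriv A t * (H (F.det / varDet A t) -
      deriv H (F.det / varDet A t) * (F.det / varDet A t))

theorem hasDerivAt_varDensity {H : ℝ → ℝ} (hH : IsStoredEnergy H)
    {F A : Matrix (Fin 3) (Fin 3) ℝ} {t : ℝ} (hF : 0 < F.det) (ht : 0 < varDet A t) :
    HasDerivAt (varDensity H F A) (varDensityDeriv H F A t) t := by
  have hd := hasDerivAt_varDet A t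
  have hm : ∀ i j, HasDerivAt (fun t => (F * varAdj A t) i j) ((F * varAdjDeriv A t) i j) t := by
    intro i j
    simp only [Matrix.mul_apply]
    exact HasDerivAt.fun_sum fun k _ => (hasDerivAt_varAdj A t k j).const_mul (F i k)
  have hf : HasDerivAt (fun t => frobSq (F * varAdj A t))
      (2 * ∑ i, ∑ j, (F * varAdj A t) i j * (F * varAdjDeriv A t) i j) t := by
    simp only [frobSq, Finset.mul_sum]
    refine HasDerivAt.fun_sum fun i _ => HasDerivAt.fun_sum fun j _ => ?_
    refine ((hm i j).pow 2).congr_deriv ?_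
    simp [mul_assoc]
  have hq : HasDerivAt (fun t => F.det / varDet A t)
      (-(F.det * varDetDeriv A t) / varDet A t ^ 2) t := by
    refine ((hasDerivAt_const t F.det).div hd ht.ne').congr_deriv ?_
    ring
  have hHd := (hH.differentiableAt (div_pos hF ht)).hasDerivAt.comp t hq
  refine ((hf.div hd ht.ne').add (hd.mul hHd)).congr_deriv ?_
  rw [varDensityDeriv]
  congr 1
  simp only [Function.comp]
  field_simp
  ring

/-- A polynomial identity in the entries of `F` and `A`. The minus sign appears because `u` is
composed with the inverse of `id + tX`. -/
theorem varDensityDeriv_zero (H : ℝ → ℝ) (F A : Matrix (Fin 3) (Fin 3) ℝ) :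
    varDensityDeriv H F A 0 = -∑ i, ∑ j, ((2 : ℝ) • (F.transpose * F) +
      (deriv H F.det * F.det - frobSq F - H F.det) • (1 : Matrix (Fin 3) (Fin 3) ℝ)) i j * A i j := by
  have h1 : varAdj A 0 = 1 := by simp [varAdj]
  have h2 : varAdjDeriv A 0 = A.trace • 1 - A := by simp [varAdjDeriv]
  have h3 : varDet A 0 = 1 := by simp [varDet]
  have h4 : varDetDeriv A 0 = A.trace := by simp [varDetDeriv]
  rw [varDensityDeriv, h1, h2, h3, h4]
  -- Nothing about the determinant is used, so it is kept as an independent variable.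
  generalize hδ : F.det = δ
  simp only [frobSq, Fin.sum_univ_three, Matrix.mul_apply, Matrix.trace_fin_three,
    Matrix.add_apply, Matrix.smul_apply, Matrix.sub_apply, Matrix.one_apply, Matrix.transpose_apply,
    smul_eq_mul]
  simp
  ring

theorem continuous_varAdj :
    Continuous fun z : ℝ × Matrix (Fin 3) (Fin 3) ℝ => varAdj z.2 z.1 := by
  have hadj : Continuous fun z : ℝ × Matrix (Fin 3) (Fin 3) ℝ => z.2.adjugate :=
    continuous_snd.matrix_adjugate
  have htr : Continuous fun z : ℝ × Matrix (Fin 3) (Fin 3) ℝ => z.2.trace :=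
    continuous_snd.matrix_trace
  unfold varAdj
  fun_prop

theorem continuous_varDet :
    Continuous fun z : ℝ × Matrix (Fin 3) (Fin 3) ℝ => varDet z.2 z.1 := by
  simp only [← det_one_add_smul_eq]
  fun_prop

theorem exists_var_bound (C : ℝ) : ∃ K : ℝ, 0 < K ∧ ∀ t : ℝ, |t| ≤ 1 →
    ∀ A : Matrix (Fin 3) (Fin 3) ℝ, (∀ i j, |A i j| ≤ C) →
      frobSq (varAdj A t) ≤ K ∧ frobSq (varAdjDeriv A t) ≤ K ∧ |varDetDeriv A t| ≤ K := by
  have hK := (isCompact_Icc (a := (-1 : ℝ)) (b := 1)).prod (isCompact_matrix_bounded 3 C)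
  have hadj : Continuous fun z : ℝ × Matrix (Fin 3) (Fin 3) ℝ => z.2.adjugate :=
    continuous_snd.matrix_adjugate
  have hdet : Continuous fun z : ℝ × Matrix (Fin 3) (Fin 3) ℝ => z.2.det :=
    continuous_snd.matrix_det
  have htr : Continuous fun z : ℝ × Matrix (Fin 3) (Fin 3) ℝ => z.2.trace :=
    continuous_snd.matrix_trace
  have htr' : Continuous fun z : ℝ × Matrix (Fin 3) (Fin 3) ℝ => z.2.adjugate.trace :=
    hadj.matrix_trace
  have hfrob : ∀ {f : ℝ × Matrix (Fin 3) (Fin 3) ℝ → Matrix (Fin 3) (Fin 3) ℝ}, Continuous f →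
      Continuous fun z => frobSq (f z) := by
    intro f hf
    have : ∀ i j, Continuous fun z => f z i j := fun i j => hf.matrix_elem i j
    simp only [frobSq]
    fun_prop
  have c1 : Continuous fun z : ℝ × Matrix (Fin 3) (Fin 3) ℝ => frobSq (varAdj z.2 z.1) :=
    hfrob continuous_varAdj
  have c2 : Continuous fun z : ℝ × Matrix (Fin 3) (Fin 3) ℝ => frobSq (varAdjDeriv z.2 z.1) := by
    refine hfrob ?_
    unfold varAdjDeriv
    fun_prop
  have c3 : Continuous fun z : ℝ × Matrix (Fin 3) (Fin 3) ℝ => varDetDeriv z.2 z.1 := by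
    unfold varDetDeriv
    fun_prop
  obtain ⟨K₁, h1⟩ := hK.exists_bound_of_continuousOn c1.continuousOn
  obtain ⟨K₂, h2⟩ := hK.exists_bound_of_continuousOn c2.continuousOn
  obtain ⟨K₃, h3⟩ := hK.exists_bound_of_continuousOn c3.continuousOn
  refine ⟨|K₁| + |K₂| + |K₃| + 1, by positivity, fun t ht A hA => ?_⟩
  have hz : (t, A) ∈ Set.Icc (-1 : ℝ) 1 ×ˢ {A : Matrix (Fin 3) (Fin 3) ℝ | ∀ i j, |A i j| ≤ C} :=
    ⟨abs_le.1 ht, hA⟩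
  have b1 := (le_abs_self _).trans (h1 _ hz)
  have b2 := (le_abs_self _).trans (h2 _ hz)
  have b3 := h3 _ hz
  rw [Real.norm_eq_abs] at b3
  have := le_abs_self K₁
  have := le_abs_self K₂
  have := le_abs_self K₃
  have := abs_nonneg K₁
  have := abs_nonneg K₂
  have := abs_nonneg K₃
  exact ⟨by linarith, by linarith, by linarith⟩

/-- For small `t` the determinant `d` of `1 + tA` lies in `(1/2, 2)`, so `det F / d` is in the
window where the growth estimate around `det F` applies. The bound, uniform in `t` and `A`, is the
dominating function for differentiation under the integral. -/
theorem exists_varDensity_bound {H : ℝ → ℝ} (hH : IsStoredEnergy H) (C : ℝ) :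
    ∃ K ε : ℝ, 0 < K ∧ 0 < ε ∧ ∀ t : ℝ, |t| < ε → ∀ F A : Matrix (Fin 3) (Fin 3) ℝ,
      (∀ i j, |A i j| ≤ C) → 0 < F.det → 0 < varDet A t ∧
        |varDensity H F A t| ≤ K * (frobSq F + 1 + H F.det) ∧
        |varDensityDeriv H F A t| ≤ K * (frobSq F + 1 + H F.det) := by
  obtain ⟨B, hB, hb⟩ := hH.exists_bound
  obtain ⟨L, hL, hl⟩ := exists_var_bound C
  obtain ⟨ε, hε, hdet⟩ := Metric.eventually_nhds_iff.1 (eventually_det_bounds 3 C)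
  -- The constant majorizes both final estimates at once; `ε` is capped at `1` because the bound `L`
  -- holds for `|t| ≤ 1`.
  refine ⟨16 * L + 4 * L ^ 2 + 2 * B + 2 * L * B, min ε 1, by positivity, by positivity,
    fun t ht F A hA hF => ?_⟩
  have ht1 : |t| ≤ 1 := (ht.trans_le (min_le_right _ _)).le
  have htε : dist t 0 < ε := by
    rw [Real.dist_0_eq_abs]
    exact ht.trans_le (min_le_left _ _)
  obtain ⟨hd1, hd2⟩ := hdet htε A hA
  obtain ⟨hl1, hl2, hl3⟩ := hl t ht1 A hA
  rw [det_one_add_smul_eq] at hd1 hd2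
  set d := varDet A t with hd
  have hd0 : 0 < d := by linarith
  have hf := frobSq_nonneg F
  have hHδ := hH.nonneg _ hF
  obtain ⟨hb1, hb2⟩ := hb F.det (F.det / d) hF
    (by rw [div_le_div_iff₀ (by norm_num) hd0]; nlinarith)
    (by rw [div_le_iff₀ hd0]; nlinarith)
  have ha : 0 < F.det / d := div_pos hF hd0
  have hP0 := frobSq_nonneg (F * varAdj A t)
  have hP : frobSq (F * varAdj A t) ≤ frobSq F * L :=
    (frobSq_mul_le _ _).trans (mul_le_mul_of_nonneg_left hl1 hf)
  have hQ : frobSq (F * varAdjDeriv A t) ≤ frobSq F * L :=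
    (frobSq_mul_le _ _).trans (mul_le_mul_of_nonneg_left hl2 hf)
  have hPQ : |2 * ∑ i, ∑ j, (F * varAdj A t) i j * (F * varAdjDeriv A t) i j| ≤
      2 * (frobSq F * L) := by
    have h1 : |2 * ∑ i, ∑ j, (F * varAdj A t) i j * (F * varAdjDeriv A t) i j| ≤
        frobSq (F * varAdj A t) + frobSq (F * varAdjDeriv A t) := by
      simp only [frobSq, Finset.mul_sum, ← Finset.sum_add_distrib]
      refine (Finset.abs_sum_le_sum_abs _ _).trans (Finset.sum_le_sum fun i _ => ?_)
      refine (Finset.abs_sum_le_sum_abs _ _).trans (Finset.sum_le_sum fun j _ => ?_)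
      rw [abs_le]
      constructor
      · nlinarith [sq_nonneg ((F * varAdj A t) i j + (F * varAdjDeriv A t) i j)]
      · nlinarith [sq_nonneg ((F * varAdj A t) i j - (F * varAdjDeriv A t) i j)]
    linarith
  have hfL : 0 ≤ frobSq F * L := by positivity
  have hBH : 0 ≤ B * (1 + H F.det) := by positivity
  refine ⟨hd0, ?_, ?_⟩
  · have h1 : |frobSq (F * varAdj A t) / d| ≤ 2 * (frobSq F * L) := by
      rw [abs_of_nonneg (by positivity), div_le_iff₀ hd0]
      nlinarith
    have h2 : |d * H (F.det / d)| ≤ 2 * (B * (1 + H F.det)) := by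
      rw [abs_mul, abs_of_pos hd0]
      exact mul_le_mul hd2.le hb2 (abs_nonneg _) (by norm_num)
    calc |varDensity H F A t| ≤ 2 * (frobSq F * L) + 2 * (B * (1 + H F.det)) :=
          (abs_add_le _ _).trans (add_le_add h1 h2)
      _ ≤ (2 * L + 2 * B) * (frobSq F + 1 + H F.det) := by nlinarith
      _ ≤ _ := by
          refine mul_le_mul_of_nonneg_right ?_ (by positivity)
          nlinarith [mul_pos hL hB, sq_nonneg L]
  · have h1 : |((2 * ∑ i, ∑ j, (F * varAdj A t) i j * (F * varAdjDeriv A t) i j) * d -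
        frobSq (F * varAdj A t) * varDetDeriv A t) / d ^ 2| ≤
        4 * (4 * (frobSq F * L) + frobSq F * L * L) := by
      rw [abs_div, abs_of_pos (show 0 < d ^ 2 by positivity), div_le_iff₀ (by positivity)]
      have h2 : |(2 * ∑ i, ∑ j, (F * varAdj A t) i j * (F * varAdjDeriv A t) i j) * d| ≤
          2 * (frobSq F * L) * 2 := by
        rw [abs_mul, abs_of_pos hd0]
        exact mul_le_mul hPQ hd2.le hd0.le (by positivity)
      have h3 : |frobSq (F * varAdj A t) * varDetDeriv A t| ≤ frobSq F * L * L := by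
        rw [abs_mul, abs_of_nonneg hP0]
        exact mul_le_mul hP hl3 (abs_nonneg _) (by positivity)
      have h4 := (abs_sub _ _).trans (add_le_add h2 h3)
      have h5 : 0 ≤ 4 * (frobSq F * L) + frobSq F * L * L := by positivity
      have h6 : 1 / 4 ≤ d ^ 2 := by nlinarith
      nlinarith
    have h2 : |varDetDeriv A t * (H (F.det / d) - deriv H (F.det / d) * (F.det / d))| ≤
        L * (2 * (B * (1 + H F.det))) := by
      rw [abs_mul]
      refine mul_le_mul hl3 ?_ (abs_nonneg _) hL.le
      refine (abs_sub _ _).trans ?_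
      rw [abs_mul (deriv H _), abs_of_pos ha]
      linarith
    calc |varDensityDeriv H F A t| ≤ 4 * (4 * (frobSq F * L) + frobSq F * L * L) +
          L * (2 * (B * (1 + H F.det))) := (abs_add_le _ _).trans (add_le_add h1 h2)
      _ ≤ (16 * L + 4 * L ^ 2 + 2 * L * B) * (frobSq F + 1 + H F.det) := by
          have := mul_pos hL hB
          nlinarith [mul_nonneg this.le hf, mul_nonneg hL.le hHδ,
            mul_nonneg (sq_nonneg L) hHδ, sq_nonneg L]
      _ ≤ _ := by
          refine mul_le_mul_of_nonneg_right ?_ (by positivity)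
          linarith

theorem frobSq_smul {m n : ℕ} (c : ℝ) (A : Matrix (Fin n) (Fin m) ℝ) :
    frobSq (c • A) = c ^ 2 * frobSq A := by
  simp [frobSq, mul_pow, Finset.mul_sum]

/-- Pulling the integral back to the original coordinates leaves `u` alone and puts the dependence
on `t` into the explicit density. At `ψ(x)` the matrix `Dχ` is `adj(1 + tA) / d`, so the weight `d`
leaves a single `1 / d` in front of the squared norm. -/
theorem IsInnerDiffeo.energy_comp {H : ℝ → ℝ} {Ω : Set (Eu 3)} {X χ : Eu 3 → Eu 3} {t : ℝ}
    (P : IsInnerDiffeo Ω (fun x => x + t • X x) χ) (hX : Differentiable ℝ X) (hΩ : IsOpen Ω)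
    (hb : Bornology.IsBounded Ω) {u : Eu 3 → Eu 3} (hu : MemW12 Ω u) :
    energy H Ω (fun y => u (χ y)) =
      ∫⁻ x in Ω, ENNReal.ofReal (varDensity H (weakGrad Ω u x) (jacobian X x) t) := by
  have hg := (P.memW12_comp hΩ hb hu).2
  have e1 : energy H Ω (fun y => u (χ y)) = ∫⁻ y in Ω, ENNReal.ofReal
      (frobSq (weakGrad Ω u (χ y) * jacobian χ y) +
        H (weakGrad Ω u (χ y) * jacobian χ y).det) := by
    refine lintegral_congr_ae ?_
    filter_upwards [hg] with y hy
    rw [hy]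
  rw [e1, P.lintegral_eq hΩ.measurableSet]
  refine lintegral_congr fun x => ?_
  have hd0 := P.det_pos x
  have hdm := P.det_mul x
  have hadj := P.adjugate_eq x
  simp only [P.left_inv]
  rw [← ENNReal.ofReal_mul hd0.le]
  congr 1
  rw [jacobian_id_add_smul hX] at hadj hd0 hdm ⊢
  rw [adjugate_one_add_smul, det_one_add_smul_eq] at hadj
  rw [det_one_add_smul_eq] at hd0 hdm ⊢
  rw [varDensity, hadj, Matrix.mul_smul, frobSq_smul, Matrix.det_mul]
  have e2 : (jacobian χ (x + t • X x)).det = (varDet (jacobian X x) t)⁻¹ :=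
    eq_inv_of_mul_eq_one_left hdm
  rw [e2, div_eq_mul_inv]
  field_simp

theorem aestronglyMeasurable_varDensity {H : ℝ → ℝ} (hH : IsStoredEnergy H) {Ω : Set (Eu 3)}
    {X u : Eu 3 → Eu 3} {t : ℝ} (hΩ : IsOpen Ω) (hu : MemW12 Ω u) (hX : ContDiff ℝ ∞ X)
    (hdet : ∀ᵐ x ∂(volume.restrict Ω), 0 < (weakGrad Ω u x).det)
    (hd : ∀ x, 0 < varDet (jacobian X x) t) :
    AEStronglyMeasurable (fun x => varDensity H (weakGrad Ω u x) (jacobian X x) t)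
      (volume.restrict Ω) := by
  have hj : Continuous fun x => jacobian X x :=
    continuous_matrix fun i j => (contDiff_jacobian hX i j).continuous
  have hz : Continuous fun x => (t, jacobian X x) := continuous_const.prodMk hj
  have hc1 : Continuous fun x => varDet (jacobian X x) t := continuous_varDet.comp hz
  have hc2 : Continuous fun x => varAdj (jacobian X x) t := continuous_varAdj.comp hz
  have hdm := aestronglyMeasurable_det hΩ hu
  have hq : AEStronglyMeasurable (fun x => (weakGrad Ω u x).det / varDet (jacobian X x) t)
      (volume.restrict Ω) := hdm.div₀ hc1.aestronglyMeasurable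
  have hHm := hH.aestronglyMeasurable_comp hq (hdet.mono fun x hx => div_pos hx (hd x))
  have hm : ∀ i j, AEStronglyMeasurable (fun x => (weakGrad Ω u x * varAdj (jacobian X x) t) i j)
      (volume.restrict Ω) := by
    intro i j
    simp only [Matrix.mul_apply]
    exact Finset.aestronglyMeasurable_fun_sum _ fun k _ =>
      (hu.memLp_weakGrad hΩ i k).aestronglyMeasurable.mul
        (hc2.matrix_elem k j).aestronglyMeasurable
  have hfm : AEStronglyMeasurable (fun x => frobSq (weakGrad Ω u x * varAdj (jacobian X x) t))
      (volume.restrict Ω) :=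
    Finset.aestronglyMeasurable_fun_sum _ fun i _ => Finset.aestronglyMeasurable_fun_sum _
      fun j _ => (hm i j).pow 2
  exact (hfm.div₀ hc1.aestronglyMeasurable).add (hc1.aestronglyMeasurable.mul hHm)

/-- A minimizer is stationary with respect to axisymmetric inner variations. -/
theorem IsMinimizer.axiStationary {H : ℝ → ℝ} (hH : IsStoredEnergy H) {Ω : Set (Eu 3)}
    (D : IsAxiDomain Ω) {g : Eu 3 → Eu 3} (hg : ContDiffOn ℝ 1 g Ω) {M : ℝ} {u : Eu 3 → Eu 3}
    (hu : IsMinimizer H Ω g M u) : AxiStationary Ω (energyMomentum H Ω u) := by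
  intro ξ hξ
  have := D.finite_volume
  have hX : IsTest Ω (axiLift ξ) := isTest_axiLift D hξ
  have hw := hu.mem.memW12
  have hdet := hu.mem.det_pos
  have hE := hu.energy_lt_top
  obtain ⟨C, hC⟩ := hX.exists_jacobian_bound
  obtain ⟨K, ε, hK, hε, hb⟩ := exists_varDensity_bound hH C
  let e : ℝ → Eu 3 → ℝ := fun t x => varDensity H (weakGrad Ω u x) (jacobian (axiLift ξ) x) t
  have hbi : Integrable (fun x => K * (frobSq (weakGrad Ω u x) + 1 + H (weakGrad Ω u x).det))
      (volume.restrict Ω) :=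
    (((integrableOn_frobSq D.isOpen hw).add (integrable_const 1)).add
      (integrableOn_storedEnergy hH D.isOpen hw hdet hE)).const_mul K
  -- `F = 1` serves only as some matrix with positive determinant; positivity of `varDet` does not
  -- involve it.
  have hdpos : ∀ t, |t| < ε → ∀ x, 0 < varDet (jacobian (axiLift ξ) x) t := fun t ht x =>
    (hb t ht 1 _ (hC x) (by simp)).1
  have hmeas : ∀ t, |t| < ε → AEStronglyMeasurable (e t) (volume.restrict Ω) := fun t ht =>
    aestronglyMeasurable_varDensity hH D.isOpen hw hX.1 hdet (hdpos t ht)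
  have hint : ∀ t, |t| < ε → Integrable (e t) (volume.restrict Ω) := fun t ht =>
    hbi.mono' (hmeas t ht) (hdet.mono fun x hx => (hb t ht _ _ (hC x) hx).2.1)
  have hpos : ∀ t, |t| < ε → 0 ≤ᵐ[volume.restrict Ω] e t := fun t ht => by
    filter_upwards [hdet] with x hx
    have hd := hdpos t ht x
    exact add_nonneg (div_nonneg (frobSq_nonneg _) hd.le)
      (mul_nonneg hd.le (hH.nonneg _ (div_pos hx hd)))
  have hderiv0 : ∀ x, varDensityDeriv H (weakGrad Ω u x) (jacobian (axiLift ξ) x) 0 =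
      -∑ i, ∑ j, energyMomentum H Ω u x i j * jacobian (axiLift ξ) x i j := fun x =>
    varDensityDeriv_zero _ _ _
  have hsmall : ∀ᶠ t in 𝓝 (0 : ℝ), |t| < ε := by
    filter_upwards [Metric.ball_mem_nhds (0 : ℝ) hε] with t ht using by simpa using ht
  have hder := (hasDerivAt_integral_of_dominated_loc_of_deriv_le (μ := volume.restrict Ω)
    (F := e) (x₀ := 0) (F' := fun t x =>
      varDensityDeriv H (weakGrad Ω u x) (jacobian (axiLift ξ) x) t)
    (bound := fun x => K * (frobSq (weakGrad Ω u x) + 1 + H (weakGrad Ω u x).det))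
    (Metric.ball_mem_nhds 0 hε) (hsmall.mono hmeas) (hint 0 (by simpa using hε))
    (by
      simp only [hderiv0]
      refine (Finset.aestronglyMeasurable_fun_sum _ fun i _ =>
        Finset.aestronglyMeasurable_fun_sum _ fun j _ => ?_).neg
      exact (integrableOn_energyMomentum hH D hw hdet hE i j).aestronglyMeasurable.mul
        (contDiff_jacobian hX.1 i j).continuous.aestronglyMeasurable)
    (hdet.mono fun x hx t ht => (hb t (by simpa using ht) _ _ (hC x) hx).2.2) hbi
    (hdet.mono fun x hx t ht => hasDerivAt_varDensity hH hx
      (hdpos t (by simpa using ht) x))).2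
  -- For small `t` the competitor `u ∘ χ` is admissible; both energies are finite, so the inequality
  -- in `[0, ∞]` becomes one between real integrals.
  have hmin : IsLocalMin (fun t => ∫ x in Ω, e t x) 0 := by
    filter_upwards [hsmall, hX.eventually_isInnerDiffeo, D.eventually_axisymmetric_inv hξ]
      with t ht ⟨χ, P⟩ haxi
    have hle := hu.le _ (P.admissibleNcAxi_comp D (haxi χ P) hg hu.mem)
    rw [P.energy_comp hX.differentiable D.isOpen D.isBounded hw] at hle
    have e0 : energy H Ω u = ∫⁻ x in Ω, ENNReal.ofReal (e 0 x) := by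
      refine lintegral_congr fun x => ?_
      simp [e, varDensity, varAdj, varDet]
    have h0 : |(0 : ℝ)| < ε := by simpa using hε
    rw [e0, ← ofReal_integral_eq_lintegral_ofReal (hint 0 h0) (hpos 0 h0),
      ← ofReal_integral_eq_lintegral_ofReal (hint t ht) (hpos t ht)] at hle
    exact (ENNReal.ofReal_le_ofReal_iff (integral_nonneg_of_ae (hpos t ht))).1 hle
  have hzero := hmin.hasDerivAt_eq_zero hder
  simp only [hderiv0, integral_neg, neg_eq_zero] at hzero
  exact hzero

end NeoHookean

end

theorem mainTheorem2 (H : ℝ → ℝ) (hH : IsStoredEnergy H)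
    (Ω Ω' : Set (Eu 3))
    (hΩ : IsSmoothBoundedDomain Ω) (hΩaxi : IsAxisymmetricSet Ω)
    (hΩ' : IsSmoothBoundedDomain Ω') (hΩ'axi : IsAxisymmetricSet Ω')
    (hΩaxis : ∃ r₀ : ℝ, 0 < r₀ ∧ ∀ x ∈ Ω, r₀ ≤ cylRadius x)
    (g : Eu 3 → Eu 3) (hg : IsC1DiffeoClosure Ω Ω' g) (hgaxi : IsAxisymmetricMap Ω g)
    (M : ℝ) (hM : 0 < M) :
    (∀ u v, IsMinimizer H Ω g M u → IsProfile Ω u v →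
      MemW12 (meridian Ω) v ∧ ReducedEquations H Ω v ∧
        DistribDivFree Ω (energyMomentum H Ω u)) ∧
    (∀ u v, AdmissibleNcAxi Ω g M u → energy H Ω u < ⊤ → IsProfile Ω u v →
      (ReducedEquations H Ω v ↔ DistribDivFree Ω (energyMomentum H Ω u))) := by
  have D : IsAxiDomain Ω := ⟨hΩ.isOpen, hΩ.isBounded, hΩaxi, hΩaxis⟩
  refine ⟨fun u v hu hv => ?_, fun u v hu hE hv => ?_⟩
  · have htfae := reducedEquations_tfae hH D hu.mem.memW12 hu.mem.det_pos hu.energy_lt_top hv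
    have hst := hu.axiStationary hH D (hg.1.mono subset_closure)
    exact ⟨(hv.memW12 D hu.mem.memW12).1, (htfae.out 0 2).2 hst, (htfae.out 1 2).2 hst⟩
  · exact (reducedEquations_tfae hH D hu.memW12 hu.det_pos hE hv).out 0 1
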